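/- Let $a>0$, $\mu>0$, let $B_1$ be the open unit ball of $\mathbb R^3$ with points $x=(x_1,x_2,z)$ and cylindrical coordinates $(\rho,z,\theta)$, let $B_1^+=B_1\cap\{z>0\}$ and let $T=\{(x_1,x_2,0): x_1^2+x_2^2<1\}$ be its flat boundary. Put $\mathbb D=\{(\rho,z):\rho>0,\ \rho^2+z^2<1\}$, $\mathbb D^+=\mathbb D\cap\{z>0\}$, $\mathrm I_-=(-1,-\tfrac12]$, $\mathrm I_+=[-\tfrac12,1)$, and $$H_a=\frac{3+\sqrt{9+8a^2}}{2\sqrt2\,a},\qquad D_a=\frac{27}{16a^3}\Big[1+\frac{4a^2}{3}+\Big(1+\frac{8a^2}{9}\Big)^{3/2}\Big].$$ For $V\in\mathbb R^3$ let $\mathscr L[V]=(V_1\cos2\theta,V_1\sin2\theta,V_2,V_3\cos\theta,V_3\sin\theta)^\top$, and, with $\phi$ the polar angle ($\rho=r\sin\phi$, $z=r\cos\phi$), let $U_a^*=H_a\big(\tfrac{\sqrt3}{2}\sin^2\phi,\ \tfrac32(\cos^2\phi-\tfrac13),\ \sqrt3\sin\phi\cos\phi\big)^\top$. For $w\in\mathbb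 R^5$ and $u\in\mathbb R^3$ let $$S[w]=-w_3(w_1^2+w_2^2)+\sqrt3\,w_2w_4w_5+\tfrac12w_3(w_4^2+w_5^2)+\tfrac13w_3^3+\tfrac{\sqrt3}{2}w_1(w_4^2-w_5^2),$$ $$P[u]=-u_1^2u_2+\tfrac{\sqrt3}{2}u_1u_3^2+\tfrac13u_2^3+\tfrac12u_2u_3^2,$$ and for a $5$-vector field $w$ on $B_1$ let $$\mathcal E_{a,\mu}[w]=\int_{B_1}|\nabla w|^2+\mu\Big[D_a-3\sqrt2\,S[w]+\frac a2\big(|w|^2-1\big)^2\Big].$$ Let $\mathscr F_a^s$ be the set of all $w\in H^1(B_1;\mathbb R^5)$ with $\mathcal E_{a,\mu}[w]<\infty$ and $w=\mathscr L[U_a^*]$ on $\partial B_1$ such that $w=\mathscr L[u]$ for some $u=u(\rho,z)\in\mathbb R^3$ with $u_1,u_2$ even and $u_3$ odd in $z$. For $b\in\mathrm I_-$ and $c\in\mathrm I_+$ let $$\mathscr F_{a,b}^+=\{w\in\mathscr F_a^s: w_3\ge bH_a\text{ on }T\},\qquad \mathscr F_{a,c}^-=\{w\in\mathscr F_a^s: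 w_3\le cH_a\text{ on }T\}.$$ Boundary values and the inequalities on $T$ are understood in the sense of traces, and fields are identified when they agree almost everywhere. **Proposition.** For every $b\in\mathrm I_-$ and $c\in\mathrm I_+$ the energy $\mathcal E_{a,\mu}$ attains its minimum over $\mathscr F_{a,b}^+$ and its minimum over $\mathscr F_{a,c}^-$. Every minimizer $w$ of either problem is of the form $w=\mathscr L[u]$ with $u:\mathbb D\to\mathbb R^3$ satisfying, in the weak sense in $\mathbb D^+$ (with $D=(\partial_\rho,\partial_z)$), $$-\frac1\rho D\cdot(\rho\,Du)+\frac1{\rho^2}\begin{pmatrix}4u_1\\0\\u_3\end{pmatrix}=\mu\Big\{\frac3{\sqrt2}\nabla_uP[u]-a\big(|u|^2-1\big)u\Big\},$$ and, in the sense of traces, the boundary condition $u=U_a^*$ on $\{(\rho,z):\rho\ge0,\ \rho^2+z^2=1\}$. Here the weak sense means that $u\in H^1_{\rm loc}\cap L^4_{\rm loc}(\mathbb D^+)$ and that the equation, multiplied by $\rho$, holds when tested against every $\eta\in C_c^\infty(\mathbb D^+;\mathbb R^3)$. -/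

import Mathlib

open MeasureTheory Set
open scoped ContDiff

noncomputable section

namespace LdG

/-- Euclidean space `ℝⁿ`. -/
abbrev E (n : ℕ) : Type := EuclideanSpace ℝ (Fin n)

/-! ### Weak derivatives, `H¹`, traces -/

/-- The classical partial derivative `∂ᵢ φ` (used for smooth `φ` only). -/
def pd {n : ℕ} (i : Fin n) (φ : E n → ℝ) (x : E n) : ℝ :=
  fderiv ℝ φ x (EuclideanSpace.single i 1)

/-- `φ ∈ C_c^∞(U)`, extended by zero to the whole space. -/
def IsTest {n : ℕ} {F : Type*} [NormedAddCommGroup F] [NormedSpace ℝ F]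
    (U : Set (E n)) (φ : E n → F) : Prop :=
  ContDiff ℝ ∞ φ ∧ HasCompactSupport φ ∧ tsupport φ ⊆ U

/-- `G` is the weak (distributional) gradient of the locally integrable function `f` on `Ω`. -/
structure HasWeakGradient {n : ℕ} (Ω : Set (E n)) (f : E n → ℝ) (G : E n → E n) : Prop where
  locInt : LocallyIntegrableOn f Ω
  locInt_grad : LocallyIntegrableOn G Ω
  integral_eq : ∀ φ : E n → ℝ, IsTest Ω φ → ∀ i : Fin n,
    ∫ x in Ω, f x * pd i φ x = - ∫ x in Ω, G x i * φ x

/-- A weak gradient is determined almost everywhere on the open set `Ω`. -/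
theorem HasWeakGradient.ae_eq {n : ℕ} {Ω : Set (E n)} (hΩ : IsOpen Ω) {f : E n → ℝ}
    {G G' : E n → E n} (h : HasWeakGradient Ω f G) (h' : HasWeakGradient Ω f G') :
    ∀ᵐ x, x ∈ Ω → G x = G' x := by
  have comp : ∀ (H : E n → E n), LocallyIntegrableOn H Ω → ∀ i : Fin n,
      LocallyIntegrableOn (fun x => H x i) Ω := by
    intro H hH i x hx
    obtain ⟨s, hs, hi⟩ := hH x hx
    exact ⟨s, hs, (EuclideanSpace.proj (𝕜 := ℝ) i).integrable_comp hi⟩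
  have key : ∀ i : Fin n, ∀ᵐ x, x ∈ Ω → G x i - G' x i = 0 := by
    intro i
    have hd := (comp G h.locInt_grad i).sub (comp G' h'.locInt_grad i)
    refine hΩ.ae_eq_zero_of_integral_contDiff_smul_eq_zero hd ?_
    intro g hg hc hs
    have e := (h.integral_eq g ⟨hg, hc, hs⟩ i).symm.trans (h'.integral_eq g ⟨hg, hc, hs⟩ i)
    have int : ∀ H : E n → ℝ, LocallyIntegrableOn H Ω →
        IntegrableOn (fun x => H x * g x) Ω := by
      intro H hH
      have hK : IntegrableOn H (tsupport g) := hH.integrableOn_compact_subset hs hc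
      have h1 : IntegrableOn (fun x => H x * g x) (tsupport g) :=
        hK.mul_continuousOn hg.continuous.continuousOn hc
      have h2 : Integrable (fun x => H x * g x) := by
        refine (integrableOn_iff_integrable_of_support_subset ?_).1 h1
        intro x hx
        exact subset_tsupport g (right_ne_zero_of_mul hx)
      exact h2.integrableOn
    have e2 : ∫ x in Ω, (G x i * g x - G' x i * g x) = 0 := by
      rw [integral_sub (int _ (comp G h.locInt_grad i)) (int _ (comp G' h'.locInt_grad i))]
      linarith
    rw [← setIntegral_eq_integral_of_forall_compl_eq_zero (s := Ω)]
    · rw [← e2]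
      refine integral_congr_ae (Filter.Eventually.of_forall fun x => ?_)
      simp only [smul_eq_mul]
      ring
    · intro x hx
      have : g x = 0 := image_eq_zero_of_notMem_tsupport fun hx' => hx (hs hx')
      simp [this]
  filter_upwards [ae_all_iff.2 key] with x hx hxΩ
  ext i
  exact sub_eq_zero.1 (hx i hxΩ)

open Classical in
/-- The weak gradient of `f` on `Ω` (a representative of it; `0` if there is none). -/
def weakGrad {n : ℕ} (Ω : Set (E n)) (f : E n → ℝ) : E n → E n :=
  if h : ∃ G, HasWeakGradient Ω f G then h.choose else 0

/-- `f ∈ H¹(Ω)`. -/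
def MemH1 {n : ℕ} (Ω : Set (E n)) (f : E n → ℝ) : Prop :=
  MemLp f 2 (volume.restrict Ω) ∧
    ∃ G, HasWeakGradient Ω f G ∧ MemLp G 2 (volume.restrict Ω)

/-- `t` is the trace of `f` on the part `∂Ω ∩ O` of the boundary of `Ω`, where `O` is an open set,
`σ` is the surface measure of `∂Ω ∩ O` and `ν` is the outward unit normal.  The trace is the unique
function on the boundary part (up to `σ`-null sets) for which the Gauss-Green formula holds:
`∫_Ω (f ∂ᵢφ + ∂ᵢf φ) = ∫_{∂Ω} t φ νᵢ dσ` for all `φ ∈ C_c^∞(O)`. -/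
def HasTrace {n : ℕ} (Ω O : Set (E n)) (σ : Measure (E n)) (ν : E n → E n)
    (f t : E n → ℝ) : Prop :=
  LocallyIntegrableOn t O σ ∧
  LocallyIntegrableOn f O (volume.restrict Ω) ∧
  ∃ G : E n → E n, HasWeakGradient Ω f G ∧
    LocallyIntegrableOn G O (volume.restrict Ω) ∧
    ∀ φ : E n → ℝ, IsTest O φ → ∀ i : Fin n,
      ∫ x in Ω, (f x * pd i φ x + G x i * φ x) = ∫ x, t x * φ x * ν x i ∂σ

/-! ### Domains and their boundaries -/

/-- The unit ball `B₁` of `ℝ³`; a point is `x = (x₁, x₂, z)`. -/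
def ball₁ : Set (E 3) := Metric.ball 0 1

/-- The upper half ball `B₁⁺`. -/
def upperBall : Set (E 3) := {x | x ∈ ball₁ ∧ 0 < x 2}

/-- The half disk `𝔻 = {(ρ, z) : ρ > 0, ρ² + z² < 1}`. -/
def D : Set (E 2) := {p | 0 < p 0 ∧ p 0 ^ 2 + p 1 ^ 2 < 1}

/-- The quarter disk `𝔻⁺ = {(ρ, z) ∈ 𝔻 : z > 0}`. -/
def Dplus : Set (E 2) := {p | p ∈ D ∧ 0 < p 1}

/-- Surface measure of the unit sphere `∂B₁`, as a measure on `ℝ³`. -/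
def sphereMeasure : Measure (E 3) :=
  ((volume : Measure (E 3)).toSphere).map Subtype.val

/-- Surface measure of the flat boundary `T` of `B₁⁺`, as a measure on `ℝ³`. -/
def flatMeasure : Measure (E 3) :=
  ((volume : Measure (E 2)).restrict (Metric.ball 0 1)).map (fun p => !₂[p 0, p 1, 0])

/-- Arc length on the half circle `{(ρ, z) : ρ > 0, ρ² + z² = 1}`, as a measure on `ℝ²`. -/
def arcMeasure : Measure (E 2) :=
  ((volume : Measure ℝ).restrict (Ioo 0 Real.pi)).map (fun s => !₂[Real.sin s, Real.cos s])

/-- `w = g` on `∂B₁` in the sense of traces, componentwise. -/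
def EqOnSphere (w g : E 3 → E 5) : Prop :=
  ∀ j : Fin 5, HasTrace ball₁ univ sphereMeasure id (fun x => w x j) (fun x => g x j)

/-- `t` is the trace of the scalar function `f` on the flat boundary `T` of `B₁⁺`
(outward normal `-e₃`). -/
def HasTraceOnT (f t : E 3 → ℝ) : Prop :=
  HasTrace upperBall ball₁ flatMeasure (fun _ => -EuclideanSpace.single 2 1) f t

/-- `u = g` on `{(ρ, z) : ρ ≥ 0, ρ² + z² = 1}` in the sense of traces, componentwise
(the two end points of the half circle are a null set for the arc length). -/
def EqOnArc (u g : E 2 → E 3) : Prop :=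
  ∀ j : Fin 3, HasTrace D {p | 0 < p 0} arcMeasure id (fun p => u p j) (fun p => g p j)

/-! ### The augmented operator and axial symmetry -/

/-- `ℒ[V] = (V₁ cos 2θ, V₁ sin 2θ, V₂, V₃ cos θ, V₃ sin θ)`. -/
def aug (V : E 3) (θ : ℝ) : E 5 :=
  !₂[V 0 * Real.cos (2 * θ), V 0 * Real.sin (2 * θ), V 1, V 2 * Real.cos θ, V 2 * Real.sin θ]

/-- The cylindrical coordinates `(ρ, z)` of `x`. -/
def meridian (x : E 3) : E 2 := !₂[Real.sqrt (x 0 ^ 2 + x 1 ^ 2), x 2]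

/-- The azimuthal angle of `x`. -/
def azimuth (x : E 3) : ℝ := Complex.arg ⟨x 0, x 1⟩

/-- The field `ℒ[u]` on `ℝ³` for `u = u(ρ, z)`. -/
def augField (u : E 2 → E 3) (x : E 3) : E 5 := aug (u (meridian x)) (azimuth x)

/-- `w = ℒ[u]` on `B₁` (fields are identified when they agree almost everywhere). -/
def IsAug (w : E 3 → E 5) (u : E 2 → E 3) : Prop :=
  w =ᵐ[volume.restrict ball₁] augField u

/-- `w` is `ℛ`-axially symmetric on `B₁`. -/
def IsRAxial (w : E 3 → E 5) : Prop :=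
  ∃ u : E 2 → E 3, IsAug w u ∧ ∀ p ∈ D,
    u !₂[p 0, -p 1] 0 = u p 0 ∧ u !₂[p 0, -p 1] 1 = u p 1 ∧ u !₂[p 0, -p 1] 2 = -u p 2

/-! ### Energy and configuration spaces -/

/-- The cubic polynomial `S[w]`. -/
def S (w : E 5) : ℝ :=
  -w 2 * (w 0 ^ 2 + w 1 ^ 2) + Real.sqrt 3 * w 1 * w 3 * w 4
    + 1 / 2 * w 2 * (w 3 ^ 2 + w 4 ^ 2) + 1 / 3 * w 2 ^ 3
    + Real.sqrt 3 / 2 * w 0 * (w 3 ^ 2 - w 4 ^ 2)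

/-- The cubic polynomial `P[u]`. -/
def P (u : E 3) : ℝ :=
  -u 0 ^ 2 * u 1 + Real.sqrt 3 / 2 * u 0 * u 2 ^ 2 + 1 / 3 * u 1 ^ 3 + 1 / 2 * u 1 * u 2 ^ 2

/-- The constant `H_a`. -/
def H (a : ℝ) : ℝ := (3 + Real.sqrt (9 + 8 * a ^ 2)) / (2 * Real.sqrt 2 * a)

/-- The constant `D_a`. -/
def Da (a : ℝ) : ℝ :=
  27 / (16 * a ^ 3) * (1 + 4 * a ^ 2 / 3 + (1 + 8 * a ^ 2 / 9) ^ (3 / 2 : ℝ))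

/-- The polar angle `ϕ ∈ [0, π]` as a function of `(ρ, z)`, `ρ ≥ 0`. -/
def polarAngle (p : E 2) : ℝ := Real.arccos (p 1 / ‖p‖)

/-- The boundary datum `U_a^*`, as a function of `(ρ, z)`. -/
def Ustar (a : ℝ) (p : E 2) : E 3 :=
  H a • !₂[Real.sqrt 3 / 2 * Real.sin (polarAngle p) ^ 2,
    3 / 2 * (Real.cos (polarAngle p) ^ 2 - 1 / 3),
    Real.sqrt 3 * Real.sin (polarAngle p) * Real.cos (polarAngle p)]

/-- The energy density `f_{a,μ}(w)`, with the weak gradient of `w` on `B₁`. -/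
def density (a μ : ℝ) (w : E 3 → E 5) (x : E 3) : ℝ :=
  (∑ j : Fin 5, ‖weakGrad ball₁ (fun y => w y j) x‖ ^ 2)
    + μ * (Da a - 3 * Real.sqrt 2 * S (w x) + a / 2 * (‖w x‖ ^ 2 - 1) ^ 2)

/-- The energy `ℰ_{a,μ}[w]`. -/
def energy (a μ : ℝ) (w : E 3 → E 5) : ℝ := ∫ x in ball₁, density a μ w x

/-- The configuration space `ℱ_a`: axially symmetric Sobolev fields of finite energy with boundary
values `ℒ[U_a^*]`. -/
structure MemF (a μ : ℝ) (w : E 3 → E 5) : Prop where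
  isAug : ∃ u : E 2 → E 3, IsAug w u
  memH1 : ∀ j : Fin 5, MemH1 ball₁ (fun x => w x j)
  finite_energy : IntegrableOn (density a μ w) ball₁
  bdry : EqOnSphere w (augField (Ustar a))

/-- The configuration space `ℱ_a^s`. -/
def Fs (a μ : ℝ) : Set (E 3 → E 5) := {w | MemF a μ w ∧ IsRAxial w}

/-- The obstacle class `ℱ_{a,b}^+`: `w₃ ≥ b H_a` on `T` in the sense of traces. -/
def Fplus (a μ b : ℝ) : Set (E 3 → E 5) :=
  {w | w ∈ Fs a μ ∧ ∃ t : E 3 → ℝ, HasTraceOnT (fun x => w x 2) t ∧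
    ∀ᵐ x ∂flatMeasure, b * H a ≤ t x}

/-- The obstacle class `ℱ_{a,c}^-`: `w₃ ≤ c H_a` on `T` in the sense of traces. -/
def Fminus (a μ c : ℝ) : Set (E 3 → E 5) :=
  {w | w ∈ Fs a μ ∧ ∃ t : E 3 → ℝ, HasTraceOnT (fun x => w x 2) t ∧
    ∀ᵐ x ∂flatMeasure, t x ≤ c * H a}

/-- `w` minimizes `ℰ_{a,μ}` in the class `K`. -/
def IsMinimizer (a μ : ℝ) (K : Set (E 3 → E 5)) (w : E 3 → E 5) : Prop :=
  w ∈ K ∧ IsMinOn (energy a μ) K w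

/-! ### The reduced Euler-Lagrange system -/

/-- `u ∈ H¹_loc ∩ L⁴_loc` is a weak solution in `𝔻⁺` of
`-ρ⁻¹ D·(ρ Du) + ρ⁻² (4u₁, 0, u₃)ᵀ = μ {(3/√2) ∇P[u] - a (|u|² - 1) u}`:
the equation, multiplied by `ρ`, is tested with all `η ∈ C_c^∞(𝔻⁺; ℝ³)`. -/
def IsWeakSolution (a μ : ℝ) (u : E 2 → E 3) : Prop :=
  ∃ Du : Fin 3 → E 2 → E 2,
    (∀ j, HasWeakGradient Dplus (fun p => u p j) (Du j)) ∧
    (∀ j, LocallyIntegrableOn (fun p => ‖Du j p‖ ^ 2) Dplus) ∧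
    LocallyIntegrableOn (fun p => ‖u p‖ ^ 4) Dplus ∧
    ∀ η : E 2 → E 3, IsTest Dplus η →
      ∫ p in Dplus,
          (p 0 * ∑ j : Fin 3, ∑ i : Fin 2, Du j p i * pd i (fun q => η q j) p
            + (p 0)⁻¹ * (4 * u p 0 * η p 0 + u p 2 * η p 2))
        = ∫ p in Dplus, p 0 * (μ * inner ℝ
            ((3 / Real.sqrt 2) • gradient P (u p) - (a * (‖u p‖ ^ 2 - 1)) • u p) (η p))

/-- `w = ℒ[u]` for some `u = u(ρ, z)` which solves the reduced Euler-Lagrange system weakly in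
`𝔻⁺` and equals `U_a^*` on the half circle. -/
def IsReducedSolution (a μ : ℝ) (w : E 3 → E 5) : Prop :=
  ∃ u : E 2 → E 3, IsAug w u ∧ IsWeakSolution a μ u ∧ EqOnArc u (Ustar a)

end LdG

end

namespace LdG

/-! ### Calculus of test functions -/

section Calculus

variable {n : ℕ}

/-! Existence is the direct method, arranged so that minimizing sequences converge strongly. Both
classes are instances of one class `Obst`, in which the trace of `w₃` on `T` takes values in a
closed convex set `C ⊆ ℝ`. On the unit sphere the boundary datum coincides with a polynomial field
`ℒ[u₀]` (`comp`), whose third component equals `-H_a/2` on `T`. Since `b ≤ -1/2 ≤ c`, this field is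
admissible in both problems.

The Gauss-Green form of the boundary condition says that `w - ℒ[u₀]`, extended by zero, lies in
`H¹(ℝ³)` (`exists_isH10_of_hasTrace`). Admissible fields are therefore the fixed field plus elements
of a linear space (`IsRep`), and traces on `T` are integrals of `∂_z` along vertical rays
(`flatTrace`).

The quartic term dominates the cubic one, which gives coercivity (`exists_isRep_bound`) and
semiconvexity of the potential (`exists_pot_semiconvex`). With the parallelogram law for the
Dirichlet integral, the energy of a midpoint plus a quarter of the squared `L²` distance of the
gradients is at most the mean energy plus a multiple of the squared `L²` distance of the fields
(`IsRep.energy_midpoint_le`). Rellich's theorem makes a minimizing sequence Cauchy in `L²`, the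
midpoint is admissible because `C` is convex, and so the gradients are Cauchy as well. In the limit
the traces converge almost everywhere, the axial symmetry passes through pointwise limits, the
Dirichlet integrals converge, and Fatou's lemma handles the potential (`exists_isMinimizer`).

For the equation, a minimizer is varied by fields `ℒ[ψ]` with `ψ` supported away from the axis and
from `T`. These do not change the trace on `T`, so both signs of the parameter are allowed and the
first variation vanishes in spite of the obstacle (`IsMinimizer.first_variation`). In cylindrical
coordinates the Dirichlet pairing splits into a radial, a vertical and an angular part. The angular
part is integrated by parts in `θ` and yields `m²/ρ²` with the frequencies `m = 2, 0, 1`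
(`sum_integral_pd_axTest`). The potential reduces because `S` composed with `ℒ` does not depend on
`θ` and equals `P` (`SPolar_aug` is the derivative of this identity).

The admissible `ψ` must have the parities of `u`. A test function in the upper quarter disk is
therefore symmetrized by reflection, and the two halves contribute equally (`euler_lagrange`). The
boundary condition on the arc holds because the profile of the zero extension of `w - ℒ[u₀]` has a
weak gradient across the arc (`hasTrace_arc`). -/

theorem pd_add {i : Fin n} {f g : E n → ℝ} {x : E n} (hf : DifferentiableAt ℝ f x)
    (hg : DifferentiableAt ℝ g x) : pd i (fun y => f y + g y) x = pd i f x + pd i g x := by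
  simp only [pd]; rw [fderiv_fun_add hf hg]; rfl

theorem pd_sub {i : Fin n} {f g : E n → ℝ} {x : E n} (hf : DifferentiableAt ℝ f x)
    (hg : DifferentiableAt ℝ g x) : pd i (fun y => f y - g y) x = pd i f x - pd i g x := by
  simp only [pd]; rw [fderiv_fun_sub hf hg]; rfl

theorem pd_mul {i : Fin n} {f g : E n → ℝ} {x : E n} (hf : DifferentiableAt ℝ f x)
    (hg : DifferentiableAt ℝ g x) :
    pd i (fun y => f y * g y) x = f x * pd i g x + pd i f x * g x := by
  simp only [pd]; rw [fderiv_fun_mul hf hg]; simp; ring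

theorem pd_const_mul {i : Fin n} {g : E n → ℝ} {x : E n} (c : ℝ)
    (hg : DifferentiableAt ℝ g x) : pd i (fun y => c * g y) x = c * pd i g x := by
  simp only [pd]; rw [fderiv_const_mul hg]; simp

theorem pd_const {i : Fin n} {x : E n} (c : ℝ) : pd i (fun _ => c) x = 0 := by
  simp [pd]

theorem pd_coord {i j : Fin n} {x : E n} : pd i (fun y => y j) x = if i = j then 1 else 0 := by
  have : (fun y : E n => y j) = EuclideanSpace.proj (𝕜 := ℝ) j := rfl
  simp only [pd]; rw [this, ContinuousLinearMap.fderiv]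
  simp [eq_comm]

theorem pd_comp {i : Fin n} {f : E n → ℝ} {g : ℝ → ℝ} {x : E n} (hf : DifferentiableAt ℝ f x)
    (hg : DifferentiableAt ℝ g (f x)) :
    pd i (fun y => g (f y)) x = deriv g (f x) * pd i f x := by
  simp only [pd]
  rw [show (fun y => g (f y)) = g ∘ f from rfl, fderiv_comp x hg hf]
  simp [fderiv_eq_smul_deriv, mul_comm]

theorem contDiff_pd {i : Fin n} {f : E n → ℝ} (hf : ContDiff ℝ ∞ f) : ContDiff ℝ ∞ (pd i f) :=
  (hf.fderiv_right (m := ∞) (by simp)).clm_apply contDiff_const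

theorem tsupport_pd_subset (i : Fin n) (f : E n → ℝ) : tsupport (pd i f) ⊆ tsupport f := by
  refine (closure_mono fun x hx => ?_).trans (tsupport_fderiv_subset ℝ (f := f))
  intro h
  exact hx (by simp [pd, h])

theorem contDiff_coord (j : Fin n) : ContDiff ℝ ∞ (fun x : E n => x j) :=
  (EuclideanSpace.proj (𝕜 := ℝ) j).contDiff

theorem fderiv_apply_eq_sum {f : E n → ℝ} {x : E n} (h : E n) :
    fderiv ℝ f x h = ∑ i, h i * pd i f x := by
  conv_lhs => rw [← (EuclideanSpace.basisFun (Fin n) ℝ).sum_repr h]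
  simp [pd]

variable {U V : Set (E n)} {φ ψ : E n → ℝ}

theorem IsTest.mono (h : IsTest U φ) (hUV : U ⊆ V) : IsTest V φ := ⟨h.1, h.2.1, h.2.2.trans hUV⟩

theorem IsTest.differentiable (h : IsTest U φ) : Differentiable ℝ φ := h.1.differentiable (by simp)

theorem IsTest.differentiableAt (h : IsTest U φ) {x : E n} : DifferentiableAt ℝ φ x :=
  h.differentiable x

theorem IsTest.continuous (h : IsTest U φ) : Continuous φ := h.1.continuous

theorem IsTest.integrable (h : IsTest U φ) {μ : Measure (E n)} [IsFiniteMeasureOnCompacts μ] :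
    Integrable φ μ := h.continuous.integrable_of_hasCompactSupport h.2.1

theorem IsTest.memLp (h : IsTest U φ) {p : ENNReal} {μ : Measure (E n)}
    [IsFiniteMeasureOnCompacts μ] : MemLp φ p μ :=
  h.continuous.memLp_of_hasCompactSupport h.2.1

theorem IsTest.pd (h : IsTest U φ) (i : Fin n) : IsTest U (LdG.pd i φ) :=
  ⟨contDiff_pd h.1, h.2.1.of_isClosed_subset (isClosed_tsupport _) (tsupport_pd_subset i φ), (tsupport_pd_subset i φ).trans h.2.2⟩

theorem IsTest.mul_left {g : E n → ℝ} (hg : ContDiff ℝ ∞ g) (h : IsTest U φ) :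
    IsTest U (fun x => g x * φ x) :=
  ⟨hg.mul h.1, h.2.1.mul_left, (tsupport_mul_subset_right (f := g) (g := φ)).trans h.2.2⟩

theorem IsTest.const_mul (c : ℝ) (h : IsTest U φ) : IsTest U (fun x => c * φ x) :=
  h.mul_left contDiff_const

theorem IsTest.add (h : IsTest U φ) (h' : IsTest U ψ) : IsTest U (fun x => φ x + ψ x) :=
  ⟨h.1.add h'.1, h.2.1.add h'.2.1,
    (tsupport_add φ ψ).trans (union_subset h.2.2 h'.2.2)⟩

theorem IsTest.sub (h : IsTest U φ) (h' : IsTest U ψ) : IsTest U (fun x => φ x - ψ x) := by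
  have := h.add (h'.const_mul (-1))
  simpa [sub_eq_add_neg] using this

theorem IsTest.exists_bound (h : IsTest U φ) : ∃ C, ∀ x, |φ x| ≤ C :=
  h.2.1.exists_bound_of_continuous h.continuous

theorem IsTest.eq_zero_of_notMem (h : IsTest U φ) {x : E n} (hx : x ∉ U) : φ x = 0 :=
  image_eq_zero_of_notMem_tsupport fun h' => hx (h.2.2 h')

theorem IsTest.integral_pd (h : IsTest U φ) (i : Fin n) : ∫ x, LdG.pd i φ x = 0 := by
  have := integral_mul_fderiv_eq_neg_fderiv_mul_of_integrable (μ := volume)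
    (f := fun _ : E n => (1 : ℝ)) (g := φ) (v := EuclideanSpace.single i 1) (by simp)
    (by simp only [one_mul]; exact (h.pd i).integrable) (by simpa using h.integrable)
    (fun x _ => by fun_prop) (fun x _ => h.differentiableAt)
  simpa [LdG.pd] using this

theorem IsTest.setIntegral_eq (h : IsTest U φ) {f : E n → ℝ} :
    ∫ x in U, f x * φ x = ∫ x, f x * φ x :=
  setIntegral_eq_integral_of_forall_compl_eq_zero fun x hx => by simp [h.eq_zero_of_notMem hx]

theorem IsTest.integrable_mul (h : IsTest U φ) {f : E n → ℝ} {μ : Measure (E n)}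
    (hf : IntegrableOn f (tsupport φ) μ) : Integrable (fun x => f x * φ x) μ := by
  have h1 : IntegrableOn (fun x => f x * φ x) (tsupport φ) μ :=
    hf.mul_continuousOn h.continuous.continuousOn h.2.1
  refine (integrableOn_iff_integrable_of_support_subset ?_).1 h1
  intro x hx
  exact subset_tsupport φ (right_ne_zero_of_mul hx)

end Calculus

/-! ### The divergence theorem on the unit ball -/

section GaussGreen

open Filter Topology

variable {n : ℕ}

theorem contDiff_smoothTransition : ContDiff ℝ ∞ Real.smoothTransition :=
  Real.smoothTransition.contDiff

theorem deriv_smoothTransition_of_nonpos {x : ℝ} (hx : x ≤ 0) :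
    deriv Real.smoothTransition x = 0 := by
  rcases hx.lt_or_eq with h | rfl
  · have : Real.smoothTransition =ᶠ[𝓝 x] fun _ => 0 := by
      filter_upwards [Iio_mem_nhds h] with y hy
      exact Real.smoothTransition.zero_of_nonpos hy.le
    rw [this.deriv_eq]; simp
  -- At the endpoint `0` the function attains its global minimum.
  · apply IsLocalMin.deriv_eq_zero
    filter_upwards with y
    simpa using Real.smoothTransition.nonneg y

theorem deriv_smoothTransition_of_one_le {x : ℝ} (hx : 1 ≤ x) :
    deriv Real.smoothTransition x = 0 := by
  apply IsLocalMax.deriv_eq_zero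
  filter_upwards with y
  rw [Real.smoothTransition.one_of_one_le hx]
  exact Real.smoothTransition.le_one y

theorem continuous_deriv_smoothTransition : Continuous (deriv Real.smoothTransition) :=
  contDiff_smoothTransition.continuous_deriv (by simp)

/-- `x s'(x)` is bounded, where `s` is the smooth transition function; likewise `s'`. -/
theorem exists_bound_deriv_smoothTransition :
    ∃ C, ∀ x : ℝ, |deriv Real.smoothTransition x| ≤ C ∧ |x * deriv Real.smoothTransition x| ≤ C := by
  have hc : HasCompactSupport (deriv Real.smoothTransition) := by
    refine HasCompactSupport.intro (K := Icc 0 1) isCompact_Icc fun x hx => ?_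
    by_cases h0 : x ≤ 0
    · exact deriv_smoothTransition_of_nonpos h0
    · exact deriv_smoothTransition_of_one_le (by by_contra h; exact hx ⟨by linarith, by linarith⟩)
  obtain ⟨C, hC⟩ := hc.exists_bound_of_continuous continuous_deriv_smoothTransition
  refine ⟨C, fun x => ⟨hC x, ?_⟩⟩
  by_cases h0 : x ≤ 0
  · simpa [deriv_smoothTransition_of_nonpos h0] using (norm_nonneg _).trans (hC 0)
  by_cases h1 : 1 ≤ x
  · simpa [deriv_smoothTransition_of_one_le h1] using (norm_nonneg _).trans (hC 0)
  push Not at h0 h1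
  rw [abs_mul, abs_of_pos h0]
  exact (mul_le_of_le_one_left (abs_nonneg _) h1.le).trans (hC x)

theorem contDiff_normSq : ContDiff ℝ ∞ (fun x : E n => ‖x‖ ^ 2) := contDiff_norm_sq ℝ

theorem pd_normSq (i : Fin n) (x : E n) : pd i (fun y => ‖y‖ ^ 2) x = 2 * x i := by
  simp only [pd]
  rw [fderiv_norm_sq_apply]
  simp [EuclideanSpace.inner_single_right]

/-- Replacing a constant field by a radial one with the same normal component on the sphere does
not change the integral of the divergence over the ball. -/
theorem integral_ball_pd_eq_radial {ψ : E n → ℝ} (h : IsTest univ ψ) (i : Fin n) :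
    ∫ x in Metric.ball (0 : E n) 1, pd i ψ x
      = ∫ x in Metric.ball (0 : E n) 1, ∑ j, pd j (fun y => y j * (y i * ψ y)) x := by
  set s := Real.smoothTransition with hs
  set ε : ℕ → ℝ := fun m => 1 / ((m : ℝ) + 1) with hε
  have hεpos : ∀ m, 0 < ε m := fun m => by positivity
  have hε0 : Tendsto ε atTop (𝓝 0) := tendsto_one_div_add_atTop_nhds_zero_nat
  set T : ℕ → E n → ℝ := fun m x => (1 - ‖x‖ ^ 2) / ε m with hT
  have hTs : ∀ m, ContDiff ℝ ∞ (T m) := fun m => (contDiff_const.sub contDiff_normSq).div_const _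
  -- `χ m` vanishes off the ball and equals `1` where `1 - ‖x‖² ≥ ε m`, so it tends to the indicator
  -- of the ball.
  set χ : ℕ → E n → ℝ := fun m x => s (T m x) with hχ
  have hχs : ∀ m, ContDiff ℝ ∞ (χ m) := fun m => contDiff_smoothTransition.comp (hTs m)
  have hdχ : ∀ m j x, pd j (χ m) x = deriv s (T m x) * (-(2 * x j) / ε m) := by
    intro m j x
    rw [hχ]
    rw [pd_comp ((hTs m).differentiable (by simp) x)
      (contDiff_smoothTransition.differentiable (by simp) _)]
    congr 1
    have : T m = fun x => (1 / ε m) * (1 - ‖x‖ ^ 2) := by ext y; simp only [hT]; ring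
    rw [this, pd_const_mul (g := fun y => 1 - ‖y‖ ^ 2) _ (((contDiff_const (n := ∞)).sub
      contDiff_normSq).differentiable (by simp) x),
      pd_sub (by fun_prop) (contDiff_normSq.differentiable (by simp) x), pd_const, pd_normSq]
    ring
  have hr : ∀ j, IsTest univ (fun y : E n => y j * (y i * ψ y)) := fun j =>
    (h.mul_left (contDiff_coord i)).mul_left (contDiff_coord j)
  set A : E n → ℝ := fun x => pd i ψ x - ∑ j, pd j (fun y => y j * (y i * ψ y)) x with hA
  have hAint : Integrable A := (h.pd i).integrable.sub
    (integrable_finsetSum _ fun j _ => ((hr j).pd j).integrable)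
  -- the identity for the cut-off fields
  have key : ∀ m, ∫ x, χ m x * A x
      = ∫ x, 2 * (T m x * deriv s (T m x)) * (x i * ψ x) := by
    intro m
    have e1 : ∫ x, pd i (fun y => χ m y * ψ y) x = 0 := (h.mul_left (hχs m)).integral_pd i
    have e2 : ∀ j, ∫ x, pd j (fun y => χ m y * (y j * (y i * ψ y))) x = 0 :=
      fun j => ((hr j).mul_left (hχs m)).integral_pd j
    have e3 : ∫ x, (pd i (fun y => χ m y * ψ y) x
        - ∑ j, pd j (fun y => χ m y * (y j * (y i * ψ y))) x) = 0 := by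
      rw [integral_sub ((h.mul_left (hχs m)).pd i).integrable
        (integrable_finsetSum _ fun j _ => (((hr j).mul_left (hχs m)).pd j).integrable),
        integral_finsetSum _ fun j _ => (((hr j).mul_left (hχs m)).pd j).integrable]
      simp [e1, e2]
    have hχd : ∀ x, DifferentiableAt ℝ (χ m) x := fun x => (hχs m).differentiable (by simp) x
    -- The field `ψ(eᵢ - xᵢ x)` has radial component `xᵢ ψ (1 - ‖x‖²)`. This factor compensates the
    -- `1 / ε m` in the gradient of the cut-off and leaves the bounded quantity `T s'(T)`.
    have e4 : ∀ x, pd i (fun y => χ m y * ψ y) x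
        - ∑ j, pd j (fun y => χ m y * (y j * (y i * ψ y))) x
        = χ m x * A x - 2 * (T m x * deriv s (T m x)) * (x i * ψ x) := by
      intro x
      rw [pd_mul (hχd x) h.differentiableAt]
      simp_rw [fun j => pd_mul (i := j) (hχd x) (hr j).differentiableAt, hdχ]
      rw [Finset.sum_add_distrib, ← Finset.mul_sum]
      have : ∑ j, deriv s (T m x) * (-(2 * x j) / ε m) * (x j * (x i * ψ x))
          = - (2 * deriv s (T m x) / ε m * (x i * ψ x)) * ‖x‖ ^ 2 := by
        rw [EuclideanSpace.norm_sq_eq, Finset.mul_sum]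
        refine Finset.sum_congr rfl fun j _ => ?_
        simp only [Real.norm_eq_abs, sq_abs]; ring
      rw [this]
      simp only [hA, hT]
      have := (hεpos m).ne'
      field_simp
      ring
    simp_rw [e4] at e3
    rw [integral_sub] at e3
    · linarith
    · obtain ⟨C, hC⟩ := exists_bound_deriv_smoothTransition
      refine hAint.bdd_mul (c := 1) (hχs m).continuous.aestronglyMeasurable
        (Eventually.of_forall fun x => ?_)
      rw [Real.norm_eq_abs, abs_of_nonneg (Real.smoothTransition.nonneg _)]
      exact Real.smoothTransition.le_one _
    · refine ((h.mul_left (contDiff_coord i)).continuous.integrable_of_hasCompactSupport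
        (h.mul_left (contDiff_coord i)).2.1).bdd_mul (c := 2 * (exists_bound_deriv_smoothTransition.choose))
        ?_ (Eventually.of_forall fun x => ?_)
      · exact (continuous_const.mul ((hTs m).continuous.mul
          (continuous_deriv_smoothTransition.comp (hTs m).continuous))).aestronglyMeasurable
      · rw [norm_mul, Real.norm_eq_abs, Real.norm_eq_abs, abs_two]
        exact mul_le_mul_of_nonneg_left
          (exists_bound_deriv_smoothTransition.choose_spec _).2 (by norm_num)
  have hTinf : ∀ x : E n, ‖x‖ < 1 → ∀ᶠ m in atTop, 1 ≤ T m x := by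
    intro x hx
    have hpos : 0 < 1 - ‖x‖ ^ 2 := by nlinarith [norm_nonneg x]
    filter_upwards [hε0.eventually (Iio_mem_nhds hpos)] with m hm
    rw [hT, one_le_div (hεpos m)]
    exact le_of_lt hm
  have hTneg : ∀ x : E n, 1 ≤ ‖x‖ → ∀ m, T m x ≤ 0 := by
    intro x hx m
    exact div_nonpos_of_nonpos_of_nonneg (by nlinarith) (hεpos m).le
  obtain ⟨C, hC⟩ := exists_bound_deriv_smoothTransition
  have lim1 : Tendsto (fun m => ∫ x, χ m x * A x) atTop
      (𝓝 (∫ x, (Metric.ball (0 : E n) 1).indicator A x)) := by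
    refine tendsto_integral_of_dominated_convergence (fun x => ‖A x‖)
      (fun m => (hχs m).continuous.aestronglyMeasurable.mul hAint.1) hAint.norm
      (fun m => Eventually.of_forall fun x => ?_) (Eventually.of_forall fun x => ?_)
    · rw [norm_mul, Real.norm_eq_abs (χ m x), abs_of_nonneg (Real.smoothTransition.nonneg _)]
      exact mul_le_of_le_one_left (norm_nonneg _) (Real.smoothTransition.le_one _)
    · by_cases hx : ‖x‖ < 1
      · rw [indicator_of_mem (by simpa using hx)]
        refine tendsto_const_nhds.congr' ?_
        filter_upwards [hTinf x hx] with m hm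
        simp [hχ, hs, Real.smoothTransition.one_of_one_le hm]
      · rw [indicator_of_notMem (by simpa using hx)]
        refine tendsto_const_nhds.congr fun m => ?_
        simp [hχ, hs, Real.smoothTransition.zero_of_nonpos (hTneg x (not_lt.1 hx) m)]
  -- The boundary layer term is bounded uniformly in `m` and vanishes pointwise for large `m`, since
  -- `s'` is zero outside `(0, 1)`.
  have lim2 : Tendsto (fun m => ∫ x, 2 * (T m x * deriv s (T m x)) * (x i * ψ x)) atTop
      (𝓝 (∫ x : E n, (0 : ℝ))) := by
    have hi : Integrable (fun x : E n => x i * ψ x) := (h.mul_left (contDiff_coord i)).integrable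
    refine tendsto_integral_of_dominated_convergence (fun x => 2 * C * ‖x i * ψ x‖)
      (fun m => ?_) (hi.norm.const_mul _)
      (fun m => Eventually.of_forall fun x => ?_) (Eventually.of_forall fun x => ?_)
    · exact (continuous_const.mul ((hTs m).continuous.mul
          (continuous_deriv_smoothTransition.comp (hTs m).continuous))).aestronglyMeasurable.mul hi.1
    · rw [norm_mul, norm_mul, Real.norm_eq_abs 2, abs_two]
      exact mul_le_mul_of_nonneg_right
        (mul_le_mul_of_nonneg_left (hC _).2 (by norm_num)) (norm_nonneg _)
    · refine tendsto_const_nhds.congr' ?_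
      by_cases hx : ‖x‖ < 1
      · filter_upwards [hTinf x hx] with m hm
        simp [hs, deriv_smoothTransition_of_one_le hm]
      · filter_upwards with m
        simp [hs, deriv_smoothTransition_of_nonpos (hTneg x (not_lt.1 hx) m)]
  have e := tendsto_nhds_unique (lim1.congr key) lim2
  rw [integral_indicator Metric.isOpen_ball.measurableSet, integral_zero, hA,
    integral_sub (h.pd i).integrable.integrableOn
      (integrable_finsetSum _ fun j _ => ((hr j).pd j).integrable).integrableOn] at e
  linarith

end GaussGreen

/-! ### Coordinates and surface integrals -/

section Polar

open Filter Topology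

/-- `(a, b) ↦ !₂[a, b]`. -/
def pairEquiv : ℝ × ℝ ≃ᵐ E 2 :=
  MeasurableEquiv.finTwoArrow.symm.trans (MeasurableEquiv.toLp 2 (Fin 2 → ℝ))

theorem pairEquiv_apply (p : ℝ × ℝ) : pairEquiv p = !₂[p.1, p.2] := by
  ext i; fin_cases i <;> rfl

theorem measurePreserving_pairEquiv : MeasurePreserving pairEquiv :=
  (volume_preserving_finTwoArrow ℝ).symm.trans (PiLp.volume_preserving_toLp (Fin 2))

/-- `(p, z) ↦ !₂[p 0, p 1, z]`. -/
def heightEquiv : E 2 × ℝ ≃ᵐ E 3 :=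
  ((MeasurableEquiv.prodCongr (MeasurableEquiv.toLp 2 (Fin 2 → ℝ)).symm
    (MeasurableEquiv.refl ℝ)).trans MeasurableEquiv.prodComm).trans
  ((MeasurableEquiv.piFinSuccAbove (fun _ => ℝ) (Fin.last 2)).symm.trans
    (MeasurableEquiv.toLp 2 (Fin 3 → ℝ)))

theorem heightEquiv_apply (p : E 2 × ℝ) : heightEquiv p = !₂[p.1 0, p.1 1, p.2] := by
  ext i
  fin_cases i <;> rfl

theorem measurePreserving_heightEquiv : MeasurePreserving heightEquiv := by
  refine MeasurePreserving.trans (MeasurePreserving.trans (μb := volume) ?_ ?_)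
    (((volume_preserving_piFinSuccAbove (fun _ => ℝ) (Fin.last 2)).symm).trans
      (PiLp.volume_preserving_toLp (Fin 3)))
  · exact (PiLp.volume_preserving_ofLp (Fin 2)).prod (MeasurePreserving.id _)
  · exact Measure.measurePreserving_swap

/-- Lebesgue measure away from the origin is the product of `toSphere` and `r² dr`. The surface
measure in the definition of boundary traces is this same `toSphere`. -/
theorem integral_sphere_polar {f : E 3 → ℝ} (hf : Integrable f) :
    ∫ x, f x = ∫ ξ : Metric.sphere (0 : E 3) 1, (∫ r in Ioi (0 : ℝ), r ^ 2 * f (r • (ξ : E 3)))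
      ∂(volume : Measure (E 3)).toSphere := by
  set μ := (volume : Measure (E 3))
  have hd : Module.finrank ℝ (E 3) - 1 = 2 := by simp
  have hmp := μ.measurePreserving_homeomorphUnitSphereProd
  rw [hd] at hmp
  have hemb := (homeomorphUnitSphereProd (E 3)).measurableEmbedding
  set g : Metric.sphere (0 : E 3) 1 × Ioi (0 : ℝ) → ℝ := fun p => f (p.2.1 • p.1.1) with hg
  have hgc : ∀ x : ({(0)}ᶜ : Set (E 3)), g (homeomorphUnitSphereProd (E 3) x) = f x := by
    intro x
    have hx : ‖(x : E 3)‖ ≠ 0 := norm_ne_zero_iff.2 x.2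
    simp [hg, smul_smul, hx]
  have hgi : Integrable g (μ.toSphere.prod (.volumeIoiPow 2)) := by
    rw [← hmp.integrable_comp_emb hemb]
    have : g ∘ (homeomorphUnitSphereProd (E 3)) = f ∘ Subtype.val := by
      ext x; exact hgc x
    rw [this]
    have hv : MeasurableEmbedding (Subtype.val : ({(0)}ᶜ : Set (E 3)) → E 3) :=
      MeasurableEmbedding.subtype_coe (measurableSet_singleton (0 : E 3)).compl
    rw [← hv.integrable_map_iff, hv.map_comap]
    exact hf.restrict
  calc ∫ x, f x = ∫ x : ({(0)}ᶜ : Set (E 3)), f x ∂(μ.comap (↑)) := by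
        rw [integral_subtype_comap (measurableSet_singleton _).compl fun x ↦ f x,
          restrict_compl_singleton]
    _ = ∫ p, g p ∂(μ.toSphere.prod (.volumeIoiPow 2)) := by
        rw [← hmp.integral_comp hemb g]
        simp_rw [hgc]
    _ = ∫ ξ, ∫ r, g (ξ, r) ∂(.volumeIoiPow 2) ∂μ.toSphere := integral_prod _ hgi
    _ = _ := by
        refine integral_congr_ae (Eventually.of_forall fun ξ => ?_)
        simp only [Measure.volumeIoiPow, ENNReal.ofReal]
        rw [integral_withDensity_eq_integral_smul,
          integral_subtype_comap measurableSet_Ioi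
            fun a ↦ Real.toNNReal (a ^ 2) • f (a • (ξ : E 3)),
          setIntegral_congr_fun measurableSet_Ioi fun x hx ↦ ?_]
        · rw [NNReal.smul_def, Real.coe_toNNReal _ (by positivity), smul_eq_mul]
        · exact (measurable_subtype_coe.pow_const _).real_toNNReal

/-- Along a ray, `r^(n-1) (n F + x·∇F)` is the derivative of `r^n F`. -/
theorem integral_ray {n k : ℕ} {F : E n → ℝ} (hF : ContDiff ℝ ∞ F) {A : E n → ℝ}
    (hA : ∀ x, A x = (k + 1) * F x + ∑ j, x j * pd j F x) {ξ : E n} (hξ : ‖ξ‖ = 1) :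
    ∫ r in Ioi (0 : ℝ), r ^ k * (Metric.ball (0 : E n) 1).indicator A (r • ξ) = F ξ := by
  have h1 : ∫ r in Ioi (0 : ℝ), r ^ k * (Metric.ball (0 : E n) 1).indicator A (r • ξ)
      = ∫ r in Ioo (0 : ℝ) 1, r ^ k * A (r • ξ) := by
    rw [← Ioi_inter_Iio, ← setIntegral_indicator measurableSet_Iio]
    refine setIntegral_congr_fun measurableSet_Ioi fun r hr => ?_
    have : r • ξ ∈ Metric.ball (0 : E n) 1 ↔ r ∈ Iio (1 : ℝ) := by
      simp [norm_smul, hξ, abs_of_pos (mem_Ioi.1 hr)]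
    by_cases h : r ∈ Iio (1 : ℝ)
    · simp only [indicator_of_mem h, indicator_of_mem (this.2 h)]
    · simp only [indicator_of_notMem h, indicator_of_notMem (fun h' => h (this.1 h')), mul_zero]
  have hderiv : ∀ r : ℝ, HasDerivAt (fun r : ℝ => r ^ (k + 1) * F (r • ξ)) (r ^ k * A (r • ξ)) r := by
    intro r
    have hl : HasDerivAt (fun r : ℝ => r • ξ) ξ r := by
      simpa using (hasDerivAt_id r).smul_const ξ
    have hF' := (hF.differentiable (by simp) (r • ξ)).hasFDerivAt.comp_hasDerivAt r hl
    refine ((hasDerivAt_pow (k + 1) r).mul hF').congr_deriv ?_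
    rw [hA, fderiv_apply_eq_sum]
    simp only [PiLp.smul_apply, smul_eq_mul, Function.comp]
    push_cast
    rw [mul_add, Finset.mul_sum, Finset.mul_sum]
    congr 1
    · ring
    · exact Finset.sum_congr rfl fun j _ => by ring
  rw [h1, ← integral_Ioc_eq_integral_Ioo, ← intervalIntegral.integral_of_le zero_le_one,
    intervalIntegral.integral_eq_sub_of_hasDerivAt fun r _ => hderiv r]
  · simp
  · apply Continuous.intervalIntegrable
    have : A = fun x => (k + 1) * F x + ∑ j, x j * pd j F x := funext hA
    rw [this]
    have h1 := hF.continuous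
    have h2 : ∀ j, Continuous (pd j F) := fun j => (contDiff_pd hF).continuous
    fun_prop

theorem sum_pd_coord_mul {n : ℕ} {F : E n → ℝ} (hF : ContDiff ℝ ∞ F) (x : E n) :
    ∑ j, pd j (fun y => y j * F y) x = n * F x + ∑ j, x j * pd j F x := by
  have : ∀ j, pd j (fun y => y j * F y) x = x j * pd j F x + F x := by
    intro j
    rw [pd_mul ((contDiff_coord j).differentiable (by simp) x) (hF.differentiable (by simp) x),
      pd_coord]
    simp
  simp_rw [this, Finset.sum_add_distrib]
  simp; ring

/-- Once `∂ᵢψ` is replaced by the divergence of the radial field `x · xᵢψ`, the integral along each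
ray is the fundamental theorem of calculus and only the value on the sphere remains. -/
theorem integral_ball_pd {ψ : E 3 → ℝ} (h : IsTest univ ψ) (i : Fin 3) :
    ∫ x in ball₁, pd i ψ x = ∫ x, ψ x * x i ∂sphereMeasure := by
  have hF : IsTest univ fun y : E 3 => y i * ψ y := h.mul_left (contDiff_coord i)
  rw [ball₁, integral_ball_pd_eq_radial h, ← integral_indicator Metric.isOpen_ball.measurableSet]
  have hi : Integrable fun x => ∑ j, pd j (fun y : E 3 => y j * (y i * ψ y)) x :=
    integrable_finsetSum _ fun j _ => ((hF.mul_left (contDiff_coord j)).pd j).integrable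
  rw [integral_sphere_polar (hi.indicator Metric.isOpen_ball.measurableSet), sphereMeasure,
    (MeasurableEmbedding.subtype_coe Metric.isClosed_sphere.measurableSet).integral_map]
  refine integral_congr_ae (Eventually.of_forall fun ξ => ?_)
  simp only
  rw [integral_ray (k := 2) hF.1 (fun x => ?_) (by simp)]
  · ring
  · rw [sum_pd_coord_mul hF.1]; norm_num

/-- The coordinates are swapped so that the angle is measured from the `z` axis, which matches the
parametrization `(sin s, cos s)` in `arcMeasure`. -/
theorem integral_plane_polar {f : E 2 → ℝ} (hf : Integrable f) :
    ∫ x, f x = ∫ θ in Ioo (-Real.pi) Real.pi, ∫ r in Ioi (0 : ℝ),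
      r ^ 1 * f (r • !₂[Real.sin θ, Real.cos θ]) := by
  have e1 : ∫ x, f x = ∫ p : ℝ × ℝ, f (pairEquiv p.swap) := by
    rw [← measurePreserving_pairEquiv.integral_comp' f]
    exact (Measure.measurePreserving_swap.integral_comp'
      (f := MeasurableEquiv.prodComm) (g := fun p => f (pairEquiv p))).symm
  have hs : Integrable fun p : ℝ × ℝ => f (pairEquiv p.swap) :=
    ((measurePreserving_pairEquiv.integrable_comp_emb pairEquiv.measurableEmbedding).2 hf).swap
  have hint : IntegrableOn (fun p : ℝ × ℝ => p.1 • f (pairEquiv (polarCoord.symm p).swap))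
      polarCoord.target := by
    have := (integrableOn_image_iff_integrableOn_abs_det_fderiv_smul volume
      polarCoord.open_target.measurableSet
      (fun p _ => (hasFDerivAt_polarCoord_symm p).hasFDerivWithinAt)
      polarCoord.symm.injOn (fun p => f (pairEquiv p.swap))).1 (hs.integrableOn)
    refine this.congr_fun (fun p hp => ?_) polarCoord.open_target.measurableSet
    simp only [det_fderivPolarCoordSymm]
    rw [abs_of_pos hp.1]
  rw [e1, ← integral_comp_polarCoord_symm]
  rw [polarCoord_target] at hint ⊢
  rw [IntegrableOn, Measure.volume_eq_prod, ← Measure.prod_restrict] at hint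
  rw [Measure.volume_eq_prod, ← Measure.prod_restrict]
  rw [integral_prod_symm _ hint]
  refine integral_congr_ae (Eventually.of_forall fun θ => ?_)
  refine integral_congr_ae (Eventually.of_forall fun r => ?_)
  simp only [smul_eq_mul, pow_one, polarCoord_symm_apply, pairEquiv_apply, Prod.swap]
  congr 2
  ext i; fin_cases i <;> simp

/-- The test function vanishes for `ρ ≤ 0`, so the half disk may be replaced by the full disk.
Angles in `(-π, 0]` contribute nothing because there `sin θ ≤ 0`. -/
theorem integral_D_pd {ψ : E 2 → ℝ} (h : IsTest {p : E 2 | 0 < p 0} ψ) (i : Fin 2) :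
    ∫ x in D, pd i ψ x = ∫ x, ψ x * x i ∂arcMeasure := by
  have h' : IsTest univ ψ := h.mono (subset_univ _)
  have hF : IsTest {p : E 2 | 0 < p 0} fun y : E 2 => y i * ψ y := h.mul_left (contDiff_coord i)
  have hD : D = {p : E 2 | 0 < p 0} ∩ Metric.ball 0 1 := by
    ext p
    simp [D, EuclideanSpace.norm_eq, Fin.sum_univ_two, Real.sqrt_lt']
  have hm : MeasurableSet {p : E 2 | 0 < p 0} :=
    (isOpen_lt continuous_const (contDiff_coord 0).continuous).measurableSet
  have e0 : ∫ x in D, pd i ψ x = ∫ x in Metric.ball (0 : E 2) 1, pd i ψ x := by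
    rw [hD, inter_comm, ← setIntegral_indicator hm]
    refine setIntegral_congr_fun Metric.isOpen_ball.measurableSet fun x _ => ?_
    by_cases hx : x ∈ {p : E 2 | 0 < p 0}
    · simp only [indicator_of_mem hx]
    · simp only [indicator_of_notMem hx, (h.pd i).eq_zero_of_notMem hx]
  rw [e0, integral_ball_pd_eq_radial h', ← integral_indicator Metric.isOpen_ball.measurableSet]
  have hi : Integrable fun x => ∑ j, pd j (fun y : E 2 => y j * (y i * ψ y)) x :=
    integrable_finsetSum _ fun j _ => ((hF.mul_left (contDiff_coord j)).pd j).integrable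
  have hsc : Continuous fun s : ℝ => (!₂[Real.sin s, Real.cos s] : E 2) := by
    refine (PiLp.continuous_toLp 2 _).comp (continuous_pi fun j => ?_)
    fin_cases j
    · exact Real.continuous_sin
    · exact Real.continuous_cos
  rw [integral_plane_polar (hi.indicator Metric.isOpen_ball.measurableSet), arcMeasure,
    integral_map (f := fun x : E 2 => ψ x * x i) hsc.aemeasurable
      (h.continuous.mul (contDiff_coord i).continuous).aestronglyMeasurable]
  have e1 : ∀ θ : ℝ, ∫ r in Ioi (0 : ℝ), r ^ 1 * (Metric.ball (0 : E 2) 1).indicator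
      (fun x => ∑ j, pd j (fun y : E 2 => y j * (y i * ψ y)) x)
        (r • !₂[Real.sin θ, Real.cos θ]) =
      (fun y : E 2 => y i * ψ y) !₂[Real.sin θ, Real.cos θ] := by
    intro θ
    rw [integral_ray (k := 1) hF.1 (fun x => ?_) ?_]
    · simp [EuclideanSpace.norm_eq, Fin.sum_univ_two]
    · rw [sum_pd_coord_mul hF.1]; norm_num
  simp_rw [e1]
  have hIoo : Ioo (0 : ℝ) Real.pi = Ioo (-Real.pi) Real.pi ∩ Ioi 0 := by
    ext s; simp only [mem_Ioo, mem_inter_iff, mem_Ioi]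
    exact ⟨fun h => ⟨⟨by linarith, h.2⟩, h.1⟩, fun h => ⟨h.2, h.1.2⟩⟩
  rw [hIoo, ← setIntegral_indicator measurableSet_Ioi]
  refine setIntegral_congr_fun measurableSet_Ioo fun s hs => ?_
  by_cases h0 : s ∈ Ioi (0 : ℝ)
  · simp only [indicator_of_mem h0]; ring
  · simp only [indicator_of_notMem h0]
    refine hF.eq_zero_of_notMem (x := !₂[Real.sin s, Real.cos s]) ?_
    simpa using Real.sin_nonpos_of_nonpos_of_neg_pi_le (not_lt.1 h0) hs.1.le

end Polar

/-! ### `H¹` functions on the whole space that vanish off a ball -/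

section HOne

open Filter Topology

variable {n : ℕ} {R : ℝ} {v v' : E n → ℝ} {G G' : E n → E n} {Ω : Set (E n)}

/-- The classical gradient of `f`. -/
noncomputable def grd (f : E n → ℝ) (x : E n) : E n := WithLp.toLp 2 fun i => pd i f x

@[simp] theorem grd_apply (f : E n → ℝ) (x : E n) (i : Fin n) : grd f x i = pd i f x := rfl

theorem continuous_grd {f : E n → ℝ} (hf : ContDiff ℝ ∞ f) : Continuous (grd f) :=
  (PiLp.continuous_toLp 2 _).comp (continuous_pi fun i => (contDiff_pd (i := i) hf).continuous)

/-- `v ∈ H¹(ℝⁿ)` has the weak gradient `G`, and both vanish off the ball of radius `R`. -/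
structure IsH10 (R : ℝ) (v : E n → ℝ) (G : E n → E n) : Prop where
  memLp : MemLp v 2 volume
  memLp_grad : MemLp G 2 volume
  eq_zero : ∀ x ∉ Metric.ball (0 : E n) R, v x = 0
  grad_eq_zero : ∀ x ∉ Metric.ball (0 : E n) R, G x = 0
  integral_eq : ∀ φ : E n → ℝ, IsTest univ φ → ∀ i, ∫ x, v x * pd i φ x = - ∫ x, G x i * φ x

theorem integrable_of_memLp_of_eq_zero {F : Type*} [NormedAddCommGroup F] {f : E n → F}
    (h : MemLp f 2 volume) (h0 : ∀ x ∉ Metric.ball (0 : E n) R, f x = 0) : Integrable f := by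
  rw [← integrableOn_iff_integrable_of_support_subset (s := Metric.ball 0 R)
    (fun x hx => by by_contra h'; exact hx (h0 x h'))]
  have : IsFiniteMeasure (volume.restrict (Metric.ball (0 : E n) R)) :=
    ⟨by simpa using measure_ball_lt_top⟩
  exact (h.restrict _).integrable (by norm_num)

theorem memLp_apply {F : E n → E n} {p : ENNReal} {μ : Measure (E n)} (h : MemLp F p μ) (i : Fin n) :
    MemLp (fun x => F x i) p μ :=
  (EuclideanSpace.proj (𝕜 := ℝ) i).comp_memLp' h

theorem IsH10.integrable (h : IsH10 R v G) : Integrable v :=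
  integrable_of_memLp_of_eq_zero h.memLp h.eq_zero

theorem IsH10.integrable_grad (h : IsH10 R v G) : Integrable G :=
  integrable_of_memLp_of_eq_zero h.memLp_grad h.grad_eq_zero

theorem integrable_apply {F : E n → E n} {μ : Measure (E n)} (h : Integrable F μ) (i : Fin n) :
    Integrable (fun x => F x i) μ :=
  (EuclideanSpace.proj (𝕜 := ℝ) i).integrable_comp h

theorem IsTest.integrable_mul' {φ f : E n → ℝ} {U : Set (E n)} (hφ : IsTest U φ)
    {μ : Measure (E n)} (hf : Integrable f μ) : Integrable (fun x => f x * φ x) μ :=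
  hφ.integrable_mul hf.integrableOn

theorem IsH10.add (h : IsH10 R v G) (h' : IsH10 R v' G') :
    IsH10 R (fun x => v x + v' x) (fun x => G x + G' x) where
  memLp := h.memLp.add h'.memLp
  memLp_grad := h.memLp_grad.add h'.memLp_grad
  eq_zero x hx := by simp [h.eq_zero x hx, h'.eq_zero x hx]
  grad_eq_zero x hx := by simp [h.grad_eq_zero x hx, h'.grad_eq_zero x hx]
  integral_eq φ hφ i := by
    simp only [add_mul, PiLp.add_apply]
    rw [integral_add ((hφ.pd i).integrable_mul' h.integrable)
      ((hφ.pd i).integrable_mul' h'.integrable),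
      integral_add (hφ.integrable_mul' (integrable_apply h.integrable_grad i))
      (hφ.integrable_mul' (integrable_apply h'.integrable_grad i)),
      h.integral_eq φ hφ i, h'.integral_eq φ hφ i]
    ring

theorem IsH10.const_mul (c : ℝ) (h : IsH10 R v G) :
    IsH10 R (fun x => c * v x) (fun x => c • G x) where
  memLp := h.memLp.const_mul c
  memLp_grad := h.memLp_grad.const_smul c
  eq_zero x hx := by simp [h.eq_zero x hx]
  grad_eq_zero x hx := by simp [h.grad_eq_zero x hx]
  integral_eq φ hφ i := by
    simp only [PiLp.smul_apply, smul_eq_mul, mul_assoc, integral_const_mul,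
      h.integral_eq φ hφ i]
    ring

theorem IsH10.sub (h : IsH10 R v G) (h' : IsH10 R v' G') :
    IsH10 R (fun x => v x - v' x) (fun x => G x - G' x) := by
  have := h.add (h'.const_mul (-1))
  simpa [sub_eq_add_neg] using this

theorem IsH10.mono {R' : ℝ} (h : IsH10 R v G) (hR : R ≤ R') : IsH10 R' v G where
  memLp := h.memLp
  memLp_grad := h.memLp_grad
  eq_zero x hx := h.eq_zero x fun h' => hx (Metric.ball_subset_ball hR h')
  grad_eq_zero x hx := h.grad_eq_zero x fun h' => hx (Metric.ball_subset_ball hR h')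
  integral_eq := h.integral_eq

theorem IsTest.integral_mul_pd {φ f : E n → ℝ} {U : Set (E n)} (hφ : IsTest U φ)
    (hf : ContDiff ℝ ∞ f) (i : Fin n) : ∫ x, f x * LdG.pd i φ x = - ∫ x, LdG.pd i f x * φ x := by
  have h1 := (hφ.mul_left hf).integral_pd i
  simp_rw [fun x => pd_mul (i := i) (hf.differentiable (by simp) x) hφ.differentiableAt (x := x)]
    at h1
  rw [integral_add ((hφ.pd i).mul_left hf).integrable (hφ.mul_left (contDiff_pd hf)).integrable]
    at h1
  linarith

theorem isTest_ball_isH10 {φ : E n → ℝ} (h : IsTest (Metric.ball 0 R) φ) :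
    IsH10 R φ (grd φ) where
  memLp := h.memLp
  memLp_grad := by
    refine (continuous_grd h.1).memLp_of_hasCompactSupport ?_
    refine h.2.1.mono' fun x hx => ?_
    by_contra hx'
    refine hx ?_
    ext i
    exact image_eq_zero_of_notMem_tsupport (f := pd i φ)
      fun h' => hx' (tsupport_pd_subset i φ h')
  eq_zero x hx := h.eq_zero_of_notMem hx
  grad_eq_zero x hx := by ext i; exact (h.pd i).eq_zero_of_notMem hx
  integral_eq ψ hψ i := hψ.integral_mul_pd h.1 i

theorem IsH10.hasWeakGradient (h : IsH10 R v G) (Ω : Set (E n)) : HasWeakGradient Ω v G where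
  locInt := h.integrable.integrableOn.locallyIntegrableOn
  locInt_grad := h.integrable_grad.integrableOn.locallyIntegrableOn
  integral_eq φ hφ i := by
    rw [(hφ.pd i).setIntegral_eq, hφ.setIntegral_eq (f := fun x => G x i)]
    exact h.integral_eq φ (hφ.mono (subset_univ _)) i

theorem hasWeakGradient_grd {f : E n → ℝ} (hf : ContDiff ℝ ∞ f) (Ω : Set (E n)) :
    HasWeakGradient Ω f (grd f) where
  locInt := hf.continuous.locallyIntegrable.locallyIntegrableOn Ω
  locInt_grad := (continuous_grd hf).locallyIntegrable.locallyIntegrableOn Ω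
  integral_eq φ hφ i := by
    rw [(hφ.pd i).setIntegral_eq, hφ.setIntegral_eq (f := fun x => grd f x i)]
    exact hφ.integral_mul_pd hf i

theorem locallyIntegrableOn_apply {F : E n → E n} {s : Set (E n)} {μ : Measure (E n)}
    (h : LocallyIntegrableOn F s μ) (i : Fin n) : LocallyIntegrableOn (fun x => F x i) s μ := by
  intro x hx
  obtain ⟨t, ht, hi⟩ := h x hx
  exact ⟨t, ht, integrable_apply hi i⟩

theorem integrableOn_mul_test {f φ : E n → ℝ} (hf : LocallyIntegrableOn f Ω) (hφ : IsTest Ω φ) :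
    IntegrableOn (fun x => f x * φ x) Ω :=
  (hφ.integrable_mul (hf.integrableOn_compact_subset hφ.2.2 hφ.2.1)).integrableOn

theorem HasWeakGradient.add {f f' : E n → ℝ} (h : HasWeakGradient Ω f G)
    (h' : HasWeakGradient Ω f' G') :
    HasWeakGradient Ω (fun x => f x + f' x) (fun x => G x + G' x) where
  locInt := h.locInt.add h'.locInt
  locInt_grad := h.locInt_grad.add h'.locInt_grad
  integral_eq φ hφ i := by
    simp only [add_mul, PiLp.add_apply]
    rw [integral_add (integrableOn_mul_test h.locInt (hφ.pd i))
      (integrableOn_mul_test h'.locInt (hφ.pd i)),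
      integral_add (integrableOn_mul_test (locallyIntegrableOn_apply h.locInt_grad i) hφ)
      (integrableOn_mul_test (locallyIntegrableOn_apply h'.locInt_grad i) hφ),
      h.integral_eq φ hφ i, h'.integral_eq φ hφ i]
    ring

theorem locallyIntegrableOn_congr {X F : Type*} [MeasurableSpace X] [TopologicalSpace X]
    [OpensMeasurableSpace X] [SecondCountableTopology X] [NormedAddCommGroup F]
    {f g : X → F} {s : Set X} {μ : Measure X}
    (hf : LocallyIntegrableOn f s μ) (h : f =ᵐ[μ.restrict s] g) :
    LocallyIntegrableOn g s μ := by
  intro x hx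
  obtain ⟨t, ht, hi⟩ := hf x hx
  obtain ⟨u, hu, hut⟩ := mem_nhdsWithin.1 ht
  refine ⟨u ∩ s, inter_mem (mem_nhdsWithin_of_mem_nhds (hu.mem_nhds hut.1)) self_mem_nhdsWithin, ?_⟩
  exact (hi.mono_set hut.2).congr (ae_restrict_of_ae_restrict_of_subset inter_subset_right h)

theorem HasWeakGradient.congr {f f' : E n → ℝ} (h : HasWeakGradient Ω f G)
    (hf : f =ᵐ[volume.restrict Ω] f') (hG : G =ᵐ[volume.restrict Ω] G') :
    HasWeakGradient Ω f' G' where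
  locInt := locallyIntegrableOn_congr h.locInt hf
  locInt_grad := locallyIntegrableOn_congr h.locInt_grad hG
  integral_eq φ hφ i := by
    have e1 : (fun x => f x * pd i φ x) =ᵐ[volume.restrict Ω] fun x => f' x * pd i φ x :=
      hf.mono fun x hx => by simp only [hx]
    have e2 : (fun x => G x i * φ x) =ᵐ[volume.restrict Ω] fun x => G' x i * φ x :=
      hG.mono fun x hx => by simp only [hx]
    rw [← integral_congr_ae e1, ← integral_congr_ae e2]
    exact h.integral_eq φ hφ i

theorem HasWeakGradient.weakGrad_ae_eq {f : E n → ℝ} (h : HasWeakGradient Ω f G)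
    (hΩ : IsOpen Ω) : weakGrad Ω f =ᵐ[volume.restrict Ω] G := by
  have hex : ∃ G, HasWeakGradient Ω f G := ⟨G, h⟩
  rw [weakGrad, dif_pos hex]
  exact (ae_restrict_iff' hΩ.measurableSet).2 (hex.choose_spec.ae_eq hΩ h)

theorem HasWeakGradient.ae_eq' {f : E n → ℝ} (h : HasWeakGradient Ω f G)
    (h' : HasWeakGradient Ω f G') (hΩ : IsOpen Ω) : G =ᵐ[volume.restrict Ω] G' :=
  (ae_restrict_iff' hΩ.measurableSet).2 (h.ae_eq hΩ h')

/-! ### Boundary values on the unit sphere -/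

theorem isOpen_ball₁ : IsOpen ball₁ := Metric.isOpen_ball

instance : IsFiniteMeasure (volume.restrict ball₁) :=
  ⟨by simp [ball₁]⟩

instance : IsFiniteMeasure sphereMeasure := by
  unfold sphereMeasure; infer_instance

theorem ae_sphereMeasure : ∀ᵐ x ∂sphereMeasure, ‖x‖ = 1 := by
  rw [sphereMeasure, (MeasurableEmbedding.subtype_coe
    Metric.isClosed_sphere.measurableSet).ae_map_iff]
  exact Eventually.of_forall fun x => by simp

theorem integrable_ball₁_of_continuous {F : Type*} [NormedAddCommGroup F] {f : E 3 → F}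
    (hf : Continuous f) {p : ENNReal} : MemLp f p (volume.restrict ball₁) := by
  obtain ⟨C, hC⟩ := (isCompact_closedBall (0 : E 3) 1).exists_bound_of_continuousOn hf.continuousOn
  refine MemLp.of_bound hf.aestronglyMeasurable C ?_
  filter_upwards [ae_restrict_mem isOpen_ball₁.measurableSet] with x hx
  exact hC x (Metric.ball_subset_closedBall hx)

variable {w w₀ g : E 3 → ℝ} {v : E 3 → ℝ} {G : E 3 → E 3}

theorem integral_ball_smooth (hw₀ : ContDiff ℝ ∞ w₀) (hg : ∀ x, ‖x‖ = 1 → g x = w₀ x)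
    {φ : E 3 → ℝ} (hφ : IsTest univ φ) (i : Fin 3) :
    ∫ x in ball₁, (w₀ x * pd i φ x + pd i w₀ x * φ x)
      = ∫ x, g x * φ x * x i ∂sphereMeasure := by
  have := integral_ball_pd (hφ.mul_left hw₀) i
  simp_rw [fun x => pd_mul (i := i) (hw₀.differentiable (by simp) x) hφ.differentiableAt (x := x)]
    at this
  rw [this]
  refine integral_congr_ae (ae_sphereMeasure.mono fun x hx => ?_)
  simp only [hg x hx]

/-- A function in `H¹(B₁)` with the boundary values of the smooth function `w₀` differs from `w₀`
by a function whose extension by zero is in `H¹(ℝ³)`. -/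
theorem exists_isH10_of_hasTrace (hw₀ : ContDiff ℝ ∞ w₀) (hg : ∀ x, ‖x‖ = 1 → g x = w₀ x)
    (hw : MemH1 ball₁ w) (ht : HasTrace ball₁ univ sphereMeasure id w g) :
    ∃ G, IsH10 1 (ball₁.indicator fun x => w x - w₀ x) G ∧
      weakGrad ball₁ w =ᵐ[volume.restrict ball₁] fun x => grd w₀ x + G x := by
  obtain ⟨hw2, Gw, hGw, hGw2⟩ := hw
  obtain ⟨-, -, G', hG', -, htr⟩ := ht
  have hGG := hGw.ae_eq' hG' isOpen_ball₁
  have hm := isOpen_ball₁.measurableSet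
  have m1 : MemLp (fun x => w x - w₀ x) 2 (volume.restrict ball₁) :=
    hw2.sub (integrable_ball₁_of_continuous hw₀.continuous)
  have m2 : MemLp (fun x => Gw x - grd w₀ x) 2 (volume.restrict ball₁) :=
    hGw2.sub (integrable_ball₁_of_continuous (continuous_grd hw₀))
  refine ⟨ball₁.indicator fun x => Gw x - grd w₀ x,
    ⟨(memLp_indicator_iff_restrict hm).2 m1, (memLp_indicator_iff_restrict hm).2 m2,
      fun x hx => indicator_of_notMem hx _, fun x hx => indicator_of_notMem hx _,
      fun φ hφ i => ?_⟩, ?_⟩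
  -- The Gauss-Green formulas for `w` and for `w₀` have the same boundary term. Their difference is
  -- integration by parts against every compactly supported test function of the whole space.
  · have e1 := htr φ hφ i
    rw [← integral_congr_ae (hGG.mono fun x hx => by simp only [hx] :
      (fun x => w x * pd i φ x + Gw x i * φ x) =ᵐ[volume.restrict ball₁] _)] at e1
    have e2 := integral_ball_smooth hw₀ hg hφ i
    simp only [id] at e1
    rw [← e2] at e1
    have j1 : IntegrableOn (fun x => (w x - w₀ x) * pd i φ x) ball₁ :=
      (hφ.pd i).integrable_mul' (m1.integrable (by norm_num))
    have j2 : IntegrableOn (fun x => (Gw x - grd w₀ x) i * φ x) ball₁ :=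
      hφ.integrable_mul' (integrable_apply (m2.integrable (by norm_num)) i)
    have l1 : (fun x => ball₁.indicator (fun x => w x - w₀ x) x * pd i φ x)
        = ball₁.indicator (fun x => (w x - w₀ x) * pd i φ x) := by
      ext x; by_cases hx : x ∈ ball₁ <;> simp [hx]
    have l2 : (fun x => ball₁.indicator (fun x => Gw x - grd w₀ x) x i * φ x)
        = ball₁.indicator (fun x => (Gw x - grd w₀ x) i * φ x) := by
      ext x; by_cases hx : x ∈ ball₁ <;> simp [hx]
    rw [l1, l2, integral_indicator hm, integral_indicator hm, eq_neg_iff_add_eq_zero,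
      ← integral_add j1 j2]
    have j3 : IntegrableOn (fun x => w x * pd i φ x + Gw x i * φ x) ball₁ :=
      ((hφ.pd i).integrable_mul' (hw2.integrable (by norm_num))).add
        (hφ.integrable_mul' (integrable_apply (hGw2.integrable (by norm_num)) i))
    have j4 : IntegrableOn (fun x => w₀ x * pd i φ x + pd i w₀ x * φ x) ball₁ :=
      (((hφ.pd i).mul_left hw₀).add (hφ.mul_left (contDiff_pd hw₀))).integrable.integrableOn
    rw [← sub_eq_zero, ← integral_sub j3 j4] at e1
    rw [← e1]
    refine integral_congr_ae (Eventually.of_forall fun x => ?_)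
    simp only [PiLp.sub_apply, grd_apply]; ring
  · refine (hGw.weakGrad_ae_eq isOpen_ball₁).trans ?_
    filter_upwards [ae_restrict_mem hm] with x hx
    simp [indicator_of_mem hx]

theorem IsH10.hasWeakGradient_add (h : IsH10 1 v G) (hw₀ : ContDiff ℝ ∞ w₀)
    (hw : w =ᵐ[volume.restrict ball₁] fun x => w₀ x + v x) :
    HasWeakGradient ball₁ w fun x => grd w₀ x + G x :=
  ((hasWeakGradient_grd hw₀ ball₁).add (h.hasWeakGradient ball₁)).congr
    hw.symm (ae_eq_refl _)

theorem IsH10.memH1_add (h : IsH10 1 v G) (hw₀ : ContDiff ℝ ∞ w₀)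
    (hw : w =ᵐ[volume.restrict ball₁] fun x => w₀ x + v x) : MemH1 ball₁ w :=
  ⟨((integrable_ball₁_of_continuous hw₀.continuous).add (h.memLp.restrict _)).ae_eq hw.symm,
    _, h.hasWeakGradient_add hw₀ hw,
    (integrable_ball₁_of_continuous (continuous_grd hw₀)).add (h.memLp_grad.restrict _)⟩

/-- Converse of `exists_isH10_of_hasTrace`: a function whose zero extension is in `H¹` contributes
no boundary term, so the Gauss-Green formula of `w₀` carries over to the sum. -/
theorem IsH10.hasTrace_add (h : IsH10 1 v G) (hw₀ : ContDiff ℝ ∞ w₀)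
    (hw : w =ᵐ[volume.restrict ball₁] fun x => w₀ x + v x)
    (hg : ∀ x, ‖x‖ = 1 → g x = w₀ x) : HasTrace ball₁ univ sphereMeasure id w g := by
  have hm := isOpen_ball₁.measurableSet
  obtain ⟨hw2, -⟩ := h.memH1_add hw₀ hw
  have hG2 : MemLp (fun x => grd w₀ x + G x) 2 (volume.restrict ball₁) :=
    (integrable_ball₁_of_continuous (continuous_grd hw₀)).add (h.memLp_grad.restrict _)
  refine ⟨?_, (hw2.integrable (by norm_num)).integrableOn.locallyIntegrableOn, _,
    h.hasWeakGradient_add hw₀ hw, (hG2.integrable (by norm_num)).integrableOn.locallyIntegrableOn,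
    fun φ hφ i => ?_⟩
  · refine Integrable.integrableOn ?_ |>.locallyIntegrableOn
    obtain ⟨C, hC⟩ := (isCompact_closedBall (0 : E 3) 1).exists_bound_of_continuousOn
      hw₀.continuous.continuousOn
    refine (MeasureTheory.Integrable.of_bound hw₀.continuous.aestronglyMeasurable C
      (ae_sphereMeasure.mono fun x hx => hC x (by simp [hx]))).congr
      (ae_sphereMeasure.mono fun x hx => (hg x hx).symm)
  · simp only [id]
    rw [← integral_ball_smooth hw₀ hg hφ i]
    have j1 : Integrable (fun x => v x * pd i φ x) := (hφ.pd i).integrable_mul' h.integrable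
    have j2 : Integrable (fun x => G x i * φ x) :=
      hφ.integrable_mul' (integrable_apply h.integrable_grad i)
    have j4 : IntegrableOn (fun x => w₀ x * pd i φ x + pd i w₀ x * φ x) ball₁ :=
      (((hφ.pd i).mul_left hw₀).add (hφ.mul_left (contDiff_pd hw₀))).integrable.integrableOn
    have e := h.integral_eq φ hφ i
    rw [eq_neg_iff_add_eq_zero, ← integral_add j1 j2,
      ← setIntegral_eq_integral_of_forall_compl_eq_zero (s := ball₁)
      (fun x hx => by simp [h.eq_zero x hx, h.grad_eq_zero x hx])] at e
    rw [← add_zero (∫ x in ball₁, (w₀ x * pd i φ x + pd i w₀ x * φ x)), ← e,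
      ← integral_add (g := fun x => v x * pd i φ x + G x i * φ x) j4 (j1.add j2).integrableOn]
    refine integral_congr_ae (hw.mono fun x hx => ?_)
    simp only [hx, PiLp.add_apply, grd_apply]; ring

end HOne

/-! ### Compactness in `L²` -/

section Rellich

open Filter Topology

theorem sq_integral_mul_le {α : Type*} [MeasurableSpace α] {μ : Measure α} {f g : α → ℝ}
    (hf : MemLp f 2 μ) (hg : MemLp g 2 μ) :
    (∫ x, f x * g x ∂μ) ^ 2 ≤ (∫ x, f x ^ 2 ∂μ) * ∫ x, g x ^ 2 ∂μ := by
  have key : ∀ {f g : α → ℝ} (hf : MemLp f 2 μ) (hg : MemLp g 2 μ),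
      inner ℝ (hf.toLp f) (hg.toLp g) = ∫ x, f x * g x ∂μ := by
    intro f g hf hg
    rw [L2.inner_def]
    refine integral_congr_ae ?_
    filter_upwards [hf.coeFn_toLp, hg.coeFn_toLp] with x h1 h2
    simp [h1, h2, mul_comm]
  have h := real_inner_mul_inner_self_le (hf.toLp f) (hg.toLp g)
  simpa only [key, ← sq] using h

theorem sq_integral_le {α : Type*} [MeasurableSpace α] {μ : Measure α} [IsFiniteMeasure μ]
    {f : α → ℝ} (hf : MemLp f 2 μ) :
    (∫ x, f x ∂μ) ^ 2 ≤ μ.real univ * ∫ x, f x ^ 2 ∂μ := by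
  have := sq_integral_mul_le (memLp_const (μ := μ) (p := 2) (1 : ℝ)) hf
  simpa using this

variable {n : ℕ}

/-- A function whose pairing with test functions is bounded in the `L²` norm. -/
theorem integral_sq_le_of_forall_isTest {f : E n → ℝ} (hf : MemLp f 2) {M : ℝ}
    (hM : 0 ≤ M) (h : ∀ φ : E n → ℝ, IsTest univ φ → (∫ x, f x * φ x) ^ 2 ≤ M * ∫ x, φ x ^ 2) :
    ∫ x, f x ^ 2 ≤ M := by
  have key : ∀ {f g : E n → ℝ} (hf : MemLp f 2) (hg : MemLp g 2),
      inner ℝ (hf.toLp f) (hg.toLp g) = ∫ x, f x * g x := by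
    intro f g hf hg
    rw [L2.inner_def]
    refine integral_congr_ae ?_
    filter_upwards [hf.coeFn_toLp, hg.coeFn_toLp] with x h1 h2
    simp [h1, h2, mul_comm]
  set F := hf.toLp f
  have hcl : IsClosed {g : Lp ℝ 2 (volume : Measure (E n)) |
      (inner ℝ F g : ℝ) ^ 2 ≤ M * inner ℝ g g} := by
    refine isClosed_le ?_ ?_ <;> fun_prop
  have hall : ∀ g : Lp ℝ 2 (volume : Measure (E n)), (inner ℝ F g : ℝ) ^ 2 ≤ M * inner ℝ g g := by
    intro g
    have hd := Lp.dense_hasCompactSupport_contDiff (E := E n) (F := ℝ)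
      (μ := volume) (p := 2) (by norm_num)
    refine hcl.closure_subset_iff.2 ?_ (hd g)
    rintro g ⟨φ, hgφ, hφc, hφs⟩
    have hφ : IsTest univ φ := ⟨hφs, hφc, subset_univ _⟩
    have e : g = hφ.memLp.toLp φ := by
      apply Lp.ext
      exact hgφ.trans hφ.memLp.coeFn_toLp.symm
    simp only [mem_ofPred_eq]
    rw [e, key, key]
    simpa [sq] using h φ hφ
  -- The estimate extends from test functions to all of `L²` by density. For `g = F` it reads `(∫
  -- f²)² ≤ M ∫ f²`.
  have := hall F
  rw [key] at this
  simp only [← sq] at this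
  have h0 : 0 ≤ ∫ x, f x ^ 2 := integral_nonneg fun x => sq_nonneg _
  rcases h0.lt_or_eq with h1 | h1
  · nlinarith
  · rwa [← h1]

variable {R : ℝ} {v : E n → ℝ} {G : E n → E n}

theorem memLp_sub_translate (hv : MemLp v 2) (h : E n) : MemLp (fun x => v (x - h) - v x) 2 :=
  (hv.comp_measurePreserving (measurePreserving_sub_right volume h)).sub hv

/-- By duality the translation is moved onto a test function. The map `t ↦ ∫ v φ(· + t h)` has the
derivative `-∫ ⟨h, G⟩ φ(· + t h)`, which Cauchy-Schwarz bounds uniformly in `t`. In this way `v`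
need not be approximated by smooth functions. -/
theorem IsH10.integral_sq_sub_translate_le (H : IsH10 R v G) (h : E n) :
    ∫ x, (v (x - h) - v x) ^ 2 ≤ ‖h‖ ^ 2 * ∫ x, ‖G x‖ ^ 2 := by
  refine integral_sq_le_of_forall_isTest (memLp_sub_translate H.memLp h)
    (mul_nonneg (sq_nonneg _) (integral_nonneg fun x => sq_nonneg _)) fun φ hφ => ?_
  have hline : ∀ (t : ℝ), IsTest univ fun x => φ (x + t • h) := fun t =>
    ⟨hφ.1.comp (contDiff_id.add contDiff_const),
      hφ.2.1.comp_homeomorph (Homeomorph.addRight (t • h)), subset_univ _⟩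
  set F : ℝ → ℝ := fun t => ∫ x, v x * φ (x + t • h) with hF
  have hL2 : MemLp (fun x => inner ℝ h (G x)) 2 := by
    have := (innerSL ℝ h).comp_memLp' H.memLp_grad
    exact this
  have hGn : Integrable (fun x => ‖G x‖ ^ 2) := H.memLp_grad.norm.integrable_sq
  have hF' : ∀ t, HasDerivAt F (-∫ x, inner ℝ h (G x) * φ (x + t • h)) t := by
    intro t
    obtain ⟨C, hC⟩ := (hφ.2.1.fderiv ℝ).exists_bound_of_continuous
      (hφ.1.continuous_fderiv (by simp))
    have hder : ∀ x t, HasDerivAt (fun t : ℝ => v x * φ (x + t • h))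
        (v x * fderiv ℝ φ (x + t • h) h) t := by
      intro x t
      have hl : HasDerivAt (fun t : ℝ => x + t • h) h t := by
        simpa using ((hasDerivAt_id t).smul_const h).const_add x
      exact ((hφ.differentiable _).hasFDerivAt.comp_hasDerivAt t hl).const_mul (v x)
    have hd := (hasDerivAt_integral_of_dominated_loc_of_deriv_le (μ := volume) (x₀ := t)
      (F := fun t x => v x * φ (x + t • h))
      (F' := fun t x => v x * fderiv ℝ φ (x + t • h) h) (s := univ)
      (bound := fun x => |v x| * (C * ‖h‖)) univ_mem
      (Eventually.of_forall fun t => ((hline t).integrable_mul' H.integrable).1)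
      ((hline t).integrable_mul' H.integrable)
      (H.integrable.1.mul (((hφ.1.continuous_fderiv (by simp)).comp
        (by fun_prop : Continuous fun x : E n => x + t • h)).clm_apply
          continuous_const).aestronglyMeasurable)
      (Eventually.of_forall fun x t _ => ?_) (H.integrable.abs.mul_const _)
      (Eventually.of_forall fun x t _ => hder x t)).2
    · have hd : HasDerivAt F (∫ x, v x * fderiv ℝ φ (x + t • h) h) t := hd
      convert hd using 1
      have hp : ∀ x, fderiv ℝ φ (x + t • h) h = ∑ i, h i * pd i (fun y => φ (y + t • h)) x := by
        intro x
        rw [fderiv_apply_eq_sum]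
        simp only [pd, fderiv_comp_add_right]
      have hp' : ∀ x, v x * fderiv ℝ φ (x + t • h) h
          = ∑ i, h i * (v x * pd i (fun y => φ (y + t • h)) x) := by
        intro x
        rw [hp, Finset.mul_sum]
        exact Finset.sum_congr rfl fun i _ => by ring
      simp_rw [hp']
      rw [integral_finsetSum _ fun i _ =>
        (((hline t).pd i).integrable_mul' H.integrable).const_mul (h i)]
      simp_rw [integral_const_mul, H.integral_eq _ (hline t)]
      have : ∀ x, inner ℝ h (G x) * φ (x + t • h) = ∑ i, h i * (G x i * φ (x + t • h)) := by
        intro x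
        rw [PiLp.inner_apply, Finset.sum_mul]
        refine Finset.sum_congr rfl fun i _ => ?_
        simp; ring
      simp_rw [this]
      rw [integral_finsetSum _ fun i _ =>
        ((hline t).integrable_mul' (integrable_apply H.integrable_grad i)).const_mul (h i),
        ← Finset.sum_neg_distrib]
      refine Finset.sum_congr rfl fun i _ => ?_
      rw [integral_const_mul]; ring
    · rw [norm_mul]
      exact mul_le_mul_of_nonneg_left ((ContinuousLinearMap.le_opNorm _ _).trans
        (mul_le_mul_of_nonneg_right (hC _) (norm_nonneg _))) (norm_nonneg _)
  obtain ⟨M, hM⟩ : ∃ M : ℝ, M = ‖h‖ ^ 2 * ∫ x, ‖G x‖ ^ 2 := ⟨_, rfl⟩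
  rw [← hM]
  have hbound : ∀ t : ℝ, (∫ x, inner ℝ h (G x) * φ (x + t • h)) ^ 2 ≤ M * ∫ x, φ x ^ 2 := by
    intro t
    refine (sq_integral_mul_le hL2 (hline t).memLp).trans ?_
    rw [integral_add_right_eq_self (fun x => φ x ^ 2) (t • h)]
    refine mul_le_mul_of_nonneg_right ?_ (integral_nonneg fun x => sq_nonneg _)
    rw [hM, ← integral_const_mul]
    refine integral_mono hL2.integrable_sq (hGn.const_mul _) fun x => ?_
    have := abs_real_inner_le_norm h (G x)
    rw [← mul_pow]
    exact sq_le_sq' (by linarith [neg_abs_le (inner ℝ h (G x) : ℝ)]) ((le_abs_self _).trans this)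
  have hmv : ‖F 1 - F 0‖ ≤ Real.sqrt (M * ∫ x, φ x ^ 2) * ‖(1 : ℝ) - 0‖ := by
    refine (convex_univ).norm_image_sub_le_of_norm_hasDerivWithin_le
      (f' := fun t => -∫ x, inner ℝ h (G x) * φ (x + t • h))
      (fun t _ => (hF' t).hasDerivWithinAt) (fun t _ => ?_) (mem_univ _) (mem_univ _)
    rw [norm_neg, Real.norm_eq_abs]
    exact Real.abs_le_sqrt (hbound t)
  have hM0 : 0 ≤ M * ∫ x, φ x ^ 2 := by
    rw [hM]
    exact mul_nonneg (mul_nonneg (sq_nonneg _) (integral_nonneg fun x => sq_nonneg _))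
      (integral_nonneg fun x => sq_nonneg _)
  have e : ∫ x, (v (x - h) - v x) * φ x = F 1 - F 0 := by
    have i1 : Integrable (fun x => v (x - h) * φ x) :=
      hφ.integrable_mul' (H.integrable.comp_sub_right h)
    simp_rw [sub_mul]
    rw [integral_sub i1 (hφ.integrable_mul' H.integrable), hF]
    simp only [one_smul, zero_smul, add_zero]
    rw [← integral_add_right_eq_self (fun x => v (x - h) * φ x) h]
    simp
  rw [e, ← Real.sq_sqrt hM0, ← sq_abs]
  simp only [Real.norm_eq_abs, sub_zero, abs_one, mul_one] at hmv
  exact pow_le_pow_left₀ (abs_nonneg _) hmv 2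

end Rellich

/-! ### Weak compactness, ball averages and Rellich's theorem -/

section Rellich

open Filter Topology

variable {n : ℕ} {R : ℝ} {v : E n → ℝ} {G : E n → E n}

/-- A bounded sequence in `L²` has a weakly convergent subsequence. -/
theorem exists_subseq_weak {α : Type*} [MeasurableSpace α] {μ : Measure α}
    [SFinite μ] [MeasurableSpace.CountablyGenerated α]
    {v : ℕ → α → ℝ} (hv : ∀ m, MemLp (v m) 2 μ) {C : ℝ} (hC : ∀ m, ∫ x, v m x ^ 2 ∂μ ≤ C) :
    ∃ φ : ℕ → ℕ, StrictMono φ ∧ ∀ g : α → ℝ, MemLp g 2 μ →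
      ∃ l, Tendsto (fun m => ∫ x, v (φ m) x * g x ∂μ) atTop (𝓝 l) := by
  have key : ∀ {f g : α → ℝ} (hf : MemLp f 2 μ) (hg : MemLp g 2 μ),
      inner ℝ (hf.toLp f) (hg.toLp g) = ∫ x, f x * g x ∂μ := by
    intro f g hf hg
    rw [L2.inner_def]
    refine integral_congr_ae ?_
    filter_upwards [hf.coeFn_toLp, hg.coeFn_toLp] with x h1 h2
    simp [h1, h2, mul_comm]
  have : Fact ((2 : ENNReal) ≠ ⊤) := ⟨by norm_num⟩
  set X := Lp ℝ 2 μ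
  let T : ℕ → WeakDual ℝ X := fun m =>
    StrongDual.toWeakDual (InnerProductSpace.toDual ℝ X ((hv m).toLp (v m)))
  have hT : ∀ m, T m ∈ WeakDual.toStrongDual ⁻¹' Metric.closedBall (0 : StrongDual ℝ X) (Real.sqrt C) := by
    intro m
    rw [mem_preimage, mem_closedBall_zero_iff]
    change ‖InnerProductSpace.toDual ℝ X ((hv m).toLp (v m))‖ ≤ _
    rw [LinearIsometryEquiv.norm_map]
    apply Real.le_sqrt_of_sq_le
    rw [← real_inner_self_eq_norm_sq, key]
    simpa [sq] using hC m
  obtain ⟨L, -, φ, hφ, hL⟩ := WeakDual.isSeqCompact_closedBall ℝ X (0 : StrongDual ℝ X) (Real.sqrt C) hT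
  refine ⟨φ, hφ, fun g hg => ⟨L (hg.toLp g), ?_⟩⟩
  have := (tendsto_iff_forall_eval_tendsto_topDualPairing.1 hL) (hg.toLp g)
  refine this.congr fun m => ?_
  rw [← key (hv (φ m)) hg]
  rfl

/-- The average of `v` over the ball of radius `ε` about `x`. -/
noncomputable def ballAvg (ε : ℝ) (v : E n → ℝ) (x : E n) : ℝ :=
  (volume.real (Metric.ball (0 : E n) ε))⁻¹ * ∫ h in Metric.ball (0 : E n) ε, v (x - h)

theorem volume_ball_pos {ε : ℝ} (hε : 0 < ε) : 0 < volume.real (Metric.ball (0 : E n) ε) :=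
  ENNReal.toReal_pos (Metric.measure_ball_pos _ _ hε).ne' measure_ball_lt_top.ne

instance (ε : ℝ) : IsFiniteMeasure (volume.restrict (Metric.ball (0 : E n) ε)) :=
  ⟨by simp [measure_ball_lt_top]⟩

theorem memLp_translate (hv : MemLp v 2) (x : E n) : MemLp (fun h => v (x - h)) 2 :=
  hv.comp_measurePreserving (Measure.measurePreserving_sub_left volume x)

/-- As a pairing with a fixed `L²` function, the average at a point passes to the limit along weakly
convergent sequences. -/
theorem ballAvg_eq (ε : ℝ) (v : E n → ℝ) (x : E n) : ballAvg ε v x =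
    (volume.real (Metric.ball (0 : E n) ε))⁻¹ *
      ∫ y, v y * (Metric.ball x ε).indicator (fun _ => (1 : ℝ)) y := by
  rw [ballAvg, ← integral_indicator Metric.isOpen_ball.measurableSet,
    ← integral_sub_left_eq_self _ volume x]
  congr 1
  refine integral_congr_ae (Eventually.of_forall fun y => ?_)
  simp only [indicator, Metric.mem_ball, dist_zero_right]
  rw [dist_eq_norm, ← norm_neg (x - y), neg_sub]
  split_ifs <;> simp

theorem aestronglyMeasurable_translate {ε : ℝ} (hv : AEStronglyMeasurable v volume) :
    AEStronglyMeasurable (fun p : E n × E n => v (p.1 - p.2))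
      (volume.prod (volume.restrict (Metric.ball (0 : E n) ε))) :=
  hv.comp_quasiMeasurePreserving (quasiMeasurePreserving_sub_of_right_invariant _ _)

theorem aestronglyMeasurable_ballAvg {ε : ℝ} (hv : AEStronglyMeasurable v volume) :
    AEStronglyMeasurable (ballAvg ε v) volume :=
  ((aestronglyMeasurable_translate hv).integral_prod_right').const_mul _

/-- The bound does not depend on the point, so on a bounded set it serves as the majorant for
dominated convergence of the averages. -/
theorem sq_ballAvg_le {ε : ℝ} (hε : 0 < ε) (hv : MemLp v 2) (x : E n) :
    ballAvg ε v x ^ 2 ≤ (volume.real (Metric.ball (0 : E n) ε))⁻¹ * ∫ y, v y ^ 2 := by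
  have hp := volume_ball_pos (n := n) hε
  have h1 := sq_integral_le ((memLp_translate hv x).restrict (Metric.ball (0 : E n) ε))
  have h2 : ∫ h in Metric.ball (0 : E n) ε, v (x - h) ^ 2 ≤ ∫ y, v y ^ 2 := by
    refine (setIntegral_le_integral (memLp_translate hv x).integrable_sq
      (Eventually.of_forall fun y => sq_nonneg _)).trans_eq ?_
    exact integral_sub_left_eq_self (fun y => v y ^ 2) volume x
  rw [measureReal_restrict_apply_univ] at h1
  rw [ballAvg, mul_pow, sq (volume.real (Metric.ball (0 : E n) ε))⁻¹, mul_assoc]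
  refine mul_le_mul_of_nonneg_left ?_ (by positivity)
  rw [inv_mul_le_iff₀ hp]
  exact h1.trans (mul_le_mul_of_nonneg_left h2 hp.le)

/-- By Jensen the squared error is at most the mean of `(v(x - h) - v x)²` over `‖h‖ < ε`. Fubini
and the translation estimate do the rest. -/
theorem IsH10.integral_sq_ballAvg_sub_le (H : IsH10 R v G) {ε : ℝ} (hε : 0 < ε) :
    Integrable (fun x => (ballAvg ε v x - v x) ^ 2) ∧
    ∫ x, (ballAvg ε v x - v x) ^ 2 ≤ ε ^ 2 * ∫ x, ‖G x‖ ^ 2 := by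
  set B := Metric.ball (0 : E n) ε
  have hp : 0 < volume.real B := volume_ball_pos (n := n) hε
  set ν := volume.restrict B with hν
  set I := ∫ x, ‖G x‖ ^ 2 with hI
  have hI0 : 0 ≤ I := integral_nonneg fun x => sq_nonneg _
  have hm : AEStronglyMeasurable (fun p : E n × E n => (v (p.1 - p.2) - v p.1) ^ 2)
      (volume.prod ν) :=
    ((aestronglyMeasurable_translate H.memLp.1).sub H.memLp.1.comp_fst).pow 2
  have hle : ∀ h ∈ B, ∫ x, (v (x - h) - v x) ^ 2 ≤ ε ^ 2 * I := fun h hh =>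
    (H.integral_sq_sub_translate_le h).trans (mul_le_mul_of_nonneg_right
      (pow_le_pow_left₀ (norm_nonneg _) (mem_ball_zero_iff.1 hh).le 2) hI0)
  have hint : Integrable (fun p : E n × E n => (v (p.1 - p.2) - v p.1) ^ 2) (volume.prod ν) := by
    rw [integrable_prod_iff' hm]
    refine ⟨Eventually.of_forall fun h => (memLp_sub_translate H.memLp h).integrable_sq, ?_⟩
    refine Integrable.of_bound (hm.norm.prod_swap.integral_prod_right') (ε ^ 2 * I) ?_
    filter_upwards [ae_restrict_mem Metric.isOpen_ball.measurableSet] with h hh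
    rw [Real.norm_of_nonneg (integral_nonneg fun x => norm_nonneg _)]
    simpa using hle h hh
  have hj : ∀ x, (ballAvg ε v x - v x) ^ 2
      ≤ (volume.real B)⁻¹ * ∫ h, (v (x - h) - v x) ^ 2 ∂ν := by
    intro x
    have hL : MemLp (fun h => v (x - h) - v x) 2 ν :=
      ((memLp_translate H.memLp x).restrict B).sub (memLp_const _)
    have h1 := sq_integral_le hL
    rw [integral_sub (((memLp_translate H.memLp x).restrict B).integrable (by norm_num))
      (integrable_const _), integral_const, measureReal_restrict_apply_univ] at h1
    have e : ballAvg ε v x - v x = (volume.real B)⁻¹ * (∫ h, v (x - h) ∂ν - volume.real B • v x) := by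
      rw [ballAvg, mul_sub, smul_eq_mul, inv_mul_cancel_left₀ hp.ne']
    rw [e, mul_pow, sq (volume.real B)⁻¹, mul_assoc]
    refine mul_le_mul_of_nonneg_left ?_ (by positivity)
    rw [inv_mul_le_iff₀ hp]
    exact h1
  have hi2 : Integrable (fun x => (volume.real B)⁻¹ * ∫ h, (v (x - h) - v x) ^ 2 ∂ν) :=
    hint.integral_prod_left.const_mul _
  have hi1 : Integrable (fun x => (ballAvg ε v x - v x) ^ 2) := by
    refine hi2.mono' (((aestronglyMeasurable_ballAvg H.memLp.1).sub H.memLp.1).pow 2)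
      (Eventually.of_forall fun x => ?_)
    rw [Real.norm_of_nonneg (sq_nonneg _)]
    exact hj x
  refine ⟨hi1, (integral_mono hi1 hi2 hj).trans ?_⟩
  rw [integral_const_mul, ← integral_prod (f := fun p : E n × E n => (v (p.1 - p.2) - v p.1) ^ 2) hint,
    integral_prod_symm _ hint, inv_mul_le_iff₀ hp]
  refine (setIntegral_mono_on (g := fun _ => ε ^ 2 * I) hint.integral_prod_right
    (integrable_const _) Metric.isOpen_ball.measurableSet hle).trans_eq ?_
  rw [integral_const, measureReal_restrict_apply_univ, smul_eq_mul]

/-- **Rellich's theorem**, for functions vanishing off the unit ball. -/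
theorem exists_subseq_cauchy {v : ℕ → E n → ℝ} {G : ℕ → E n → E n} (H : ∀ m, IsH10 1 (v m) (G m))
    {C : ℝ} (hv : ∀ m, ∫ x, v m x ^ 2 ≤ C) (hG : ∀ m, ∫ x, ‖G m x‖ ^ 2 ≤ C) :
    ∃ φ : ℕ → ℕ, StrictMono φ ∧ ∀ δ > 0, ∃ N, ∀ m ≥ N, ∀ k ≥ N,
      ∫ x, (v (φ m) x - v (φ k) x) ^ 2 ≤ δ := by
  obtain ⟨φ, hφ, hw⟩ := exists_subseq_weak (fun m => (H m).memLp) hv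
  refine ⟨φ, hφ, fun δ hδ => ?_⟩
  have hC : 0 ≤ C := (integral_nonneg fun x => sq_nonneg _).trans (hv 0)
  -- Half of `δ` is reserved for the averaging error of the difference, whose squared gradient norm
  -- is at most `4 C`. The other half is `4 · δ/16 + 4 · δ/16`, from the distances of the two
  -- averages to their limit.
  obtain ⟨ε, hε, hε2⟩ : ∃ ε : ℝ, 0 < ε ∧ 2 * (ε ^ 2 * (4 * C)) ≤ δ / 2 := by
    refine ⟨Real.sqrt (δ / (16 * (C + 1))), Real.sqrt_pos.2 (by positivity), ?_⟩
    rw [Real.sq_sqrt (by positivity)]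
    rw [div_mul_eq_mul_div, mul_div_assoc', div_le_div_iff₀ (by positivity) (by norm_num)]
    nlinarith
  set B := Metric.ball (0 : E n) 1
  have hB : MeasurableSet B := Metric.isOpen_ball.measurableSet
  have hp := volume_ball_pos (n := n) hε
  -- the averages converge pointwise, hence in `L²` of the unit ball
  have hpt : ∀ x, ∃ l, Tendsto (fun m => ballAvg ε (v (φ m)) x) atTop (𝓝 l) := by
    intro x
    obtain ⟨l, hl⟩ := hw ((Metric.ball x ε).indicator fun _ => 1)
      ((memLp_indicator_const 2 Metric.isOpen_ball.measurableSet 1 (Or.inr measure_ball_lt_top.ne)))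
    refine ⟨(volume.real (Metric.ball (0 : E n) ε))⁻¹ * l, ?_⟩
    simp_rw [ballAvg_eq]
    exact hl.const_mul _
  choose a ha using hpt
  set K : ℝ := (volume.real (Metric.ball (0 : E n) ε))⁻¹ * C with hK
  have hK0 : 0 ≤ K := by positivity
  have hbd : ∀ m x, ballAvg ε (v m) x ^ 2 ≤ K := fun m x =>
    (sq_ballAvg_le hε (H m).memLp x).trans (mul_le_mul_of_nonneg_left (hv m) (by positivity))
  have habd : ∀ x, a x ^ 2 ≤ K := fun x =>
    le_of_tendsto ((ha x).pow 2) (Eventually.of_forall fun m => hbd _ x)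
  have ham : AEStronglyMeasurable a (volume.restrict B) :=
    aestronglyMeasurable_of_tendsto_ae atTop
      (fun m => (aestronglyMeasurable_ballAvg (H (φ m)).memLp.1).restrict)
      (Eventually.of_forall ha)
  have hdiff : ∀ m x, (ballAvg ε (v (φ m)) x - a x) ^ 2 ≤ 4 * K := fun m x => by
    nlinarith [hbd (φ m) x, habd x, sq_nonneg (ballAvg ε (v (φ m)) x + a x)]
  have hdm : ∀ m, AEStronglyMeasurable (fun x => (ballAvg ε (v (φ m)) x - a x) ^ 2)
      (volume.restrict B) := fun m =>
    ((aestronglyMeasurable_ballAvg (H (φ m)).memLp.1).restrict.sub ham).pow 2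
  have hdi : ∀ m, IntegrableOn (fun x => (ballAvg ε (v (φ m)) x - a x) ^ 2) B := fun m =>
    Integrable.of_bound (hdm m) (4 * K) (Eventually.of_forall fun x => by
      rw [Real.norm_of_nonneg (sq_nonneg _)]; exact hdiff m x)
  have hlim : Tendsto (fun m => ∫ x in B, (ballAvg ε (v (φ m)) x - a x) ^ 2) atTop (𝓝 0) := by
    rw [show (0 : ℝ) = ∫ x in B, (0 : ℝ) by simp]
    refine tendsto_integral_of_dominated_convergence (fun _ => 4 * K) hdm (integrable_const _)
      (fun m => Eventually.of_forall fun x => ?_) (Eventually.of_forall fun x => ?_)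
    · rw [Real.norm_of_nonneg (sq_nonneg _)]; exact hdiff m x
    · simpa using ((ha x).sub_const (a x)).pow 2
  obtain ⟨N, hN⟩ := eventually_atTop.1 (hlim.eventually (Iio_mem_nhds (show 0 < δ / 16 by positivity)))
  refine ⟨N, fun m hm k hk => ?_⟩
  have Hd : IsH10 1 (fun x => v (φ m) x - v (φ k) x) (fun x => G (φ m) x - G (φ k) x) :=
    (H _).sub (H _)
  set d : E n → ℝ := fun x => v (φ m) x - v (φ k) x with hd
  obtain ⟨hi, hle⟩ := Hd.integral_sq_ballAvg_sub_le hε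
  have hG2 : ∫ x, ‖G (φ m) x - G (φ k) x‖ ^ 2 ≤ 4 * C := by
    have i1 : ∀ m, Integrable fun x => ‖G m x‖ ^ 2 := fun m => (H m).memLp_grad.norm.integrable_sq
    have : ∫ x, ‖G (φ m) x - G (φ k) x‖ ^ 2
        ≤ ∫ x, (2 * ‖G (φ m) x‖ ^ 2 + 2 * ‖G (φ k) x‖ ^ 2) := by
      refine integral_mono Hd.memLp_grad.norm.integrable_sq
        (((i1 _).const_mul 2).add ((i1 _).const_mul 2)) fun x => ?_
      have := norm_sub_le (G (φ m) x) (G (φ k) x)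
      simp only
      nlinarith [sq_nonneg (‖G (φ m) x‖ - ‖G (φ k) x‖), norm_nonneg (G (φ m) x - G (φ k) x)]
    rw [integral_add ((i1 _).const_mul 2) ((i1 _).const_mul 2), integral_const_mul,
      integral_const_mul] at this
    linarith [hG (φ m), hG (φ k)]
  have havg : ∀ x, ballAvg ε d x = ballAvg ε (v (φ m)) x - ballAvg ε (v (φ k)) x := by
    intro x
    have i1 : ∀ m, IntegrableOn (fun h => v m (x - h)) (Metric.ball 0 ε) := fun m =>
      ((memLp_translate (H m).memLp x).restrict _).integrable (by norm_num)
    simp only [ballAvg, hd]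
    rw [integral_sub (i1 _) (i1 _), mul_sub]
  have e1 : ∫ x, d x ^ 2 = ∫ x in B, d x ^ 2 :=
    (setIntegral_eq_integral_of_forall_compl_eq_zero fun x hx => by
      rw [Hd.eq_zero x hx]; norm_num).symm
  have hpw : ∀ x, d x ^ 2 ≤ 2 * (ballAvg ε d x - d x) ^ 2 +
      (4 * (ballAvg ε (v (φ m)) x - a x) ^ 2 + 4 * (ballAvg ε (v (φ k)) x - a x) ^ 2) := by
    intro x
    have h1 : d x ^ 2 ≤ 2 * (ballAvg ε d x - d x) ^ 2 + 2 * ballAvg ε d x ^ 2 := by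
      nlinarith [sq_nonneg (2 * ballAvg ε d x - d x)]
    have h2 : ballAvg ε d x ^ 2 ≤ 2 * (ballAvg ε (v (φ m)) x - a x) ^ 2
        + 2 * (ballAvg ε (v (φ k)) x - a x) ^ 2 := by
      rw [havg]
      nlinarith [sq_nonneg (ballAvg ε (v (φ m)) x - a x + (ballAvg ε (v (φ k)) x - a x))]
    linarith
  rw [e1]
  refine (integral_mono (Hd.memLp.integrable_sq.integrableOn) (((hi.integrableOn.const_mul 2)).add
    (((hdi m).const_mul 4).add ((hdi k).const_mul 4))) hpw).trans ?_
  rw [integral_add' (hi.integrableOn.const_mul 2) (((hdi m).const_mul 4).add ((hdi k).const_mul 4)),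
    integral_add' ((hdi m).const_mul 4) ((hdi k).const_mul 4), integral_const_mul,
    integral_const_mul, integral_const_mul]
  have h1 : ∫ x in B, (ballAvg ε d x - d x) ^ 2 ≤ ε ^ 2 * (4 * C) :=
    (setIntegral_le_integral hi (Eventually.of_forall fun x => sq_nonneg _)).trans
      (hle.trans (mul_le_mul_of_nonneg_left hG2 (sq_nonneg _)))
  have h2 : ∫ x in B, (ballAvg ε (v (φ m)) x - a x) ^ 2 < δ / 16 := hN m hm
  have h3 : ∫ x in B, (ballAvg ε (v (φ k)) x - a x) ^ 2 < δ / 16 := hN k hk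
  linarith

end Rellich

/-! ### Traces on the flat boundary -/

section FlatTrace

open Filter Topology

variable {R : ℝ} {v : E 3 → ℝ} {G : E 3 → E 3}

/-- The embedding `p ↦ (p, 0)` of the plane. -/
noncomputable def planeIncl (p : E 2) : E 3 := !₂[p 0, p 1, 0]

/-- The projection `x ↦ (x₁, x₂, 0)` as a continuous linear map. -/
noncomputable def planeProj : E 3 →L[ℝ] E 3 :=
  ContinuousLinearMap.id ℝ (E 3) -
    (EuclideanSpace.proj (𝕜 := ℝ) 2).smulRight (EuclideanSpace.single 2 (1 : ℝ))

theorem planeProj_apply (x : E 3) : planeProj x = !₂[x 0, x 1, 0] := by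
  ext i; fin_cases i <;> simp [planeProj]

theorem planeProj_height (p : E 2) (z : ℝ) : planeProj (heightEquiv (p, z)) = planeIncl p := by
  rw [planeProj_apply, heightEquiv_apply]; simp [planeIncl]

theorem norm_planeIncl (p : E 2) : ‖planeIncl p‖ = ‖p‖ := by
  simp [planeIncl, EuclideanSpace.norm_eq, Fin.sum_univ_three, Fin.sum_univ_two]

theorem isometry_planeIncl : Isometry planeIncl := by
  refine Isometry.of_dist_eq fun p q => ?_
  rw [dist_eq_norm, dist_eq_norm, ← norm_planeIncl]
  congr 1
  ext i; fin_cases i <;> simp [planeIncl]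

theorem measurableEmbedding_planeIncl : MeasurableEmbedding planeIncl :=
  isometry_planeIncl.isClosedEmbedding.measurableEmbedding

theorem flatMeasure_eq :
    flatMeasure = ((volume : Measure (E 2)).restrict (Metric.ball 0 1)).map planeIncl := rfl

/-- The half space `{z > 0}`. -/
def upperHalf : Set (E 3) := {x | 0 < x 2}

theorem isOpen_upperHalf : IsOpen upperHalf :=
  isOpen_lt continuous_const (contDiff_coord 2).continuous

theorem upperBall_eq : upperBall = ball₁ ∩ upperHalf := rfl

theorem isOpen_upperBall : IsOpen upperBall := isOpen_ball₁.inter isOpen_upperHalf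

/-- The smooth approximation of the indicator of the half space. -/
noncomputable def heightCut (m : ℕ) (x : E 3) : ℝ := Real.smoothTransition (((m : ℝ) + 1) * x 2)

theorem contDiff_heightCut (m : ℕ) : ContDiff ℝ ∞ (heightCut m) :=
  contDiff_smoothTransition.comp (contDiff_const.mul (contDiff_coord 2))

theorem pd_heightCut (m : ℕ) (i : Fin 3) (x : E 3) : pd i (heightCut m) x =
    if i = 2 then ((m : ℝ) + 1) * deriv Real.smoothTransition (((m : ℝ) + 1) * x 2) else 0 := by
  have := pd_comp (i := i) (f := fun x : E 3 => ((m : ℝ) + 1) * x 2) (g := Real.smoothTransition)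
    (x := x) ((contDiff_const.mul (contDiff_coord 2)).differentiable (n := ∞) (by simp) x)
    (contDiff_smoothTransition.differentiable (by simp) _)
  rw [pd_const_mul _ ((contDiff_coord 2).differentiable (by simp) x), pd_coord] at this
  rw [show heightCut m = fun y => Real.smoothTransition (((m : ℝ) + 1) * y 2) from rfl, this]
  split_ifs <;> ring

theorem abs_heightCut_le (m : ℕ) (x : E 3) : |heightCut m x| ≤ 1 := by
  rw [heightCut, abs_of_nonneg (Real.smoothTransition.nonneg _)]
  exact Real.smoothTransition.le_one _

theorem tendsto_mul_atTop_of_pos {z : ℝ} (hz : 0 < z) :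
    ∀ᶠ m : ℕ in atTop, 1 ≤ ((m : ℝ) + 1) * z := by
  filter_upwards [(tendsto_natCast_atTop_atTop (R := ℝ)).eventually (eventually_ge_atTop (1 / z))]
    with m hm
  rw [div_le_iff₀ hz] at hm
  nlinarith

theorem tendsto_heightCut (x : E 3) :
    Tendsto (fun m => heightCut m x) atTop (𝓝 (upperHalf.indicator (fun _ => 1) x)) := by
  by_cases hx : 0 < x 2
  · rw [indicator_of_mem (show x ∈ upperHalf from hx)]
    refine tendsto_const_nhds.congr' ?_
    filter_upwards [tendsto_mul_atTop_of_pos hx] with m hm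
    exact (Real.smoothTransition.one_of_one_le hm).symm
  · rw [indicator_of_notMem (show x ∉ upperHalf from hx)]
    refine tendsto_const_nhds.congr fun m => ?_
    exact (Real.smoothTransition.zero_of_nonpos (mul_nonpos_of_nonneg_of_nonpos (by positivity)
      (not_lt.1 hx))).symm

theorem tendsto_integral_heightCut_mul {f : E 3 → ℝ} (hf : Integrable f) :
    Tendsto (fun m => ∫ x, heightCut m x * f x) atTop (𝓝 (∫ x in upperHalf, f x)) := by
  rw [← integral_indicator isOpen_upperHalf.measurableSet]
  refine tendsto_integral_of_dominated_convergence (fun x => ‖f x‖)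
    (fun m => (contDiff_heightCut m).continuous.aestronglyMeasurable.mul hf.1) hf.norm
    (fun m => Eventually.of_forall fun x => ?_) (Eventually.of_forall fun x => ?_)
  · rw [norm_mul]
    exact mul_le_of_le_one_left (norm_nonneg _) (abs_heightCut_le m x)
  · have := (tendsto_heightCut x).mul_const (f x)
    by_cases hx : x ∈ upperHalf <;> simpa [hx] using this

/-- The half space is approximated by the cut-offs `heightCut m`, which depend on the height alone
and so matter only for `i = 2`. There `|φ| ≤ C |z|` absorbs the factor `m + 1`, because `x s'(x)` is
bounded, and the boundary term tends to zero by dominated convergence. -/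
theorem IsH10.integral_upperHalf (H : IsH10 R v G) {φ : E 3 → ℝ} (hφ : IsTest univ φ) (i : Fin 3)
    (h : i = 2 → ∃ C, ∀ x ∈ Metric.ball (0 : E 3) R, |φ x| ≤ C * |x 2|) :
    ∫ x in upperHalf, (v x * pd i φ x + G x i * φ x) = 0 := by
  have i1 : Integrable fun x => v x * pd i φ x := (hφ.pd i).integrable_mul' H.integrable
  have i2 : Integrable fun x => G x i * φ x :=
    hφ.integrable_mul' (integrable_apply H.integrable_grad i)
  have hT : ∀ m, IsTest univ fun x => heightCut m x * φ x := fun m =>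
    hφ.mul_left (contDiff_heightCut m)
  have key : ∀ m, ∫ x, heightCut m x * (v x * pd i φ x + G x i * φ x)
      = - ∫ x, v x * (pd i (heightCut m) x * φ x) := by
    intro m
    have e := H.integral_eq _ (hT m) i
    have j0 : IsTest univ fun x => pd i (heightCut m) x * φ x :=
      hφ.mul_left (contDiff_pd (contDiff_heightCut m))
    have j1 : Integrable fun x => v x * (pd i (heightCut m) x * φ x) :=
      j0.integrable_mul' H.integrable
    have j2 : Integrable fun x => heightCut m x * (v x * pd i φ x + G x i * φ x) :=
      (i1.add i2).bdd_mul (c := 1) (contDiff_heightCut m).continuous.aestronglyMeasurable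
        (Eventually.of_forall (abs_heightCut_le m))
    have j3 : Integrable fun x => v x * pd i (fun y => heightCut m y * φ y) x :=
      ((hT m).pd i).integrable_mul' H.integrable
    have j4 : Integrable fun x => G x i * (heightCut m x * φ x) :=
      (hT m).integrable_mul' (integrable_apply H.integrable_grad i)
    rw [eq_neg_iff_add_eq_zero, ← integral_add j2 j1]
    rw [eq_neg_iff_add_eq_zero, ← integral_add j3 j4] at e
    rw [← e]
    refine integral_congr_ae (Eventually.of_forall fun x => ?_)
    simp only
    rw [pd_mul ((contDiff_heightCut m).differentiable (by simp) x) hφ.differentiableAt]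
    ring
  have lim1 := tendsto_integral_heightCut_mul (i1.add i2)
  refine tendsto_nhds_unique lim1 ?_
  simp only [Pi.add_apply, key]
  rw [← neg_zero, show (0 : ℝ) = ∫ x : E 3, (0 : ℝ) by simp]
  refine Tendsto.neg ?_
  by_cases hi : i = 2
  · obtain ⟨C, hC⟩ := h hi
    obtain ⟨K, hK⟩ := exists_bound_deriv_smoothTransition
    have hK0 : 0 ≤ K := (abs_nonneg _).trans (hK 0).1
    refine tendsto_integral_of_dominated_convergence (fun x => |v x| * (K * |C|))
      (fun m => H.integrable.1.mul ((hφ.mul_left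
        (contDiff_pd (contDiff_heightCut m))).continuous.aestronglyMeasurable))
      (H.integrable.abs.mul_const _)
      (fun m => Eventually.of_forall fun x => ?_) (Eventually.of_forall fun x => ?_)
    · by_cases hx : x ∈ Metric.ball (0 : E 3) R
      · rw [norm_mul, Real.norm_eq_abs, Real.norm_eq_abs]
        refine mul_le_mul_of_nonneg_left ?_ (abs_nonneg _)
        rw [pd_heightCut, if_pos hi, abs_mul]
        have h1 := hC x hx
        have h2 := (hK (((m : ℝ) + 1) * x 2)).2
        calc _ ≤ |((m : ℝ) + 1) * deriv Real.smoothTransition (((m : ℝ) + 1) * x 2)|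
              * (|C| * |x 2|) := by
              refine mul_le_mul_of_nonneg_left (h1.trans ?_) (abs_nonneg _)
              exact mul_le_mul_of_nonneg_right (le_abs_self C) (abs_nonneg _)
          _ = |((m : ℝ) + 1) * x 2 * deriv Real.smoothTransition (((m : ℝ) + 1) * x 2)| * |C| := by
              simp only [abs_mul]; ring
          _ ≤ _ := mul_le_mul_of_nonneg_right h2 (abs_nonneg _)
      · rw [H.eq_zero x hx]; simp
    · refine tendsto_const_nhds.congr' ?_
      by_cases hx : 0 < x 2
      · filter_upwards [tendsto_mul_atTop_of_pos hx] with m hm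
        rw [pd_heightCut, if_pos hi, deriv_smoothTransition_of_one_le hm]; simp
      · filter_upwards with m
        rw [pd_heightCut, if_pos hi, deriv_smoothTransition_of_nonpos
          (mul_nonpos_of_nonneg_of_nonpos (by positivity) (not_lt.1 hx))]; simp
  · refine tendsto_const_nhds.congr fun m => ?_
    refine integral_congr_ae (Eventually.of_forall fun x => ?_)
    simp only
    rw [pd_heightCut, if_neg hi]; simp

/-- The trace on the plane `{z = 0}` of an `H¹` function with the weak gradient `G`, vanishing for
large `z`. -/
noncomputable def flatTrace (G : E 3 → E 3) (x : E 3) : ℝ :=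
  -∫ z in Ioi (0 : ℝ), G !₂[x 0, x 1, z] 2

theorem setIntegral_upperHalf {f : E 3 → ℝ} (hf : Integrable f) :
    Integrable (fun p : E 2 => ∫ z in Ioi (0 : ℝ), f (heightEquiv (p, z))) ∧
    ∫ x in upperHalf, f x = ∫ p : E 2, ∫ z in Ioi (0 : ℝ), f (heightEquiv (p, z)) := by
  have e : heightEquiv ⁻¹' upperHalf = univ ×ˢ Ioi (0 : ℝ) := by
    ext p; simp [upperHalf, heightEquiv_apply]
  have hi : Integrable (fun q : E 2 × ℝ => f (heightEquiv q))
      (volume.prod (volume.restrict (Ioi 0))) := by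
    have := ((measurePreserving_heightEquiv.integrable_comp_emb
      heightEquiv.measurableEmbedding).2 hf).integrableOn (s := univ ×ˢ Ioi (0 : ℝ))
    rw [IntegrableOn, Measure.volume_eq_prod, ← Measure.prod_restrict, Measure.restrict_univ] at this
    exact this
  refine ⟨hi.integral_prod_left, ?_⟩
  rw [← measurePreserving_heightEquiv.setIntegral_preimage_emb heightEquiv.measurableEmbedding, e,
    Measure.volume_eq_prod, ← Measure.prod_restrict, Measure.restrict_univ, integral_prod _ hi]

theorem flatTrace_planeIncl (G : E 3 → E 3) (p : E 2) :
    flatTrace G (planeIncl p) = -∫ z in Ioi (0 : ℝ), G (heightEquiv (p, z)) 2 := by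
  simp [flatTrace, planeIncl, heightEquiv_apply]

theorem integrable_flatTrace (hG : Integrable G) : Integrable (flatTrace G) flatMeasure := by
  rw [flatMeasure_eq, measurableEmbedding_planeIncl.integrable_map_iff]
  simp only [Function.comp_def, flatTrace_planeIncl]
  exact (setIntegral_upperHalf (integrable_apply hG 2)).1.neg.integrableOn

/-- Supplies the decay at the plane that `IsH10.integral_upperHalf` asks for in the vertical
direction. -/
theorem abs_sub_planeProj_le {φ : E 3 → ℝ} (hφ : IsTest univ φ) :
    ∃ C, ∀ x, |φ x - φ (planeProj x)| ≤ C * |x 2| := by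
  obtain ⟨C, hC⟩ := (hφ.2.1.fderiv ℝ).exists_bound_of_continuous
    (hφ.1.continuous_fderiv (by simp))
  refine ⟨C, fun x => ?_⟩
  have := convex_univ.norm_image_sub_le_of_norm_fderiv_le (𝕜 := ℝ) (f := φ) (C := C)
    (fun y _ => hφ.differentiable y) (fun y _ => hC y) (mem_univ (planeProj x)) (mem_univ x)
  refine this.trans_eq ?_
  congr 1
  have : x - planeProj x = x 2 • EuclideanSpace.single 2 (1 : ℝ) := by simp [planeProj]
  rw [this, norm_smul]; simp

/-- In the vertical direction `φ` is split into a part vanishing on the plane, which has no boundary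
term, and a part independent of `z` wherever `v` and `G` live. For the latter only `∫ ∂_z v` along
vertical rays remains, and this is `-flatTrace`. -/
theorem IsH10.hasTraceOnT (H : IsH10 R v G) {f : E 3 → ℝ}
    (hf : v =ᵐ[volume.restrict ball₁] f) : HasTraceOnT f (flatTrace G) := by
  have hsub : upperBall ⊆ ball₁ := fun x hx => hx.1
  have hfu : v =ᵐ[volume.restrict upperBall] f :=
    ae_restrict_of_ae_restrict_of_subset hsub hf
  refine ⟨(integrable_flatTrace H.integrable_grad).integrableOn.locallyIntegrableOn,
    (Integrable.integrableOn (H.integrable.integrableOn.congr hfu)).locallyIntegrableOn, G,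
    (H.hasWeakGradient upperBall).congr hfu (ae_eq_refl _),
    (H.integrable_grad.integrableOn (s := upperBall)).integrableOn.locallyIntegrableOn,
    fun φ hφ i => ?_⟩
  have hφ' := hφ.mono (subset_univ _)
  have e0 : ∫ x in upperBall, (f x * pd i φ x + G x i * φ x)
      = ∫ x in upperHalf, (v x * pd i φ x + G x i * φ x) := by
    rw [← integral_congr_ae (hfu.mono fun x hx => by simp only [hx] :
      (fun x => v x * pd i φ x + G x i * φ x) =ᵐ[volume.restrict upperBall]
        fun x => f x * pd i φ x + G x i * φ x), upperBall_eq, inter_comm,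
      ← setIntegral_indicator isOpen_ball₁.measurableSet]
    refine integral_congr_ae (Eventually.of_forall fun x => ?_)
    by_cases hx : x ∈ ball₁
    · simp [hx]
    · simp [hx, hφ.eq_zero_of_notMem hx, (hφ.pd i).eq_zero_of_notMem hx]
  rw [e0]
  by_cases hi : i = 2
  · subst hi
    obtain ⟨C, hC⟩ := abs_sub_planeProj_le hφ'
    -- `φ ∘ planeProj` has no compact support. The bump equals `1` on the ball of radius `R`, so it
    -- does not affect the integrals; the absolute value keeps the radii positive for every `R`.
    let b : ContDiffBump (0 : E 3) := ⟨|R| + 1, |R| + 2, by positivity, by linarith⟩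
    have hbR : ∀ x ∈ Metric.ball (0 : E 3) R, b =ᶠ[𝓝 x] fun _ => 1 := by
      intro x hx
      filter_upwards [Metric.isOpen_ball.mem_nhds hx] with y hy
      refine b.one_of_mem_closedBall ?_
      have := mem_ball_zero_iff.1 hy
      rw [mem_closedBall_zero_iff]
      exact this.le.trans ((le_abs_self R).trans (by simp [b]))
    have hq : ContDiff ℝ ∞ fun x => φ (planeProj x) := hφ.1.comp planeProj.contDiff
    have hb : IsTest univ fun x => φ (planeProj x) * b x :=
      IsTest.mul_left hq ⟨b.contDiff, b.hasCompactSupport, subset_univ _⟩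
    have h0 := H.integral_upperHalf (hφ'.sub hb) 2 fun _ => ⟨C, fun x hx => by
      rw [(hbR x hx).eq_of_nhds, mul_one]; exact hC x⟩
    have hpt : ∀ x, v x * pd 2 (fun x => φ x - φ (planeProj x) * b x) x
        + G x 2 * (φ x - φ (planeProj x) * b x)
        = (v x * pd 2 φ x + G x 2 * φ x) - G x 2 * φ (planeProj x) := by
      intro x
      by_cases hx : x ∈ Metric.ball (0 : E 3) R
      · have e1 : (fun x => φ x - φ (planeProj x) * b x) =ᶠ[𝓝 x]
            fun x => φ x - φ (planeProj x) := by
          filter_upwards [hbR x hx] with y hy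
          rw [hy, mul_one]
        have e2 : pd 2 (fun x => φ (planeProj x)) x = 0 := by
          simp only [pd]
          rw [show (fun x => φ (planeProj x)) = φ ∘ planeProj from rfl,
            fderiv_comp x hφ'.differentiableAt planeProj.differentiableAt]
          have : planeProj (EuclideanSpace.single 2 (1 : ℝ)) = 0 := by
            rw [planeProj_apply]; ext j; fin_cases j <;> simp
          simp [this]
        have e3 : pd 2 (fun x => φ x - φ (planeProj x) * b x) x = pd 2 φ x := by
          rw [show pd 2 (fun x => φ x - φ (planeProj x) * b x) x
            = pd 2 (fun x => φ x - φ (planeProj x)) x by simp only [pd, e1.fderiv_eq],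
            pd_sub hφ'.differentiableAt (hq.differentiable (by simp) x), e2, sub_zero]
        rw [e3, (hbR x hx).eq_of_nhds]; ring
      · simp [H.eq_zero x hx, H.grad_eq_zero x hx]
    simp_rw [hpt] at h0
    have hqb : Integrable fun x => G x 2 * φ (planeProj x) := by
      obtain ⟨K, hK⟩ := hφ'.exists_bound
      exact (integrable_apply H.integrable_grad 2).mul_bdd (c := K)
        hq.continuous.aestronglyMeasurable (Eventually.of_forall fun x => hK _)
    have hint : Integrable fun x => v x * pd 2 φ x + G x 2 * φ x :=
      ((hφ'.pd 2).integrable_mul' H.integrable).add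
        (hφ'.integrable_mul' (integrable_apply H.integrable_grad 2))
    rw [integral_sub hint.integrableOn hqb.integrableOn, sub_eq_zero] at h0
    rw [h0, (setIntegral_upperHalf hqb).2, flatMeasure_eq,
      measurableEmbedding_planeIncl.integral_map,
      setIntegral_eq_integral_of_forall_compl_eq_zero]
    · refine integral_congr_ae (Eventually.of_forall fun p => ?_)
      simp only [planeProj_height, flatTrace_planeIncl, integral_mul_const]
      simp
    · intro p hp
      rw [hφ.eq_zero_of_notMem (x := planeIncl p)]
      · simp
      · simpa [ball₁, norm_planeIncl] using hp
  · rw [H.integral_upperHalf hφ' i fun h => absurd h hi]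
    simp [hi]

/-- The weak gradient is unique, so the left sides of the two Gauss-Green formulas agree. The
vertical formula then determines the pairing with every planar test function, each being the
restriction of a test function of the ball. -/
theorem HasTraceOnT.ae_eq {f t t' : E 3 → ℝ} (h : HasTraceOnT f t) (h' : HasTraceOnT f t') :
    t =ᵐ[flatMeasure] t' := by
  obtain ⟨ht, -, G, hG, -, hφ⟩ := h
  obtain ⟨ht', -, G', hG', -, hφ'⟩ := h'
  have hGG := hG.ae_eq' hG' isOpen_upperBall
  have loc : ∀ t : E 3 → ℝ, LocallyIntegrableOn t ball₁ flatMeasure →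
      ∀ K ⊆ Metric.ball (0 : E 2) 1, IsCompact K → IntegrableOn (fun p => t (planeIncl p)) K := by
    intro t ht K hK hKc
    have h1 := ht.integrableOn_compact_subset (t := planeIncl '' K) (by
      rintro _ ⟨p, hp, rfl⟩
      simpa [ball₁, norm_planeIncl] using hK hp) (hKc.image isometry_planeIncl.continuous)
    rw [flatMeasure_eq, measurableEmbedding_planeIncl.integrableOn_map_iff,
      preimage_image_eq _ isometry_planeIncl.injective, IntegrableOn,
      Measure.restrict_restrict hKc.measurableSet, inter_eq_left.2 hK] at h1
    exact h1
  have hd : LocallyIntegrableOn (fun p => t (planeIncl p) - t' (planeIncl p))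
      (Metric.ball (0 : E 2) 1) := by
    rw [locallyIntegrableOn_iff Metric.isOpen_ball.isLocallyClosed]
    exact fun K hK hKc => (loc t ht K hK hKc).sub (loc t' ht' K hK hKc)
  have hz := Metric.isOpen_ball.ae_eq_zero_of_integral_contDiff_smul_eq_zero hd
    fun g hg hgc hgs => ?_
  · rw [flatMeasure_eq, EventuallyEq, measurableEmbedding_planeIncl.ae_map_iff,
      ae_restrict_iff' Metric.isOpen_ball.measurableSet]
    filter_upwards [hz] with p hp hpb
    exact sub_eq_zero.1 (hp hpb)
  · -- extend the test function to the ball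
    -- Room between the support and the unit circle lets the bump below be `1` on the support while
    -- it stays inside the ball.
    obtain ⟨r, hr0, hr1, hr⟩ : ∃ r, 0 < r ∧ r < 1 ∧ ∀ p ∈ tsupport g, ‖p‖ ≤ r := by
      rcases (tsupport g).eq_empty_or_nonempty with he | hne
      · exact ⟨1 / 2, by norm_num, by norm_num, by simp [he]⟩
      · obtain ⟨p, hp, hmax⟩ := IsCompact.exists_isMaxOn hgc hne continuous_norm.continuousOn
        have := mem_ball_zero_iff.1 (hgs hp)
        exact ⟨max ‖p‖ (1 / 2), by positivity, max_lt this (by norm_num), fun q hq =>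
          (hmax hq).trans (le_max_left _ _)⟩
    let b : ContDiffBump (0 : E 3) := ⟨r, (1 + r) / 2, hr0, by linarith⟩
    let q : E 3 →L[ℝ] E 2 := LinearMap.toContinuousLinearMap
      { toFun := fun x => !₂[x 0, x 1]
        map_add' := fun x y => by ext i; fin_cases i <;> simp
        map_smul' := fun c x => by ext i; fin_cases i <;> simp }
    have hq : ∀ p, q (planeIncl p) = p := by
      intro p; ext i; fin_cases i <;> simp [q, planeIncl]
    have hb : IsTest ball₁ (fun x => g (q x) * b x) := by
      refine IsTest.mul_left (hg.comp q.contDiff) ⟨b.contDiff, b.hasCompactSupport, ?_⟩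
      rw [b.tsupport_eq]
      exact Metric.closedBall_subset_ball (by simp only [b]; linarith)
    have e1 := hφ _ hb 2
    have e2 := hφ' _ hb 2
    have e0 : (fun x => f x * pd 2 (fun x => g (q x) * b x) x + G x 2 * (g (q x) * b x))
        =ᵐ[volume.restrict upperBall]
        fun x => f x * pd 2 (fun x => g (q x) * b x) x + G' x 2 * (g (q x) * b x) :=
      hGG.mono fun x hx => by simp only [hx]
    rw [integral_congr_ae e0, e2] at e1
    simp only [PiLp.neg_apply, PiLp.single_apply, if_true, mul_neg, mul_one, integral_neg,
      neg_inj] at e1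
    rw [flatMeasure_eq, measurableEmbedding_planeIncl.integral_map,
      measurableEmbedding_planeIncl.integral_map] at e1
    have hgb : ∀ p, g (q (planeIncl p)) * b (planeIncl p) = g p := by
      intro p
      rw [hq]
      by_cases hp : p ∈ tsupport g
      · rw [b.one_of_mem_closedBall (by simpa [norm_planeIncl, b] using hr p hp), mul_one]
      · rw [image_eq_zero_of_notMem_tsupport hp, zero_mul]
    simp only [hgb] at e1
    have hT : IsTest (Metric.ball (0 : E 2) 1) g := ⟨hg, hgc, hgs⟩
    have i1 : ∀ t : E 3 → ℝ, LocallyIntegrableOn t ball₁ flatMeasure →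
        Integrable fun p => t (planeIncl p) * g p := fun t ht =>
      hT.integrable_mul (loc t ht _ hgs hgc)
    rw [hT.setIntegral_eq (f := fun p => t' (planeIncl p)),
      hT.setIntegral_eq (f := fun p => t (planeIncl p))] at e1
    rw [← sub_eq_zero, ← integral_sub (i1 t' ht') (i1 t ht)] at e1
    have e3 : ∀ p, g p • (t (planeIncl p) - t' (planeIncl p))
        = - (t' (planeIncl p) * g p - t (planeIncl p) * g p) := fun p => by
      rw [smul_eq_mul]; ring
    simp_rw [e3, integral_neg, e1, neg_zero]

/-- The trace is an integral over vertical rays, so Fubini bounds it in `L¹` by the gradient alone.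
-/
theorem integral_abs_flatTrace_sub_le {G' : E 3 → E 3} (hG : Integrable G) (hG' : Integrable G') :
    ∫ x, |flatTrace G x - flatTrace G' x| ∂flatMeasure ≤ ∫ x, ‖G x - G' x‖ := by
  have h2 := integrable_apply (hG.sub hG') 2
  have e1 := setIntegral_upperHalf h2.norm
  have hle : ∀ p : E 2, Integrable (fun z => G (heightEquiv (p, z)) 2) (volume.restrict (Ioi 0)) →
      Integrable (fun z => G' (heightEquiv (p, z)) 2) (volume.restrict (Ioi 0)) →
      |flatTrace G (planeIncl p) - flatTrace G' (planeIncl p)|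
        ≤ ∫ z in Ioi (0 : ℝ), ‖(G - G') (heightEquiv (p, z)) 2‖ := by
    intro p h h'
    rw [flatTrace_planeIncl, flatTrace_planeIncl, neg_sub_neg, abs_sub_comm, ← integral_sub h h']
    exact norm_integral_le_integral_norm
      fun z => G (heightEquiv (p, z)) 2 - G' (heightEquiv (p, z)) 2
  have hae : ∀ {G : E 3 → E 3}, Integrable G → ∀ᵐ p : E 2,
      Integrable (fun z => G (heightEquiv (p, z)) 2) (volume.restrict (Ioi 0)) := by
    intro G hG
    have := (measurePreserving_heightEquiv.integrable_comp_emb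
      heightEquiv.measurableEmbedding).2 (integrable_apply hG 2)
    rw [Measure.volume_eq_prod] at this
    filter_upwards [this.prod_right_ae] with p hp
    exact hp.integrableOn
  rw [flatMeasure_eq, measurableEmbedding_planeIncl.integral_map]
  calc _ ≤ ∫ p in Metric.ball (0 : E 2) 1, ∫ z in Ioi (0 : ℝ),
        ‖(G - G') (heightEquiv (p, z)) 2‖ := by
        refine integral_mono_of_nonneg (Eventually.of_forall fun p => abs_nonneg _)
          e1.1.integrableOn ?_
        refine ae_restrict_of_ae ?_
        filter_upwards [hae hG, hae hG'] with p h h'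
        exact hle p h h'
    _ ≤ ∫ p : E 2, ∫ z in Ioi (0 : ℝ), ‖(G - G') (heightEquiv (p, z)) 2‖ :=
        setIntegral_le_integral e1.1 (Eventually.of_forall fun p =>
          integral_nonneg fun z => norm_nonneg _)
    _ = ∫ x in upperHalf, ‖(G - G') x 2‖ := e1.2.symm
    _ ≤ ∫ x, ‖(G - G') x 2‖ :=
        setIntegral_le_integral h2.norm (Eventually.of_forall fun x => norm_nonneg _)
    _ ≤ _ := by
        exact integral_mono h2.norm (hG.sub hG').norm fun x => PiLp.norm_apply_le ((G - G') x) 2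

/-- `L²` convergence of the gradients gives convergence of the traces almost everywhere, along a
subsequence. -/
theorem exists_subseq_flatTrace {v : ℕ → E 3 → ℝ} {G : ℕ → E 3 → E 3} {v' : E 3 → ℝ}
    {G' : E 3 → E 3} (H : ∀ m, IsH10 R (v m) (G m)) (H' : IsH10 R v' G')
    (h : Tendsto (fun m => ∫ x, ‖G m x - G' x‖ ^ 2) atTop (𝓝 0)) :
    ∃ φ : ℕ → ℕ, StrictMono φ ∧ ∀ᵐ x ∂flatMeasure,
      Tendsto (fun m => flatTrace (G (φ m)) x) atTop (𝓝 (flatTrace G' x)) := by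
  -- All gradients vanish off one ball of finite volume, hence `L²` convergence implies `L¹`
  -- convergence by Cauchy-Schwarz.
  have h1 : Tendsto (fun m => ∫ x, ‖G m x - G' x‖) atTop (𝓝 0) := by
    set B := Metric.ball (0 : E 3) R
    have hb : ∀ m, ∫ x, ‖G m x - G' x‖
        ≤ Real.sqrt (volume.real B * ∫ x, ‖G m x - G' x‖ ^ 2) := by
      intro m
      have Hm := (H m).sub H'
      have := sq_integral_le (Hm.memLp_grad.norm.restrict B)
      rw [measureReal_restrict_apply_univ,
        setIntegral_eq_integral_of_forall_compl_eq_zero (fun x hx => by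
          rw [Hm.grad_eq_zero x hx, norm_zero]),
        setIntegral_eq_integral_of_forall_compl_eq_zero (fun x hx => by
          rw [Hm.grad_eq_zero x hx, norm_zero]; norm_num)] at this
      exact Real.le_sqrt_of_sq_le this
    have hs : Tendsto (fun m => Real.sqrt (volume.real B * ∫ x, ‖G m x - G' x‖ ^ 2)) atTop (𝓝 0) := by
      have := (h.const_mul (volume.real B)).sqrt
      simpa using this
    exact squeeze_zero (fun m => integral_nonneg fun x => norm_nonneg _) hb hs
  have h2 : Tendsto (fun m => ∫ x, |flatTrace (G m) x - flatTrace G' x| ∂flatMeasure) atTop (𝓝 0) :=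
    squeeze_zero (fun m => integral_nonneg fun x => abs_nonneg _)
      (fun m => integral_abs_flatTrace_sub_le (H m).integrable_grad H'.integrable_grad) h1
  have hi : ∀ m, Integrable (flatTrace (G m)) flatMeasure := fun m =>
    integrable_flatTrace (H m).integrable_grad
  have hi' := integrable_flatTrace H'.integrable_grad
  have h3 : TendstoInMeasure flatMeasure (fun m => flatTrace (G m)) atTop (flatTrace G') := by
    refine tendstoInMeasure_of_tendsto_eLpNorm (p := 1) one_ne_zero (fun m => (hi m).1) hi'.1 ?_
    have : ∀ m, eLpNorm (flatTrace (G m) - flatTrace G') 1 flatMeasure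
        = ENNReal.ofReal (∫ x, |flatTrace (G m) x - flatTrace G' x| ∂flatMeasure) := by
      intro m
      rw [eLpNorm_one_eq_lintegral_enorm, ← ofReal_integral_norm_eq_lintegral_enorm
        ((hi m).sub hi')]
      rfl
    simp_rw [this]
    simpa using ENNReal.tendsto_ofReal h2
  exact h3.exists_seq_tendsto_ae

end FlatTrace

/-! ### The augmented operator in Cartesian coordinates and a polynomial competitor -/

section Competitor

open Filter Topology

/-- The component of `u` that enters the `k`-th component of `ℒ[u]`. -/
def augIdx : Fin 5 → Fin 3 := ![0, 0, 1, 2, 2]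

/-- The angular frequency of the `j`-th component. -/
def augDeg : Fin 3 → ℕ := ![2, 0, 1]

/-- The homogeneous harmonic polynomials `ρ² cos 2θ, ρ² sin 2θ, 1, ρ cos θ, ρ sin θ`. -/
def augPoly (k : Fin 5) (x : E 3) : ℝ :=
  ![x 0 ^ 2 - x 1 ^ 2, 2 * x 0 * x 1, 1, x 0, x 1] k

theorem contDiff_augPoly (k : Fin 5) : ContDiff ℝ ∞ (augPoly k) := by
  have h0 := contDiff_coord (n := 3) 0
  have h1 := contDiff_coord (n := 3) 1
  fin_cases k
  · exact (h0.pow 2).sub (h1.pow 2)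
  · exact (contDiff_const.mul h0).mul h1
  · exact contDiff_const
  · exact h0
  · exact h1

theorem meridian_zero (x : E 3) : meridian x 0 = Real.sqrt (x 0 ^ 2 + x 1 ^ 2) := rfl

theorem meridian_one (x : E 3) : meridian x 1 = x 2 := rfl

theorem meridian_zero_nonneg (x : E 3) : 0 ≤ meridian x 0 := Real.sqrt_nonneg _

theorem meridian_zero_sq (x : E 3) : meridian x 0 ^ 2 = x 0 ^ 2 + x 1 ^ 2 :=
  Real.sq_sqrt (by positivity)

theorem norm_meridian (x : E 3) : ‖meridian x‖ = ‖x‖ := by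
  simp only [EuclideanSpace.norm_eq, Fin.sum_univ_three, Fin.sum_univ_two, Real.norm_eq_abs, sq_abs,
    meridian_zero_sq, meridian_one]

theorem continuous_meridian : Continuous meridian := by
  refine (PiLp.continuous_toLp 2 _).comp (continuous_pi fun j => ?_)
  have h := fun j => (contDiff_coord (n := 3) j).continuous
  fin_cases j
  · exact (((h 0).pow 2).add ((h 1).pow 2)).sqrt
  · exact h 2

theorem norm_azimuth (x : E 3) : ‖(⟨x 0, x 1⟩ : ℂ)‖ = meridian x 0 := by
  rw [meridian_zero, Complex.norm_def, Complex.normSq_apply, sq, sq]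

theorem meridian_mul_cos (x : E 3) : meridian x 0 * Real.cos (azimuth x) = x 0 := by
  rw [← norm_azimuth]; exact Complex.norm_mul_cos_arg _

theorem meridian_mul_sin (x : E 3) : meridian x 0 * Real.sin (azimuth x) = x 1 := by
  rw [← norm_azimuth]; exact Complex.norm_mul_sin_arg _

/-- The trigonometric factors of `ℒ`. -/
noncomputable def augTrig (k : Fin 5) (θ : ℝ) : ℝ :=
  ![Real.cos (2 * θ), Real.sin (2 * θ), 1, Real.cos θ, Real.sin θ] k

theorem aug_apply (V : E 3) (θ : ℝ) (k : Fin 5) : aug V θ k = augTrig k θ * V (augIdx k) := by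
  fin_cases k <;> simp [aug, augTrig, augIdx, mul_comm]

theorem augPoly_eq (x : E 3) (k : Fin 5) :
    augPoly k x = meridian x 0 ^ augDeg (augIdx k) * augTrig k (azimuth x) := by
  have h0 := meridian_mul_cos x
  have h1 := meridian_mul_sin x
  fin_cases k <;>
    simp only [augPoly, augDeg, augIdx, augTrig, ← h0, ← h1, Real.cos_two_mul', Real.sin_two_mul] <;>
    simp <;> ring

/-- By `cos² + sin² = 1` the profile is a pointwise linear function of the field. This is the
inverse of `ℒ` used in limits and in angular means. -/
theorem sum_augTrig_sq (V : E 3) (θ : ℝ) (j : Fin 3) :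
    ∑ k, (if augIdx k = j then augTrig k θ * aug V θ k else 0) = V j := by
  have h1 := Real.sin_sq_add_cos_sq (2 * θ)
  have h2 := Real.sin_sq_add_cos_sq θ
  simp only [Fin.sum_univ_five, aug_apply]
  fin_cases j <;> simp [augIdx, augTrig]
  · linear_combination V 0 * h1
  · linear_combination V 2 * h2

/-- The profiles of the competitor. -/
noncomputable def compProfile (a : ℝ) (j : Fin 3) (z : ℝ) : ℝ :=
  ![H a * (Real.sqrt 3 / 2), H a * (3 / 2 * z ^ 2 - 1 / 2), H a * (Real.sqrt 3 * z)] j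

theorem contDiff_compProfile (a : ℝ) (j : Fin 3) : ContDiff ℝ ∞ (compProfile a j) := by
  fin_cases j
  · exact contDiff_const
  · exact contDiff_const.mul ((contDiff_const.mul (contDiff_id.pow 2)).sub contDiff_const)
  · exact contDiff_const.mul (contDiff_const.mul contDiff_id)

/-- The competitor `u₀`, a polynomial field in `(ρ, z)`. -/
noncomputable def compProf (a : ℝ) (p : E 2) : E 3 :=
  WithLp.toLp 2 fun j => p 0 ^ augDeg j * compProfile a j (p 1)

/-- The competitor `ℒ[u₀]`, a polynomial field on `ℝ³`. -/
noncomputable def comp (a : ℝ) (k : Fin 5) (x : E 3) : ℝ :=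
  augPoly k x * compProfile a (augIdx k) (x 2)

theorem contDiff_comp (a : ℝ) (k : Fin 5) : ContDiff ℝ ∞ (comp a k) :=
  (contDiff_augPoly k).mul ((contDiff_compProfile a _).comp (contDiff_coord 2))

theorem contDiff_compProf (a : ℝ) (j : Fin 3) : ContDiff ℝ ∞ fun p => compProf a p j :=
  ((contDiff_coord 0).pow _).mul ((contDiff_compProfile a j).comp (contDiff_coord 1))

theorem augField_compProf (a : ℝ) (x : E 3) (k : Fin 5) :
    augField (compProf a) x k = comp a k x := by
  rw [augField, aug_apply, comp, augPoly_eq]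
  simp only [compProf, meridian_one]
  ring

/-- On the unit half circle `sin ϕ = ρ` and `cos ϕ = z`, so the datum extends to a polynomial. Its
powers of `ρ` are those which make `ℒ` of it smooth across the axis. -/
theorem Ustar_eq_compProf (a : ℝ) {p : E 2} (h0 : 0 ≤ p 0) (h1 : ‖p‖ = 1) :
    Ustar a p = compProf a p := by
  have hs : p 0 ^ 2 + p 1 ^ 2 = 1 := by
    have := EuclideanSpace.norm_sq_eq p
    rw [h1, Fin.sum_univ_two] at this
    simpa using this.symm
  have hc : Real.cos (polarAngle p) = p 1 := by
    rw [polarAngle, h1, div_one, Real.cos_arccos] <;> nlinarith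
  have hsin : Real.sin (polarAngle p) = p 0 := by
    rw [polarAngle, h1, div_one, Real.sin_arccos, show 1 - p 1 ^ 2 = p 0 ^ 2 by linarith,
      Real.sqrt_sq h0]
  ext j
  fin_cases j <;> simp [Ustar, compProf, compProfile, augDeg, hc, hsin] <;>
    first | ring1 | exact Or.inl (by ring1)

theorem augField_Ustar (a : ℝ) {x : E 3} (hx : ‖x‖ = 1) (k : Fin 5) :
    augField (Ustar a) x k = comp a k x := by
  rw [← augField_compProf, augField, augField,
    Ustar_eq_compProf a (meridian_zero_nonneg x) (by rw [norm_meridian, hx])]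

/-- A smooth function of compact support that agrees with the third component of the competitor on
the unit ball. -/
theorem exists_comp_cut (a : ℝ) : ∃ f : E 3 → ℝ, IsTest (Metric.ball 0 3) f ∧
    ∀ x ∈ ball₁, f x = comp a 2 x := by
  let b : ContDiffBump (0 : E 3) := ⟨1, 2, by norm_num, by norm_num⟩
  refine ⟨fun x => comp a 2 x * b x, IsTest.mul_left (contDiff_comp a 2)
    ⟨b.contDiff, b.hasCompactSupport, ?_⟩, fun x hx => ?_⟩
  · rw [b.tsupport_eq]; exact Metric.closedBall_subset_ball (by norm_num)
  · simp only
    rw [b.one_of_mem_closedBall (Metric.ball_subset_closedBall hx), mul_one]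

/-- Fundamental theorem of calculus on a vertical ray, with no contribution from infinity. Hence
`flatTrace` is the ordinary restriction for test functions. -/
theorem flatTrace_grd {f : E 3 → ℝ} (hf : IsTest univ f) (x : E 3) :
    flatTrace (grd f) x = f (planeProj x) := by
  have hd : ∀ z : ℝ, HasDerivAt (fun z => f !₂[x 0, x 1, z]) (pd 2 f !₂[x 0, x 1, z]) z := by
    intro z
    have hl : HasDerivAt (fun z : ℝ => planeProj x + z • EuclideanSpace.single 2 (1 : ℝ))
        (EuclideanSpace.single 2 (1 : ℝ)) z := by
      simpa using ((hasDerivAt_id z).smul_const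
        (EuclideanSpace.single 2 (1 : ℝ) : E 3)).const_add (planeProj x)
    have e : ∀ z : ℝ, planeProj x + z • EuclideanSpace.single 2 (1 : ℝ) = !₂[x 0, x 1, z] := by
      intro z; rw [planeProj_apply]; ext i; fin_cases i <;> simp
    have := (hf.differentiable (planeProj x + z • EuclideanSpace.single 2 1)).hasFDerivAt.comp_hasDerivAt z hl
    simp only [Function.comp_def, e] at this
    exact this
  obtain ⟨r, hr⟩ := hf.2.1.isBounded.subset_closedBall 0
  have hnot : ∀ z : ℝ, r < |z| → !₂[x 0, x 1, z] ∉ tsupport f := by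
    intro z hz h
    have h1 := mem_closedBall_zero_iff.1 (hr h)
    have h2 := PiLp.norm_apply_le (!₂[x 0, x 1, z] : E 3) 2
    simp at h2
    linarith
  have hcont : Continuous fun z : ℝ => (!₂[x 0, x 1, z] : E 3) := by
    refine (PiLp.continuous_toLp 2 _).comp (continuous_pi fun j => ?_)
    fin_cases j
    · exact continuous_const
    · exact continuous_const
    · exact continuous_id
  have hint : IntegrableOn (fun z : ℝ => pd 2 f !₂[x 0, x 1, z]) (Ioi 0) := by
    refine Integrable.integrableOn (Continuous.integrable_of_hasCompactSupport
      ((contDiff_pd hf.1).continuous.comp hcont) ?_)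
    refine HasCompactSupport.intro (isCompact_closedBall (0 : ℝ) r) fun z hz => ?_
    rw [mem_closedBall_zero_iff, Real.norm_eq_abs, not_le] at hz
    exact image_eq_zero_of_notMem_tsupport (f := pd 2 f)
      fun h => hnot z hz (tsupport_pd_subset 2 f h)
  have hlim : Tendsto (fun z : ℝ => f !₂[x 0, x 1, z]) atTop (𝓝 0) := by
    refine tendsto_const_nhds.congr' ?_
    filter_upwards [eventually_gt_atTop r] with z h
    exact (image_eq_zero_of_notMem_tsupport (hnot z (h.trans_le (le_abs_self z)))).symm
  have := integral_Ioi_of_hasDerivAt_of_tendsto' (fun z _ => hd z) hint hlim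
  rw [flatTrace]
  simp only [grd_apply]
  rw [this, planeProj_apply]
  simp

theorem ae_flatMeasure : ∀ᵐ x ∂flatMeasure, planeProj x = x ∧ planeProj x ∈ ball₁ := by
  rw [flatMeasure_eq, measurableEmbedding_planeIncl.ae_map_iff]
  filter_upwards [ae_restrict_mem Metric.isOpen_ball.measurableSet] with p hp
  have : planeProj (planeIncl p) = planeIncl p := by
    rw [planeProj_apply]; ext i; fin_cases i <;> simp [planeIncl]
  rw [this]
  exact ⟨rfl, by simpa [ball₁, norm_planeIncl] using hp⟩

/-- This value is why the ranges of `b` and `c` meet at `-1/2`: it satisfies both obstacle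
conditions. -/
theorem comp_planeProj (a : ℝ) (x : E 3) : comp a 2 (planeProj x) = -1 / 2 * H a := by
  rw [planeProj_apply]
  simp [comp, augPoly, augIdx, compProfile]; ring

end Competitor

/-! ### The bulk potential -/

section Potential

/-- The bulk potential. -/
noncomputable def pot (a : ℝ) (w : E 5) : ℝ :=
  Da a - 3 * Real.sqrt 2 * S w + a / 2 * (‖w‖ ^ 2 - 1) ^ 2

theorem abs_apply_le (w : E 5) (i : Fin 5) : |w i| ≤ ‖w‖ := PiLp.norm_apply_le w i

theorem abs_mul_mul_le {x y z p q : ℝ} (hx : |x| ≤ p) (hy : |y| ≤ q) (hz : |z| ≤ q) :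
    |x * y * z| ≤ p * q ^ 2 := by
  rw [abs_mul, abs_mul, sq, ← mul_assoc]
  have := (abs_nonneg x).trans hx
  have := (abs_nonneg y).trans hy
  gcongr

/-- The polarization of `S`, linear in `m` and quadratic in `d`. -/
noncomputable def SPolar (m d : E 5) : ℝ :=
  -(m 2 * d 0 * d 0 + m 2 * d 1 * d 1) - 2 * (m 0 * d 0 * d 2 + m 1 * d 1 * d 2)
    + Real.sqrt 3 * (m 1 * d 3 * d 4 + m 3 * d 1 * d 4 + m 4 * d 1 * d 3)
    + 1 / 2 * (m 2 * d 3 * d 3 + m 2 * d 4 * d 4) + (m 3 * d 2 * d 3 + m 4 * d 2 * d 4)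
    + m 2 * d 2 * d 2
    + Real.sqrt 3 / 2 * (m 0 * d 3 * d 3 - m 0 * d 4 * d 4)
    + Real.sqrt 3 * (m 3 * d 0 * d 3 - m 4 * d 0 * d 4)

theorem S_add_add_S_sub (m d : E 5) : S (m + d) + S (m - d) - 2 * S m = 2 * SPolar m d := by
  simp only [S, SPolar, PiLp.add_apply, PiLp.sub_apply]; ring

theorem sqrt_three_le : Real.sqrt 3 ≤ 2 := by
  rw [Real.sqrt_le_left (by norm_num)]; norm_num

theorem sqrt_two_le : Real.sqrt 2 ≤ 2 := by
  rw [Real.sqrt_le_left (by norm_num)]; norm_num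

/-- A count of monomials with `√3 ≤ 2`. The constant is crude; only the homogeneity in `m` and `d`
matters later. -/
theorem abs_SPolar_le (m d : E 5) : |SPolar m d| ≤ 30 * (‖m‖ * ‖d‖ ^ 2) := by
  have h : ∀ i j k, |m i * d j * d k| ≤ ‖m‖ * ‖d‖ ^ 2 := fun i j k =>
    abs_mul_mul_le (abs_apply_le m i) (abs_apply_le d j) (abs_apply_le d k)
  have hs := sqrt_three_le
  have hs0 := Real.sqrt_nonneg 3
  have hmul : ∀ {x : ℝ} {N : ℝ}, |x| ≤ N → |Real.sqrt 3 * x| ≤ 2 * N := fun {x N} hx => by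
    rw [abs_mul, abs_of_nonneg hs0]
    have := abs_nonneg x
    nlinarith
  have e : SPolar m d = -(m 2 * d 0 * d 0 + m 2 * d 1 * d 1)
      - 2 * (m 0 * d 0 * d 2 + m 1 * d 1 * d 2)
      + (Real.sqrt 3 * (m 1 * d 3 * d 4) + Real.sqrt 3 * (m 3 * d 1 * d 4)
        + Real.sqrt 3 * (m 4 * d 1 * d 3))
      + 1 / 2 * (m 2 * d 3 * d 3 + m 2 * d 4 * d 4) + (m 3 * d 2 * d 3 + m 4 * d 2 * d 4)
      + m 2 * d 2 * d 2
      + 1 / 2 * (Real.sqrt 3 * (m 0 * d 3 * d 3) - Real.sqrt 3 * (m 0 * d 4 * d 4))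
      + (Real.sqrt 3 * (m 3 * d 0 * d 3) - Real.sqrt 3 * (m 4 * d 0 * d 4)) := by
    rw [SPolar]; ring
  rw [e, abs_le]
  have a1 := abs_le.1 (h 2 0 0)
  have a2 := abs_le.1 (h 2 1 1)
  have a3 := abs_le.1 (h 0 0 2)
  have a4 := abs_le.1 (h 1 1 2)
  have a5 := abs_le.1 (hmul (h 1 3 4))
  have a6 := abs_le.1 (hmul (h 3 1 4))
  have a7 := abs_le.1 (hmul (h 4 1 3))
  have a8 := abs_le.1 (h 2 3 3)
  have a9 := abs_le.1 (h 2 4 4)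
  have b1 := abs_le.1 (h 3 2 3)
  have b2 := abs_le.1 (h 4 2 4)
  have b3 := abs_le.1 (h 2 2 2)
  have b4 := abs_le.1 (hmul (h 0 3 3))
  have b5 := abs_le.1 (hmul (h 0 4 4))
  have b6 := abs_le.1 (hmul (h 3 0 3))
  have b7 := abs_le.1 (hmul (h 4 0 4))
  constructor <;> linarith

theorem abs_S_le (w : E 5) : |S w| ≤ 10 * ‖w‖ ^ 3 := by
  have e : S w = 1 / 3 * SPolar w w := by rw [S, SPolar]; ring
  rw [e, abs_mul]
  have := abs_SPolar_le w w
  norm_num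
  nlinarith

/-- The bulk potential is bounded above and below by the fourth power of the norm. -/
theorem exists_pot_bounds {a : ℝ} (ha : 0 < a) : ∃ c C : ℝ, 0 < c ∧ 0 ≤ C ∧
    ∀ w, c * ‖w‖ ^ 4 - C ≤ pot a w ∧ pot a w ≤ C * (1 + ‖w‖ ^ 4) := by
  -- The quartic coefficient is `a/2`. Young's inequality spends `a/8` three times: on the cubic
  -- term, on the quadratic remainder `B N²` that it leaves, and on `a N²`. The last `a/8` survives
  -- as the lower coefficient.
  refine ⟨a / 8, |Da a| + 2 * a + 60 + (60 ^ 2 * 2 / a) ^ 2 * (2 / a) * 4, by positivity, by positivity,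
    fun w => ?_⟩
  set N := ‖w‖ with hN
  have hN0 : 0 ≤ N := norm_nonneg _
  have hS : |3 * Real.sqrt 2 * S w| ≤ 60 * N ^ 3 := by
    rw [abs_mul, abs_of_nonneg (by positivity)]
    have h1 := sqrt_two_le
    have h2 := abs_S_le w
    have h3 := abs_nonneg (S w)
    nlinarith [Real.sqrt_nonneg 2]
  have hS' := abs_le.1 hS
  have hD := abs_le.1 (le_refl |Da a|)
  set B := 60 ^ 2 * 2 / a with hB
  have hB0 : 0 < B := by positivity
  have hBa : B * a = 60 ^ 2 * 2 := by rw [hB]; field_simp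
  have y1 : 60 * N ^ 3 ≤ a / 8 * N ^ 4 + B * N ^ 2 := by
    have : 60 * N ≤ a / 8 * N ^ 2 + B := by
      have h := sq_nonneg (a * N - 240)
      have : a * (60 * N) ≤ a * (a / 8 * N ^ 2 + B) := by nlinarith
      exact le_of_mul_le_mul_left this ha
    nlinarith [mul_le_mul_of_nonneg_right this (sq_nonneg N)]
  have y2 : B * N ^ 2 ≤ a / 8 * N ^ 4 + B ^ 2 * (2 / a) := by
    have h2a : a * (2 / a) = 2 := by field_simp
    have : a * (B * N ^ 2) ≤ a * (a / 8 * N ^ 4 + B ^ 2 * (2 / a)) := by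
      nlinarith [sq_nonneg (a * N ^ 2 - 4 * B)]
    exact le_of_mul_le_mul_left this ha
  have hpos : 0 ≤ B ^ 2 * (2 / a) := by positivity
  have hq1 : N ^ 4 - 2 * N ^ 2 + 1 = (N ^ 2 - 1) ^ 2 := by ring
  have hq2 : N ^ 2 * a ≤ a / 8 * N ^ 4 + 2 * a := by nlinarith [sq_nonneg (N ^ 2 - 4)]
  have hn3 : N ^ 3 ≤ 1 + N ^ 4 := by
    nlinarith [sq_nonneg (N ^ 2 - N), sq_nonneg (N - 1), sq_nonneg (N ^ 2 - 1), sq_nonneg N]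
  have hN4 : 0 ≤ N ^ 4 := by positivity
  have hN2 : 0 ≤ N ^ 2 := by positivity
  have hexp : a / 2 * (N ^ 2 - 1) ^ 2 = a / 2 * N ^ 4 - N ^ 2 * a + a / 2 := by ring
  have hp1 : 0 ≤ N ^ 2 * a := by positivity
  have hp2 : 0 ≤ N ^ 4 * a := by positivity
  have hp3 : 0 ≤ B ^ 2 * (2 / a) * N ^ 4 := by positivity
  have hp4 : 0 ≤ |Da a| * N ^ 4 := by positivity
  rw [pot, ← hN, hexp]
  constructor <;> linarith

/-- The bulk potential is semiconvex. -/
theorem exists_pot_semiconvex {a : ℝ} (ha : 0 < a) : ∃ K : ℝ, 0 ≤ K ∧ ∀ v w : E 5,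
    pot a ((1 / 2 : ℝ) • (v + w)) ≤ (pot a v + pot a w) / 2 + K * ‖v - w‖ ^ 2 := by
  refine ⟨2 * a + 360 ^ 2 / a, by positivity, fun v w => ?_⟩
  set m := (1 / 2 : ℝ) • (v + w) with hm
  set d := (1 / 2 : ℝ) • (v - w) with hd
  have ev : v = m + d := by rw [hm, hd]; module
  have ew : w = m - d := by rw [hm, hd]; module
  have hdn : ‖v - w‖ = 2 * ‖d‖ := by
    rw [hd, norm_smul, Real.norm_of_nonneg (by norm_num)]; ring
  have hT := abs_le.1 (abs_SPolar_le m d)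
  have hS := S_add_add_S_sub m d
  rw [hdn]
  rw [ev, ew]
  simp only [pot]
  rw [norm_add_sq_real, norm_sub_sq_real]
  set M := ‖m‖
  set N := ‖d‖
  set i := (inner ℝ m d : ℝ)
  have hM0 : 0 ≤ M := norm_nonneg _
  have hs2 : |Real.sqrt 2 * SPolar m d| ≤ 60 * (M * N ^ 2) := by
    rw [abs_mul, abs_of_nonneg (Real.sqrt_nonneg 2)]
    have := abs_SPolar_le m d
    nlinarith [sqrt_two_le, Real.sqrt_nonneg 2, abs_nonneg (SPolar m d)]
  have hs3 := abs_le.1 hs2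
  have hcub : Real.sqrt 2 * (S (m + d) + S (m - d) - 2 * S m) ≤ 120 * (M * N ^ 2) := by
    rw [hS]; linarith
  -- The second difference of the cubic part grows like `M N²`, where `M = ‖m‖` and `N = ‖d‖`. The
  -- quartic part supplies `a M² N²`, which absorbs this growth, so the defect is a constant times
  -- `N²`.
  have hy : 360 * M ≤ a * M ^ 2 + 360 ^ 2 / a := by
    have : a * (360 * M) ≤ a * (a * M ^ 2 + 360 ^ 2 / a) := by
      have : a * (360 ^ 2 / a) = 360 ^ 2 := by field_simp
      nlinarith [sq_nonneg (a * M - 360), sq_nonneg (a * M)]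
    exact le_of_mul_le_mul_left this ha
  have hy2 : 360 * M * N ^ 2 ≤ (a * M ^ 2 + 360 ^ 2 / a) * N ^ 2 :=
    mul_le_mul_of_nonneg_right hy (sq_nonneg N)
  have hpos : 0 ≤ 360 ^ 2 / a * N ^ 2 := by positivity
  have hquart : (M ^ 2 + 2 * i + N ^ 2 - 1) ^ 2 + (M ^ 2 - 2 * i + N ^ 2 - 1) ^ 2
      - 2 * (M ^ 2 - 1) ^ 2 ≥ 4 * (M ^ 2 - 1) * N ^ 2 := by
    nlinarith [sq_nonneg i, sq_nonneg (N ^ 2)]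
  have hquart' := mul_le_mul_of_nonneg_left hquart (show 0 ≤ a / 4 by positivity)
  have hp2 : 0 ≤ a * (M ^ 2 * N ^ 2) := by positivity
  have hp3 : 0 ≤ a * N ^ 2 := by positivity
  linarith

theorem continuous_S : Continuous S := by
  have h := fun j => (contDiff_coord (n := 5) j).continuous
  unfold S
  fun_prop

theorem continuous_pot (a : ℝ) : Continuous (pot a) := by
  have := continuous_S
  unfold pot
  fun_prop

end Potential

/-! ### The configuration spaces -/

section Config

open Filter Topology

/-- The class of the `w ∈ ℱ_a^s` whose third component has a trace on `T` with values in `C`. -/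
def Obst (a μ : ℝ) (C : Set ℝ) : Set (E 3 → E 5) :=
  {w | w ∈ Fs a μ ∧ ∃ t : E 3 → ℝ, HasTraceOnT (fun x => w x 2) t ∧ ∀ᵐ x ∂flatMeasure, t x ∈ C}

theorem Fplus_eq_Obst (a μ b : ℝ) : Fplus a μ b = Obst a μ (Ici (b * H a)) := rfl

theorem Fminus_eq_Obst (a μ c : ℝ) : Fminus a μ c = Obst a μ (Iic (c * H a)) := rfl

/-- `w = ℒ[u₀] + V` on the unit ball, where `V` has the weak gradient `G` in `H¹(ℝ³)`. -/
structure IsRep (a : ℝ) (w : E 3 → E 5) (V : Fin 5 → E 3 → ℝ) (G : Fin 5 → E 3 → E 3) : Prop where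
  isH10 : ∀ k, IsH10 1 (V k) (G k)
  eq_add : ∀ k, (fun x => w x k) =ᵐ[volume.restrict ball₁] fun x => comp a k x + V k x

variable {a μ : ℝ} {w w' : E 3 → E 5} {V V' : Fin 5 → E 3 → ℝ} {G G' : Fin 5 → E 3 → E 3}

theorem IsRep.memLp_apply (h : IsRep a w V G) (k : Fin 5) :
    MemLp (fun x => w x k) 2 (volume.restrict ball₁) :=
  ((h.isH10 k).memH1_add (contDiff_comp a k) (h.eq_add k)).1

theorem IsRep.aestronglyMeasurable (h : IsRep a w V G) :
    AEStronglyMeasurable w (volume.restrict ball₁) := by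
  have h1 : AEMeasurable (fun x => (fun k => w x k : Fin 5 → ℝ)) (volume.restrict ball₁) :=
    aemeasurable_pi_iff.2 fun k => (h.memLp_apply k).1.aemeasurable
  exact ((PiLp.continuous_toLp 2 (fun _ : Fin 5 => ℝ)).measurable.comp_aemeasurable
    h1).aestronglyMeasurable

theorem IsRep.weakGrad_ae_eq (h : IsRep a w V G) (k : Fin 5) :
    weakGrad ball₁ (fun x => w x k) =ᵐ[volume.restrict ball₁]
      fun x => grd (comp a k) x + G k x :=
  ((h.isH10 k).hasWeakGradient_add (contDiff_comp a k) (h.eq_add k)).weakGrad_ae_eq isOpen_ball₁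

theorem memLp_grd_add (h : IsRep a w V G) (k : Fin 5) :
    MemLp (fun x => grd (comp a k) x + G k x) 2 (volume.restrict ball₁) :=
  (integrable_ball₁_of_continuous (continuous_grd (contDiff_comp a k))).add
    ((h.isH10 k).memLp_grad.restrict _)

theorem IsRep.integrable_grad_sq (h : IsRep a w V G) (k : Fin 5) :
    IntegrableOn (fun x => ‖grd (comp a k) x + G k x‖ ^ 2) ball₁ :=
  (memLp_grd_add h k).norm.integrable_sq

theorem IsRep.density_ae_eq (h : IsRep a w V G) (μ : ℝ) :
    density a μ w =ᵐ[volume.restrict ball₁]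
      fun x => (∑ k, ‖grd (comp a k) x + G k x‖ ^ 2) + μ * pot a (w x) := by
  filter_upwards [ae_all_iff.2 h.weakGrad_ae_eq] with x hx
  simp only [density, pot, hx]

theorem MemF.exists_isRep (h : MemF a μ w) : ∃ V G, IsRep a w V G := by
  have := fun k => exists_isH10_of_hasTrace (contDiff_comp a k)
    (fun x hx => augField_Ustar a hx k) (h.memH1 k) (h.bdry k)
  choose G hG hG' using this
  refine ⟨_, G, hG, fun k => ?_⟩
  filter_upwards [ae_restrict_mem isOpen_ball₁.measurableSet] with x hx
  rw [indicator_of_mem hx]; ring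

theorem IsRep.integrable_pot (h : IsRep a w V G) (hμ : 0 < μ)
    (hd : IntegrableOn (density a μ w) ball₁) : IntegrableOn (fun x => pot a (w x)) ball₁ := by
  have h1 : IntegrableOn (fun x => ∑ k, ‖grd (comp a k) x + G k x‖ ^ 2) ball₁ :=
    integrable_finsetSum _ fun k _ => h.integrable_grad_sq k
  refine ((hd.sub h1).const_mul μ⁻¹).congr ?_
  filter_upwards [h.density_ae_eq μ] with x hx
  simp only [Pi.sub_apply, hx]
  rw [add_sub_cancel_left, inv_mul_cancel_left₀ hμ.ne']

theorem IsRep.memF (h : IsRep a w V G) (hp : IntegrableOn (fun x => pot a (w x)) ball₁)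
    (hu : ∃ u, IsAug w u) : MemF a μ w where
  isAug := hu
  memH1 k := (h.isH10 k).memH1_add (contDiff_comp a k) (h.eq_add k)
  finite_energy := by
    refine Integrable.congr ?_ (h.density_ae_eq μ).symm
    exact (integrable_finsetSum _ fun k _ => h.integrable_grad_sq k).add (hp.const_mul μ)
  bdry k := (h.isH10 k).hasTrace_add (contDiff_comp a k) (h.eq_add k)
    fun x hx => augField_Ustar a hx k

theorem IsRep.energy_eq (h : IsRep a w V G) (hp : IntegrableOn (fun x => pot a (w x)) ball₁) :
    energy a μ w = (∑ k, ∫ x in ball₁, ‖grd (comp a k) x + G k x‖ ^ 2)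
      + μ * ∫ x in ball₁, pot a (w x) := by
  rw [energy, integral_congr_ae (h.density_ae_eq μ), integral_add
    (integrable_finsetSum _ fun k _ => h.integrable_grad_sq k) (hp.const_mul μ),
    integral_finsetSum _ fun k _ => h.integrable_grad_sq k, integral_const_mul]

/-- Finite potential energy is the same as `w ∈ L⁴`, a linear condition. It is therefore stable
under midpoints and under the addition of test fields. -/
theorem integrable_pot_iff (ha : 0 < a) (hw : AEStronglyMeasurable w (volume.restrict ball₁)) :
    IntegrableOn (fun x => pot a (w x)) ball₁ ↔ IntegrableOn (fun x => ‖w x‖ ^ 4) ball₁ := by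
  obtain ⟨c, C, hc, hC, h⟩ := exists_pot_bounds ha
  constructor
  · intro hp
    refine ((hp.add (integrable_const C)).const_mul c⁻¹).mono' (hw.norm.pow 4)
      (Eventually.of_forall fun x => ?_)
    rw [Real.norm_of_nonneg (by positivity), ← div_eq_inv_mul, le_div_iff₀ hc]
    have := (h (w x)).1
    simp only [Pi.add_apply]; linarith
  · intro h4
    refine (((integrable_const (1 : ℝ)).add h4).const_mul C).mono'
      ((continuous_pot a).comp_aestronglyMeasurable hw) (Eventually.of_forall fun x => ?_)
    rw [Real.norm_eq_abs, abs_le]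
    have h1 := h (w x)
    have : 0 ≤ c * ‖w x‖ ^ 4 := by positivity
    have : 0 ≤ C * ‖w x‖ ^ 4 := by positivity
    simp only [Pi.add_apply]
    exact ⟨by linarith [h1.1], h1.2⟩

theorem HasTraceOnT.add {f f' t t' : E 3 → ℝ} (h : HasTraceOnT f t) (h' : HasTraceOnT f' t') :
    HasTraceOnT (fun x => f x + f' x) (fun x => t x + t' x) := by
  obtain ⟨ht, hf, G, hG, hGl, hφ⟩ := h
  obtain ⟨ht', hf', G', hG', hGl', hφ'⟩ := h'
  have key : ∀ {σ : Measure (E 3)} {g φ : E 3 → ℝ}, LocallyIntegrableOn g ball₁ σ → IsTest ball₁ φ →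
      Integrable (fun x => g x * φ x) σ := fun hg hφ =>
    hφ.integrable_mul (hg.integrableOn_compact_subset hφ.2.2 hφ.2.1)
  refine ⟨ht.add ht', hf.add hf', _, hG.add hG', hGl.add hGl', fun φ hT i => ?_⟩
  have e1 := hφ φ hT i
  have e2 := hφ' φ hT i
  have i1 := (key hf (hT.pd i)).add (key (locallyIntegrableOn_apply hGl i) hT)
  have i2 := (key hf' (hT.pd i)).add (key (locallyIntegrableOn_apply hGl' i) hT)
  have e3 : ∀ x, (f x + f' x) * pd i φ x + (G x + G' x) i * φ x
      = (f x * pd i φ x + G x i * φ x) + (f' x * pd i φ x + G' x i * φ x) := fun x => by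
    rw [PiLp.add_apply]; ring
  simp_rw [e3]
  rw [integral_add (f := fun x => f x * pd i φ x + G x i * φ x)
    (g := fun x => f' x * pd i φ x + G' x i * φ x) i1 i2, e1, e2,
    ← integral_add ((key ht hT).mul_const _) ((key ht' hT).mul_const _)]
  refine integral_congr_ae (Eventually.of_forall fun x => ?_)
  simp only; ring

theorem HasTraceOnT.const_mul {f t : E 3 → ℝ} (c : ℝ) (h : HasTraceOnT f t) :
    HasTraceOnT (fun x => c * f x) (fun x => c * t x) := by
  obtain ⟨ht, hf, G, hG, hGl, hφ⟩ := h
  refine ⟨ht.smul c, hf.smul c, fun x => c • G x, ⟨hG.locInt.smul c, hG.locInt_grad.smul c,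
    fun φ hT i => ?_⟩, hGl.smul c, fun φ hT i => ?_⟩
  · have := hG.integral_eq φ hT i
    simp only [PiLp.smul_apply, smul_eq_mul, mul_assoc, integral_const_mul, this]
    ring
  · have := hφ φ hT i
    simp only [PiLp.smul_apply, smul_eq_mul, mul_assoc, ← mul_add, integral_const_mul] at this ⊢
    rw [this]

theorem IsRAxial.add (h : IsRAxial w) (h' : IsRAxial w') : IsRAxial fun x => w x + w' x := by
  obtain ⟨u, hu, hs⟩ := h
  obtain ⟨u', hu', hs'⟩ := h'
  refine ⟨fun p => u p + u' p, ?_, fun p hp => ?_⟩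
  · filter_upwards [hu, hu'] with x hx hx'
    simp only [hx, hx']
    ext k
    simp only [augField, aug_apply, PiLp.add_apply]; ring
  · obtain ⟨h0, h1, h2⟩ := hs p hp
    obtain ⟨h0', h1', h2'⟩ := hs' p hp
    simp only [PiLp.add_apply, h0, h1, h2, h0', h1', h2']
    exact ⟨trivial, trivial, by ring⟩

theorem IsRAxial.const_smul (c : ℝ) (h : IsRAxial w) : IsRAxial fun x => c • w x := by
  obtain ⟨u, hu, hs⟩ := h
  refine ⟨fun p => c • u p, ?_, fun p hp => ?_⟩
  · filter_upwards [hu] with x hx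
    simp only [hx]
    ext k
    simp only [augField, aug_apply, PiLp.smul_apply, smul_eq_mul]; ring
  · obtain ⟨h0, h1, h2⟩ := hs p hp
    simp [h0, h1, h2]

theorem IsRAxial.exists_isAug (h : IsRAxial w) : ∃ u, IsAug w u := h.imp fun _ hu => hu.1

open Classical in
/-- The pointwise limit of a sequence of reals, `0` where there is none. -/
noncomputable def limOrZero (s : ℕ → ℝ) : ℝ :=
  if h : ∃ l, Tendsto s atTop (𝓝 l) then h.choose else 0

theorem limOrZero_eq {s : ℕ → ℝ} {l : ℝ} (h : Tendsto s atTop (𝓝 l)) : limOrZero s = l := by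
  have hex : ∃ l, Tendsto s atTop (𝓝 l) := ⟨l, h⟩
  rw [limOrZero, dif_pos hex]
  exact tendsto_nhds_unique hex.choose_spec h

/-- The default value `0` is its own negative, so the parity of limit profiles also holds at points
without a limit. -/
theorem limOrZero_neg (s : ℕ → ℝ) : limOrZero (fun n => -s n) = -limOrZero s := by
  by_cases h : ∃ l, Tendsto s atTop (𝓝 l)
  · obtain ⟨l, hl⟩ := h
    rw [limOrZero_eq hl, limOrZero_eq hl.neg]
  · have h' : ¬ ∃ l, Tendsto (fun n => -s n) atTop (𝓝 l) := fun ⟨l, hl⟩ =>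
      h ⟨-l, by simpa using hl.neg⟩
    rw [limOrZero, limOrZero, dif_neg h, dif_neg h', neg_zero]

/-- Axial symmetry passes to limits almost everywhere. -/
theorem isRAxial_of_tendsto {wn : ℕ → E 3 → E 5} (h : ∀ n, IsRAxial (wn n))
    (hlim : ∀ᵐ x ∂volume.restrict ball₁, ∀ k, Tendsto (fun n => wn n x k) atTop (𝓝 (w x k))) :
    IsRAxial w := by
  choose u hu hs using h
  refine ⟨fun p => WithLp.toLp 2 fun j => limOrZero fun n => u n p j, ?_, fun p hp => ?_⟩
  · filter_upwards [ae_all_iff.2 hu, hlim] with x hx hl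
    -- The profiles are recovered from the fields by the angular factors, so they converge on the
    -- meridian of every point at which the fields do.
    have hux : ∀ j, Tendsto (fun n => u n (meridian x) j) atTop
        (𝓝 (∑ k, if augIdx k = j then augTrig k (azimuth x) * w x k else 0)) := by
      intro j
      have : ∀ n, u n (meridian x) j
          = ∑ k, if augIdx k = j then augTrig k (azimuth x) * wn n x k else 0 := fun n => by
        rw [hx n]; exact (sum_augTrig_sq _ _ _).symm
      simp_rw [this]
      refine tendsto_finsetSum _ fun k _ => ?_
      split_ifs
      · exact (hl k).const_mul _
      · exact tendsto_const_nhds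
    ext k
    refine tendsto_nhds_unique (hl k) ?_
    rw [augField, aug_apply]
    simp only
    rw [limOrZero_eq (hux _)]
    refine ((hux (augIdx k)).const_mul (augTrig k (azimuth x))).congr fun n => ?_
    rw [hx n, augField, aug_apply]
  · simp only [fun n => (hs n p hp).1, fun n => (hs n p hp).2.1, fun n => (hs n p hp).2.2,
      limOrZero_neg, and_self]

/-- A fixed smooth cut-off of the third component of the competitor. -/
noncomputable def compCut (a : ℝ) : E 3 → ℝ := (exists_comp_cut a).choose

theorem isTest_compCut (a : ℝ) : IsTest (Metric.ball 0 3) (compCut a) :=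
  (exists_comp_cut a).choose_spec.1

theorem compCut_eq (a : ℝ) {x : E 3} (hx : x ∈ ball₁) : compCut a x = comp a 2 x :=
  (exists_comp_cut a).choose_spec.2 x hx

/-- The formula for `flatTrace` integrates to infinity along vertical rays. The competitor is
therefore replaced by a compactly supported function that agrees with it on the ball; its support
lies in the ball of radius `3`. -/
theorem IsRep.isH10_cut (h : IsRep a w V G) :
    IsH10 3 (fun x => compCut a x + V 2 x) (fun x => grd (compCut a) x + G 2 x) :=
  (isTest_ball_isH10 (isTest_compCut a)).add ((h.isH10 2).mono (by norm_num))

theorem IsRep.hasTraceOnT (h : IsRep a w V G) :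
    HasTraceOnT (fun x => w x 2) (flatTrace fun x => grd (compCut a) x + G 2 x) := by
  refine h.isH10_cut.hasTraceOnT ?_
  filter_upwards [h.eq_add 2, ae_restrict_mem isOpen_ball₁.measurableSet] with x hx hb
  rw [hx, compCut_eq a hb]

/-- The competitor as a field. -/
noncomputable def compField (a : ℝ) (x : E 3) : E 5 := WithLp.toLp 2 fun k => comp a k x

theorem isH10_zero : IsH10 1 (fun _ : E 3 => (0 : ℝ)) fun _ => 0 where
  memLp := MemLp.zero
  memLp_grad := MemLp.zero
  eq_zero _ _ := rfl
  grad_eq_zero _ _ := rfl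
  integral_eq φ _ i := by simp

theorem isRep_compField (a : ℝ) : IsRep a (compField a) (fun _ _ => 0) (fun _ _ => 0) where
  isH10 _ := isH10_zero
  eq_add k := Eventually.of_forall fun x => by simp [compField]

theorem compField_mem {C : Set ℝ} (hC : -1 / 2 * H a ∈ C) :
    compField a ∈ Obst a μ C := by
  have hax : IsRAxial (compField a) := by
    refine ⟨compProf a, Eventually.of_forall fun x => ?_, fun p _ => ?_⟩
    · ext k; rw [augField_compProf]; rfl
    · simp [compProf, compProfile, augDeg]
  refine ⟨⟨(isRep_compField a).memF ?_ hax.exists_isAug, hax⟩, _,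
    (isRep_compField a).hasTraceOnT, ?_⟩
  · have hc : Continuous (compField a) :=
      (PiLp.continuous_toLp 2 _).comp (continuous_pi fun k => (contDiff_comp a k).continuous)
    exact memLp_one_iff_integrable.1 (integrable_ball₁_of_continuous ((continuous_pot a).comp hc))
  · filter_upwards [ae_flatMeasure] with x hx
    simp only [add_zero]
    rw [show (fun x => grd (compCut a) x) = grd (compCut a) from rfl,
      flatTrace_grd ((isTest_compCut a).mono (subset_univ _)), compCut_eq a hx.2, comp_planeProj]
    exact hC

/-- The midpoint of two members of a minimizing sequence is the comparison field that forces their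
gradients together. This is where the convexity of the constraint enters. -/
theorem Obst.midpoint (ha : 0 < a) (hμ : 0 < μ) {C : Set ℝ} (hC : Convex ℝ C)
    (h : w ∈ Obst a μ C) (h' : w' ∈ Obst a μ C)
    (hr : IsRep a w V G) (hr' : IsRep a w' V' G') :
    (fun x => (1 / 2 : ℝ) • (w x + w' x)) ∈ Obst a μ C ∧
    IsRep a (fun x => (1 / 2 : ℝ) • (w x + w' x)) (fun k x => 1 / 2 * (V k x + V' k x))
      (fun k x => (1 / 2 : ℝ) • (G k x + G' k x)) := by
  have hrep : IsRep a (fun x => (1 / 2 : ℝ) • (w x + w' x)) (fun k x => 1 / 2 * (V k x + V' k x))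
      (fun k x => (1 / 2 : ℝ) • (G k x + G' k x)) := by
    refine ⟨fun k => ((hr.isH10 k).add (hr'.isH10 k)).const_mul _, fun k => ?_⟩
    filter_upwards [hr.eq_add k, hr'.eq_add k] with x hx hx'
    simp only [PiLp.smul_apply, PiLp.add_apply, smul_eq_mul, hx, hx']; ring
  obtain ⟨⟨hF, hax⟩, t, ht, htC⟩ := h
  obtain ⟨⟨hF', hax'⟩, t', ht', htC'⟩ := h'
  have hax'' := (hax.add hax').const_smul (1 / 2)
  refine ⟨⟨⟨hrep.memF ?_ hax''.exists_isAug, hax''⟩, fun x => 1 / 2 * (t x + t' x),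
    ((ht.add ht').const_mul (1 / 2)), ?_⟩, hrep⟩
  · rw [integrable_pot_iff ha hrep.aestronglyMeasurable]
    have i1 := (integrable_pot_iff ha hr.aestronglyMeasurable).1
      (hr.integrable_pot hμ hF.finite_energy)
    have i2 := (integrable_pot_iff ha hr'.aestronglyMeasurable).1
      (hr'.integrable_pot hμ hF'.finite_energy)
    refine (i1.add i2).mono' (hrep.aestronglyMeasurable.norm.pow 4) (Eventually.of_forall fun x => ?_)
    rw [Real.norm_of_nonneg (by positivity), norm_smul, Real.norm_of_nonneg (by norm_num)]
    have h1 := norm_add_le (w x) (w' x)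
    calc (1 / 2 * ‖w x + w' x‖) ^ 4 ≤ (1 / 2 * (‖w x‖ + ‖w' x‖)) ^ 4 := by gcongr
      _ ≤ ‖w x‖ ^ 4 + ‖w' x‖ ^ 4 := by
        have h2 := add_pow_le (norm_nonneg (w x)) (norm_nonneg (w' x)) 4
        norm_num at h2
        have : 0 ≤ ‖w x‖ ^ 4 + ‖w' x‖ ^ 4 := by positivity
        rw [mul_pow]
        norm_num
        linarith
  · filter_upwards [htC, htC'] with x hx hx'
    have := hC hx hx' (show (0 : ℝ) ≤ 1 / 2 by norm_num) (show (0 : ℝ) ≤ 1 / 2 by norm_num)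
      (by norm_num)
    simpa [mul_add] using this

end Config

/-! ### Existence of minimizers -/

section Existence

open Filter Topology

/-! ### Convergence in `L²` expressed by integrals -/

section L2

variable {α F : Type*} [MeasurableSpace α] {ν : Measure α} [NormedAddCommGroup F]
  [InnerProductSpace ℝ F]

theorem norm_toLp_sq {f : α → F} (hf : MemLp f 2 ν) : ‖hf.toLp f‖ ^ 2 = ∫ x, ‖f x‖ ^ 2 ∂ν := by
  rw [← real_inner_self_eq_norm_sq, L2.inner_def]
  refine integral_congr_ae ?_
  filter_upwards [hf.coeFn_toLp] with x hx
  rw [hx, real_inner_self_eq_norm_sq]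

theorem norm_toLp_sub_sq {f g : α → F} (hf : MemLp f 2 ν) (hg : MemLp g 2 ν) :
    ‖hf.toLp f - hg.toLp g‖ ^ 2 = ∫ x, ‖f x - g x‖ ^ 2 ∂ν := by
  rw [← MemLp.toLp_sub, norm_toLp_sq]; rfl

theorem exists_tendsto_of_cauchy [CompleteSpace F] {f : ℕ → α → F} (hf : ∀ m, MemLp (f m) 2 ν)
    (hc : ∀ δ > 0, ∃ N, ∀ m ≥ N, ∀ k ≥ N, ∫ x, ‖f m x - f k x‖ ^ 2 ∂ν ≤ δ) :
    ∃ g, MemLp g 2 ν ∧ Tendsto (fun m => ∫ x, ‖f m x - g x‖ ^ 2 ∂ν) atTop (𝓝 0) := by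
  have hC : CauchySeq fun m => (hf m).toLp (f m) := by
    rw [Metric.cauchySeq_iff]
    intro ε hε
    obtain ⟨N, hN⟩ := hc (ε ^ 2 / 2) (by positivity)
    refine ⟨N, fun m hm k hk => ?_⟩
    rw [dist_eq_norm]
    refine lt_of_pow_lt_pow_left₀ 2 hε.le ?_
    rw [norm_toLp_sub_sq]
    have : 0 < ε ^ 2 := by positivity
    linarith [hN m hm k hk]
  obtain ⟨g, hg⟩ := cauchySeq_tendsto_of_complete hC
  refine ⟨g, Lp.memLp g, ?_⟩
  have h1 := (tendsto_iff_norm_sub_tendsto_zero.1 hg).pow 2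
  rw [zero_pow two_ne_zero] at h1
  refine h1.congr fun m => ?_
  rw [← norm_toLp_sub_sq (hf m) (Lp.memLp g), Lp.toLp_coeFn]

theorem exists_subseq_ae_tendsto {f : ℕ → α → F} {g : α → F} (hf : ∀ m, MemLp (f m) 2 ν)
    (hg : MemLp g 2 ν) (h : Tendsto (fun m => ∫ x, ‖f m x - g x‖ ^ 2 ∂ν) atTop (𝓝 0)) :
    ∃ φ : ℕ → ℕ, StrictMono φ ∧ ∀ᵐ x ∂ν, Tendsto (fun m => f (φ m) x) atTop (𝓝 (g x)) := by
  refine (tendstoInMeasure_of_tendsto_eLpNorm (p := 2) two_ne_zero (fun m => (hf m).1) hg.1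
    ?_).exists_seq_tendsto_ae
  have h1 : Tendsto (fun m => (hf m).toLp (f m)) atTop (𝓝 (hg.toLp g)) := by
    rw [tendsto_iff_norm_sub_tendsto_zero]
    have := h.sqrt
    rw [Real.sqrt_zero] at this
    refine this.congr fun m => ?_
    rw [← norm_toLp_sub_sq (hf m) hg, Real.sqrt_sq (norm_nonneg _)]
  exact (Lp.tendsto_Lp_iff_tendsto_eLpNorm'' f hf g hg).1 h1

theorem tendsto_integral_mul {f : ℕ → α → ℝ} {g φ : α → ℝ} (hf : ∀ m, MemLp (f m) 2 ν)
    (hg : MemLp g 2 ν) (hφ : MemLp φ 2 ν)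
    (h : Tendsto (fun m => ∫ x, (f m x - g x) ^ 2 ∂ν) atTop (𝓝 0)) :
    Tendsto (fun m => ∫ x, f m x * φ x ∂ν) atTop (𝓝 (∫ x, g x * φ x ∂ν)) := by
  rw [tendsto_iff_norm_sub_tendsto_zero]
  have hs : Tendsto (fun m => Real.sqrt ((∫ x, (f m x - g x) ^ 2 ∂ν) * ∫ x, φ x ^ 2 ∂ν)) atTop
      (𝓝 0) := by
    simpa using (h.mul_const (∫ x, φ x ^ 2 ∂ν)).sqrt
  refine squeeze_zero (fun _ => norm_nonneg _) (fun m => ?_) hs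
  rw [← integral_sub (f := fun x => f m x * φ x) (g := fun x => g x * φ x)
    ((hf m).integrable_mul hφ) (hg.integrable_mul hφ), Real.norm_eq_abs]
  refine Real.abs_le_sqrt ?_
  have := sq_integral_mul_le ((hf m).sub hg) hφ
  simpa [sub_mul] using this

end L2

/-! ### Completeness and compactness for functions vanishing off a ball -/

variable {n : ℕ} {R : ℝ}

theorem sq_apply_le_norm_sq (y : E n) (i : Fin n) : y i ^ 2 ≤ ‖y‖ ^ 2 := by
  rw [← sq_abs]; exact pow_le_pow_left₀ (abs_nonneg _) (PiLp.norm_apply_le y i) 2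

theorem tendsto_integral_indicator {F : Type*} [NormedAddCommGroup F] {f : ℕ → E n → F}
    {g : E n → F} {s : Set (E n)} (hs : MeasurableSet s) (hf : ∀ m, MemLp (f m) 2 volume)
    (hg : MemLp g 2 volume) (h0 : ∀ m, ∀ x ∉ s, f m x = 0)
    (h : Tendsto (fun m => ∫ x, ‖f m x - g x‖ ^ 2) atTop (𝓝 0)) :
    Tendsto (fun m => ∫ x, ‖f m x - s.indicator g x‖ ^ 2) atTop (𝓝 0) := by
  refine squeeze_zero (fun m => integral_nonneg fun x => by positivity) (fun m => ?_) h
  refine integral_mono ((hf m).sub (hg.indicator hs)).norm.integrable_sq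
    ((hf m).sub hg).norm.integrable_sq fun x => ?_
  by_cases hx : x ∈ s
  · simp [hx]
  · simp only [indicator_of_notMem hx, h0 m x hx, sub_zero, norm_zero]
    exact (zero_pow two_ne_zero).trans_le (sq_nonneg _)

/-- The spaces `H¹₀` are complete. -/
theorem exists_isH10_limit {v : ℕ → E n → ℝ} {G : ℕ → E n → E n} (H : ∀ m, IsH10 R (v m) (G m))
    (hv : ∀ δ > 0, ∃ N, ∀ m ≥ N, ∀ k ≥ N, ∫ x, (v m x - v k x) ^ 2 ≤ δ)
    (hG : ∀ δ > 0, ∃ N, ∀ m ≥ N, ∀ k ≥ N, ∫ x, ‖G m x - G k x‖ ^ 2 ≤ δ) :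
    ∃ v' G', IsH10 R v' G' ∧ Tendsto (fun m => ∫ x, (v m x - v' x) ^ 2) atTop (𝓝 0) ∧
      Tendsto (fun m => ∫ x, ‖G m x - G' x‖ ^ 2) atTop (𝓝 0) := by
  obtain ⟨v', hv', hvt⟩ := exists_tendsto_of_cauchy (fun m => (H m).memLp)
    (by simpa only [Real.norm_eq_abs, sq_abs] using hv)
  obtain ⟨G', hG', hGt⟩ := exists_tendsto_of_cauchy (fun m => (H m).memLp_grad) hG
  set B := Metric.ball (0 : E n) R
  have hB : MeasurableSet B := Metric.isOpen_ball.measurableSet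
  have hvt' := tendsto_integral_indicator hB (fun m => (H m).memLp) hv' (fun m => (H m).eq_zero) hvt
  simp only [Real.norm_eq_abs, sq_abs] at hvt'
  have hGt' := tendsto_integral_indicator hB (fun m => (H m).memLp_grad) hG'
    (fun m => (H m).grad_eq_zero) hGt
  refine ⟨B.indicator v', B.indicator G', ⟨hv'.indicator hB, hG'.indicator hB,
    fun x hx => indicator_of_notMem hx _, fun x hx => indicator_of_notMem hx _,
    fun φ hφ i => ?_⟩, hvt', hGt'⟩
  have h1 := tendsto_integral_mul (fun m => (H m).memLp) (hv'.indicator hB) (hφ.pd i).memLp hvt'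
  have h2 := tendsto_integral_mul (fun m => memLp_apply (H m).memLp_grad i)
    (memLp_apply (hG'.indicator hB) i) hφ.memLp (squeeze_zero
      (fun m => integral_nonneg fun x => sq_nonneg _) (fun m => integral_mono
        ((memLp_apply (H m).memLp_grad i).sub (memLp_apply (hG'.indicator hB) i)).integrable_sq
        ((H m).memLp_grad.sub (hG'.indicator hB)).norm.integrable_sq
        fun x => sq_apply_le_norm_sq (G m x - B.indicator G' x) i) hGt')
  exact tendsto_nhds_unique h1 (h2.neg.congr fun m => ((H m).integral_eq φ hφ i).symm)

/-- Rellich's theorem for finitely many components. -/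
theorem exists_subseq_cauchy_fin {ι : Type*} [Finite ι] {v : ι → ℕ → E n → ℝ}
    {G : ι → ℕ → E n → E n} (H : ∀ k m, IsH10 1 (v k m) (G k m)) {C : ℝ}
    (hv : ∀ k m, ∫ x, v k m x ^ 2 ≤ C) (hG : ∀ k m, ∫ x, ‖G k m x‖ ^ 2 ≤ C) :
    ∃ φ : ℕ → ℕ, StrictMono φ ∧ ∀ k, ∀ δ > 0, ∃ N, ∀ m ≥ N, ∀ l ≥ N,
      ∫ x, (v k (φ m) x - v k (φ l) x) ^ 2 ≤ δ := by
  classical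
  have := Fintype.ofFinite ι
  suffices h : ∀ s : Finset ι, ∃ φ : ℕ → ℕ, StrictMono φ ∧ ∀ k ∈ s, ∀ δ > 0, ∃ N, ∀ m ≥ N, ∀ l ≥ N,
      ∫ x, (v k (φ m) x - v k (φ l) x) ^ 2 ≤ δ by
    obtain ⟨φ, hφ, h⟩ := h Finset.univ
    exact ⟨φ, hφ, fun k => h k (Finset.mem_univ k)⟩
  intro s
  induction s using Finset.induction_on with
  | empty => exact ⟨id, strictMono_id, by simp⟩
  | insert k s _ ih =>
    obtain ⟨φ, hφ, h⟩ := ih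
    obtain ⟨ψ, hψ, h'⟩ := exists_subseq_cauchy (fun m => H k (φ m)) (fun m => hv k (φ m))
      fun m => hG k (φ m)
    refine ⟨φ ∘ ψ, hφ.comp hψ, fun l hl => ?_⟩
    rcases Finset.mem_insert.1 hl with rfl | hl
    · exact h'
    · intro δ hδ
      obtain ⟨N, hN⟩ := h l hl δ hδ
      exact ⟨N, fun m hm j hj => hN _ (hm.trans (hψ.id_le m)) _ (hj.trans (hψ.id_le j))⟩

/-! ### Midpoint inequality, coercivity and the limit of a minimizing sequence -/

variable {a μ : ℝ} {w w' : E 3 → E 5} {V V' : Fin 5 → E 3 → ℝ} {G G' : Fin 5 → E 3 → E 3}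

theorem setIntegral_ball_eq {f : E 3 → ℝ} (h : ∀ x ∉ ball₁, f x = 0) :
    ∫ x in ball₁, f x = ∫ x, f x := setIntegral_eq_integral_of_forall_compl_eq_zero h

theorem IsRep.memLp (h : IsRep a w V G) : MemLp w 2 (volume.restrict ball₁) := by
  have h1 : MemLp (fun x => ∑ k, |w x k|) 2 (volume.restrict ball₁) :=
    memLp_finsetSum _ fun k _ => (h.memLp_apply k).norm
  refine h1.mono h.aestronglyMeasurable (Eventually.of_forall fun x => ?_)
  rw [Real.norm_of_nonneg (Finset.sum_nonneg fun k _ => abs_nonneg _)]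
  refine (sq_le_sq₀ (norm_nonneg _) (Finset.sum_nonneg fun k _ => abs_nonneg _)).1 ?_
  rw [EuclideanSpace.norm_sq_eq]
  exact Finset.sum_sq_le_sq_sum_of_nonneg fun k _ => abs_nonneg _

theorem IsRep.integral_norm_sub_sq (h : IsRep a w V G) (h' : IsRep a w' V' G') :
    ∫ x in ball₁, ‖w x - w' x‖ ^ 2 = ∑ k, ∫ x, (V k x - V' k x) ^ 2 := by
  have h1 : ∀ k, IntegrableOn (fun x => (V k x - V' k x) ^ 2) ball₁ := fun k =>
    ((h.isH10 k).memLp.sub (h'.isH10 k).memLp).integrable_sq.integrableOn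
  rw [show ∑ k, ∫ x, (V k x - V' k x) ^ 2 = ∑ k, ∫ x in ball₁, (V k x - V' k x) ^ 2 from
    Finset.sum_congr rfl fun k _ => (setIntegral_ball_eq fun x hx => by
      rw [(h.isH10 k).eq_zero x hx, (h'.isH10 k).eq_zero x hx]; ring).symm,
    ← integral_finsetSum _ fun k _ => h1 k]
  refine integral_congr_ae ?_
  filter_upwards [ae_all_iff.2 h.eq_add, ae_all_iff.2 h'.eq_add] with x hx hx'
  rw [EuclideanSpace.norm_sq_eq]
  refine Finset.sum_congr rfl fun k _ => ?_
  rw [PiLp.sub_apply, hx, hx', Real.norm_eq_abs, sq_abs]; ring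

/-- The parallelogram inequality for the energy. -/
theorem IsRep.energy_midpoint_le (hμ : 0 < μ) {K : ℝ}
    (hK : ∀ v w : E 5, pot a ((1 / 2 : ℝ) • (v + w)) ≤ (pot a v + pot a w) / 2 + K * ‖v - w‖ ^ 2)
    (h : IsRep a w V G) (h' : IsRep a w' V' G')
    (hm : IsRep a (fun x => (1 / 2 : ℝ) • (w x + w' x)) (fun k x => 1 / 2 * (V k x + V' k x))
      (fun k x => (1 / 2 : ℝ) • (G k x + G' k x)))
    (hp : IntegrableOn (fun x => pot a (w x)) ball₁)
    (hp' : IntegrableOn (fun x => pot a (w' x)) ball₁)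
    (hpm : IntegrableOn (fun x => pot a ((1 / 2 : ℝ) • (w x + w' x))) ball₁) :
    energy a μ (fun x => (1 / 2 : ℝ) • (w x + w' x)) + (∑ k, ∫ x, ‖G k x - G' k x‖ ^ 2) / 4 ≤
      (energy a μ w + energy a μ w') / 2 + μ * K * ∑ k, ∫ x, (V k x - V' k x) ^ 2 := by
  rw [hm.energy_eq hpm, h.energy_eq hp, h'.energy_eq hp', ← h.integral_norm_sub_sq h']
  -- The fixed gradient of the competitor cancels in the difference, and the parallelogram law is an
  -- identity: the Dirichlet integral falls short of the mean by exactly a quarter of the squared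
  -- distance.
  have e1 : ∀ k, ∫ x in ball₁, ‖grd (comp a k) x + (1 / 2 : ℝ) • (G k x + G' k x)‖ ^ 2
      = ((∫ x in ball₁, ‖grd (comp a k) x + G k x‖ ^ 2)
        + ∫ x in ball₁, ‖grd (comp a k) x + G' k x‖ ^ 2) / 2
        - (∫ x, ‖G k x - G' k x‖ ^ 2) / 4 := fun k => by
    have i3 : IntegrableOn (fun x => ‖G k x - G' k x‖ ^ 2) ball₁ :=
      ((h.isH10 k).memLp_grad.sub (h'.isH10 k).memLp_grad).norm.integrable_sq.integrableOn
    rw [← setIntegral_ball_eq fun x hx => by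
      rw [(h.isH10 k).grad_eq_zero x hx, (h'.isH10 k).grad_eq_zero x hx]; simp,
      ← integral_add (h.integrable_grad_sq k) (h'.integrable_grad_sq k), ← integral_div,
      ← integral_div, ← integral_sub
      (((h.integrable_grad_sq k).fun_add (h'.integrable_grad_sq k)).div_const 2) (i3.div_const 4)]
    refine integral_congr_ae (Eventually.of_forall fun x => ?_)
    simp only
    set p := grd (comp a k) x + G k x with hpd
    set q := grd (comp a k) x + G' k x with hqd
    have e2 : grd (comp a k) x + (1 / 2 : ℝ) • (G k x + G' k x) = (1 / 2 : ℝ) • (p + q) := by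
      rw [hpd, hqd]; module
    have e3 : G k x - G' k x = p - q := by rw [hpd, hqd]; abel
    rw [e2, e3, norm_smul, mul_pow, Real.norm_of_nonneg (by norm_num)]
    have := parallelogram_law_with_norm ℝ p q
    linear_combination (1 / 4 : ℝ) * this
  have e2 : ∫ x in ball₁, pot a ((1 / 2 : ℝ) • (w x + w' x)) ≤
      ((∫ x in ball₁, pot a (w x)) + ∫ x in ball₁, pot a (w' x)) / 2
        + K * ∫ x in ball₁, ‖w x - w' x‖ ^ 2 := by
    have i1 : IntegrableOn (fun x => ‖w x - w' x‖ ^ 2) ball₁ :=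
      (h.memLp.sub h'.memLp).norm.integrable_sq
    rw [← integral_add hp hp', ← integral_div, ← integral_const_mul,
      ← integral_add ((hp.fun_add hp').div_const 2) (i1.const_mul K)]
    exact integral_mono hpm (((hp.fun_add hp').div_const 2).add (i1.const_mul K)) fun x => hK _ _
  simp_rw [e1]
  rw [Finset.sum_sub_distrib, ← Finset.sum_div, ← Finset.sum_div, Finset.sum_add_distrib]
  nlinarith [mul_le_mul_of_nonneg_left e2 hμ.le]

theorem add_sq_le (x y : ℝ) : (x - y) ^ 2 ≤ 2 * x ^ 2 + 2 * y ^ 2 := by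
  nlinarith [sq_nonneg (x + y)]

theorem IsRep.integral_sq_le (h : IsRep a w V G) (i4 : IntegrableOn (fun x => ‖w x‖ ^ 4) ball₁)
    (k : Fin 5) : ∫ x, V k x ^ 2 ≤ 2 * (∫ x in ball₁, ‖w x‖ ^ 4) + 2 * volume.real ball₁
      + 2 * ∫ x in ball₁, comp a k x ^ 2 := by
  have ik : IntegrableOn (fun x => comp a k x ^ 2) ball₁ :=
    (integrable_ball₁_of_continuous (contDiff_comp a k).continuous).integrable_sq
  rw [← setIntegral_ball_eq fun x hx => by rw [(h.isH10 k).eq_zero x hx]; ring]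
  have := integral_mono_ae (h.isH10 k).memLp.integrable_sq.integrableOn
    (((i4.const_mul 2).fun_add (integrable_const (2 : ℝ))).add (ik.const_mul 2)) (by
      filter_upwards [h.eq_add k] with x hx
      have e : V k x = w x k - comp a k x := by rw [hx]; ring
      have h3 := add_sq_le (w x k) (comp a k x)
      have h4 := sq_apply_le_norm_sq (w x) k
      simp only [Pi.add_apply]
      rw [e]
      nlinarith [sq_nonneg (‖w x‖ ^ 2 - 1)])
  simp only [Pi.add_apply] at this
  rw [integral_add ((i4.const_mul 2).fun_add (integrable_const (2 : ℝ))) (ik.const_mul 2),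
    integral_add (i4.const_mul 2) (integrable_const (2 : ℝ)), integral_const_mul,
    integral_const_mul] at this
  simp only [integral_const, smul_eq_mul, measureReal_restrict_apply_univ] at this
  linarith

theorem norm_sq_le_of_add {F : Type*} [NormedAddCommGroup F] [InnerProductSpace ℝ F] (p q : F) :
    ‖q‖ ^ 2 ≤ 2 * ‖p + q‖ ^ 2 + 2 * ‖p‖ ^ 2 := by
  have h := parallelogram_law_with_norm ℝ (p + q) p
  rw [add_sub_cancel_left] at h
  nlinarith [mul_self_nonneg ‖p + q + p‖]

theorem IsRep.integral_norm_grad_sq_le (h : IsRep a w V G) (k : Fin 5) :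
    ∫ x, ‖G k x‖ ^ 2 ≤ 2 * (∫ x in ball₁, ‖grd (comp a k) x + G k x‖ ^ 2)
      + 2 * ∫ x in ball₁, ‖grd (comp a k) x‖ ^ 2 := by
  have ik : IntegrableOn (fun x => ‖grd (comp a k) x‖ ^ 2) ball₁ :=
    (integrable_ball₁_of_continuous (continuous_grd (contDiff_comp a k))).norm.integrable_sq
  rw [← setIntegral_ball_eq fun x hx => by rw [(h.isH10 k).grad_eq_zero x hx]; simp,
    ← integral_const_mul, ← integral_const_mul,
    ← integral_add ((h.integrable_grad_sq k).const_mul 2) (ik.const_mul 2)]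
  exact integral_mono (h.isH10 k).memLp_grad.norm.integrable_sq.integrableOn
    (((h.integrable_grad_sq k).const_mul 2).add (ik.const_mul 2)) fun x => norm_sq_le_of_add _ _

/-- The arithmetic of coercivity apart from the integrals. Here `X` stands for `∫ ‖w‖⁴`, `S` for the
Dirichlet integral, `P` for the integral of the potential, `b` for the volume of the ball, and `Q`
bounds the competitor and its gradient. -/
theorem coercive_bound {μ c C b Q X S P e : ℝ} (hμ : 0 < μ) (hc : 0 < c) (hb : 0 ≤ b)
    (hQ : 0 ≤ Q) (hS : 0 ≤ S) (hX : 0 ≤ X) (he : e = S + μ * P) (hP : c * X - C * b ≤ P) :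
    -(μ * C * b + Q + b) ≤ e ∧
    (∀ v ≤ 2 * X + 2 * b + 2 * Q, v ≤ 2 * (1 + (μ * c)⁻¹) * (e + (μ * C * b + Q + b))) ∧
    ∀ v ≤ 2 * S + 2 * Q, v ≤ 2 * (1 + (μ * c)⁻¹) * (e + (μ * C * b + Q + b)) := by
  have h1 : μ * (c * X) - μ * C * b ≤ μ * P := by
    have := mul_le_mul_of_nonneg_left hP hμ.le
    linarith
  have h2 : 0 ≤ μ * (c * X) := by positivity
  have hi : 0 ≤ (μ * c)⁻¹ := by positivity
  have h3 : X ≤ (μ * c)⁻¹ * (e + (μ * C * b + Q + b)) := by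
    have : μ * c * X ≤ e + (μ * C * b + Q + b) := by linarith
    calc X = (μ * c)⁻¹ * (μ * c * X) := by field_simp
      _ ≤ _ := mul_le_mul_of_nonneg_left this hi
  have h4 : 0 ≤ (μ * c)⁻¹ * (e + (μ * C * b + Q + b)) := hX.trans h3
  exact ⟨by linarith, fun v hv => by linarith, fun v hv => by linarith⟩

/-- Coercivity of the energy. -/
theorem exists_isRep_bound (ha : 0 < a) (hμ : 0 < μ) : ∃ A B : ℝ, 0 ≤ A ∧ ∀ {w V G}, IsRep a w V G →
    IntegrableOn (fun x => pot a (w x)) ball₁ → (-B ≤ energy a μ w) ∧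
      ∀ k, ∫ x, V k x ^ 2 ≤ A * (energy a μ w + B) ∧ ∫ x, ‖G k x‖ ^ 2 ≤ A * (energy a μ w + B) := by
  obtain ⟨c, C, hc, hC, hpot⟩ := exists_pot_bounds ha
  have hb0 : 0 ≤ volume.real ball₁ := measureReal_nonneg
  have hn : ∀ k, 0 ≤ (∫ x in ball₁, ‖grd (comp a k) x‖ ^ 2) := fun k =>
    integral_nonneg fun x => sq_nonneg _
  have hn' : ∀ k, 0 ≤ (∫ x in ball₁, comp a k x ^ 2) := fun k => integral_nonneg fun x => sq_nonneg _
  obtain ⟨Q, hQ0, hQ, hQ'⟩ : ∃ Q, 0 ≤ Q ∧ (∀ k, (∫ x in ball₁, ‖grd (comp a k) x‖ ^ 2) ≤ Q) ∧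
      ∀ k, (∫ x in ball₁, comp a k x ^ 2) ≤ Q := by
    have hs := fun k => Finset.single_le_sum (f := fun k => (∫ x in ball₁, ‖grd (comp a k) x‖ ^ 2)
      + ∫ x in ball₁, comp a k x ^ 2) (fun k _ => add_nonneg (hn k) (hn' k)) (Finset.mem_univ k)
    exact ⟨_, Finset.sum_nonneg fun k _ => add_nonneg (hn k) (hn' k),
      fun k => (le_add_of_nonneg_right (hn' k)).trans (hs k),
      fun k => (le_add_of_nonneg_left (hn k)).trans (hs k)⟩
  refine ⟨2 * (1 + (μ * c)⁻¹), μ * C * volume.real ball₁ + Q + volume.real ball₁, by positivity,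
    fun {w V G} h hp => ?_⟩
  have i4 : IntegrableOn (fun x => ‖w x‖ ^ 4) ball₁ :=
    (integrable_pot_iff ha h.aestronglyMeasurable).1 hp
  have hlow : c * (∫ x in ball₁, ‖w x‖ ^ 4) - C * volume.real ball₁
      ≤ ∫ x in ball₁, pot a (w x) := by
    have := integral_mono ((i4.const_mul c).sub (integrable_const C)) hp fun x => (hpot (w x)).1
    simp only [Pi.sub_apply] at this
    rw [integral_sub (i4.const_mul c) (integrable_const C), integral_const_mul] at this
    simp only [integral_const, smul_eq_mul, measureReal_restrict_apply_univ] at this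
    rwa [mul_comm C]
  have hgk : ∀ k, 0 ≤ ∫ x in ball₁, ‖grd (comp a k) x + G k x‖ ^ 2 := fun k =>
    integral_nonneg fun x => sq_nonneg _
  have hgs := fun k => Finset.single_le_sum
    (f := fun k => ∫ x in ball₁, ‖grd (comp a k) x + G k x‖ ^ 2)
    (fun k _ => hgk k) (Finset.mem_univ k)
  obtain ⟨h1, h2, h3⟩ := coercive_bound hμ hc hb0 hQ0 ((hgk 0).trans (hgs 0))
    (integral_nonneg fun x => pow_nonneg (norm_nonneg (w x)) 4) (h.energy_eq (μ := μ) hp) hlow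
  refine ⟨h1, fun k => ⟨h2 _ ?_, h3 _ ?_⟩⟩
  · exact (h.integral_sq_le i4 k).trans (by linarith [hQ' k])
  · exact (h.integral_norm_grad_sq_le k).trans (by linarith [hQ k, hgs k])

theorem Obst.integrable_pot (hμ : 0 < μ) {C : Set ℝ} (h : w ∈ Obst a μ C) (hr : IsRep a w V G) :
    IntegrableOn (fun x => pot a (w x)) ball₁ := hr.integrable_pot hμ h.1.1.finite_energy

/-- A minimizing sequence has a strongly convergent subsequence. -/
theorem exists_minimizing_seq (ha : 0 < a) (hμ : 0 < μ) {C : Set ℝ} (hC : Convex ℝ C)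
    (hC0 : -1 / 2 * H a ∈ C) : ∃ (I : ℝ) (wn : ℕ → E 3 → E 5) (Vn : ℕ → Fin 5 → E 3 → ℝ)
      (Gn : ℕ → Fin 5 → E 3 → E 3), (∀ w ∈ Obst a μ C, I ≤ energy a μ w) ∧
      Tendsto (fun n => energy a μ (wn n)) atTop (𝓝 I) ∧ (∀ n, wn n ∈ Obst a μ C) ∧
      (∀ n, IsRep a (wn n) (Vn n) (Gn n)) ∧
      (∀ k, ∀ δ > 0, ∃ N, ∀ m ≥ N, ∀ l ≥ N, ∫ x, (Vn m k x - Vn l k x) ^ 2 ≤ δ) ∧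
      ∀ k, ∀ δ > 0, ∃ N, ∀ m ≥ N, ∀ l ≥ N, ∫ x, ‖Gn m k x - Gn l k x‖ ^ 2 ≤ δ := by
  obtain ⟨A, B, hA, hAB⟩ := exists_isRep_bound ha hμ
  have hbdd : BddBelow (energy a μ '' Obst a μ C) := by
    refine ⟨-B, ?_⟩
    rintro _ ⟨w, hw, rfl⟩
    obtain ⟨V, G, hr⟩ := hw.1.1.exists_isRep
    exact (hAB hr (Obst.integrable_pot hμ hw hr)).1
  obtain ⟨e, he, het, hem⟩ := exists_seq_tendsto_sInf
    (Set.Nonempty.image _ ⟨_, compField_mem (a := a) (μ := μ) hC0⟩) hbdd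
  set I := sInf (energy a μ '' Obst a μ C) with hI
  choose w hw hwe using hem
  have := fun n => (hw n).1.1.exists_isRep
  choose V G hr using this
  have hp := fun n => Obst.integrable_pot hμ (hw n) (hr n)
  have hle : ∀ n, A * (energy a μ (w n) + B) ≤ A * (e 0 + B) := fun n => by
    rw [hwe]
    exact mul_le_mul_of_nonneg_left (by linarith [he (Nat.zero_le n)]) hA
  obtain ⟨φ, hφ, hcauchy⟩ := exists_subseq_cauchy_fin (v := fun k n => V n k) (G := fun k n => G n k)
    (fun k n => (hr n).isH10 k) (fun k n => (((hAB (hr n) (hp n)).2 k).1).trans (hle n))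
    fun k n => (((hAB (hr n) (hp n)).2 k).2).trans (hle n)
  have hIle : ∀ w ∈ Obst a μ C, I ≤ energy a μ w := fun w hw => csInf_le hbdd ⟨w, hw, rfl⟩
  have het' : Tendsto (fun n => energy a μ (w (φ n))) atTop (𝓝 I) := by
    simp_rw [hwe]; exact het.comp hφ.tendsto_atTop
  refine ⟨I, fun n => w (φ n), fun n => V (φ n), fun n => G (φ n), hIle, het', fun n => hw _,
    fun n => hr _, hcauchy, fun k δ hδ => ?_⟩
  obtain ⟨K, hK0, hK⟩ := exists_pot_semiconvex ha
  -- Two energies within `ε` of the infimum and five components within `ε` in squared `L²` distance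
  -- bound the gradient distance by `4 (ε + 5 μ K ε) ≤ δ`.
  set ε := δ / (4 * (2 + 5 * μ * K)) with hε
  have hε0 : 0 < ε := by positivity
  choose N hN using fun k => hcauchy k ε hε0
  obtain ⟨N', hN'⟩ := (Filter.eventually_atTop.1 (het'.eventually (gt_mem_nhds (lt_add_of_pos_right I
    hε0))))
  refine ⟨max N' (∑ k, N k), fun m hm l hl => ?_⟩
  have hmid := Obst.midpoint ha hμ hC (hw (φ m)) (hw (φ l)) (hr _) (hr _)
  have h1 := (hr (φ m)).energy_midpoint_le hμ hK (hr (φ l)) hmid.2 (hp _) (hp _)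
    (Obst.integrable_pot hμ hmid.1 hmid.2)
  have h2 := hIle _ hmid.1
  have h3 := hN' m ((le_max_left _ _).trans hm)
  have h4 := hN' l ((le_max_left _ _).trans hl)
  have hNs : ∀ j, N j ≤ ∑ k, N k := fun j => Finset.single_le_sum (fun _ _ => Nat.zero_le _)
    (Finset.mem_univ j)
  have h5 : ∑ k, ∫ x, (V (φ m) k x - V (φ l) k x) ^ 2 ≤ 5 * ε := by
    refine (Finset.sum_le_sum fun j _ => hN j m ((hNs j).trans ((le_max_right _ _).trans hm)) l
      ((hNs j).trans ((le_max_right _ _).trans hl))).trans ?_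
    simp
  have h6 := Finset.single_le_sum (f := fun k => ∫ x, ‖G (φ m) k x - G (φ l) k x‖ ^ 2)
    (fun k _ => integral_nonneg fun x => sq_nonneg _) (Finset.mem_univ k)
  have h7 : μ * K * (∑ k, ∫ x, (V (φ m) k x - V (φ l) k x) ^ 2) ≤ μ * K * (5 * ε) :=
    mul_le_mul_of_nonneg_left h5 (by positivity)
  have h8 : ε * (4 * (2 + 5 * μ * K)) = δ := by rw [hε]; field_simp
  linarith

/-- Fatou's lemma for the potential. -/
theorem integrable_pot_of_tendsto (ha : 0 < a) {wn : ℕ → E 3 → E 5}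
    (hw : AEStronglyMeasurable w (volume.restrict ball₁))
    (hp : ∀ n, IntegrableOn (fun x => pot a (wn n x)) ball₁)
    (hlim : ∀ᵐ x ∂volume.restrict ball₁, Tendsto (fun n => wn n x) atTop (𝓝 (w x)))
    {P : ℝ} (hP : Tendsto (fun n => ∫ x in ball₁, pot a (wn n x)) atTop (𝓝 P)) :
    IntegrableOn (fun x => pot a (w x)) ball₁ ∧ ∫ x in ball₁, pot a (w x) ≤ P := by
  obtain ⟨c, C, hc, hC, hpot⟩ := exists_pot_bounds ha
  -- Adding the constant of the lower bound makes the integrand nonnegative, as Fatou's lemma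
  -- requires; the ball has finite volume.
  have hnn : ∀ v, 0 ≤ pot a v + C := fun v => by
    have : 0 ≤ c * ‖v‖ ^ 4 := by positivity
    linarith [(hpot v).1]
  have i1 : ∀ n, IntegrableOn (fun x => pot a (wn n x) + C) ball₁ := fun n =>
    (hp n).fun_add (integrable_const C)
  have e1 : ∀ n, ∫ x in ball₁, (pot a (wn n x) + C)
      = (∫ x in ball₁, pot a (wn n x)) + C * volume.real ball₁ := fun n => by
    rw [integral_add (hp n) (integrable_const C)]
    simp [mul_comm]
  have hmeas : AEStronglyMeasurable (fun x => pot a (w x) + C) (volume.restrict ball₁) :=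
    ((continuous_pot a).comp_aestronglyMeasurable hw).add_const C
  have hfatou : ∫⁻ x in ball₁, ENNReal.ofReal (pot a (w x) + C)
      ≤ ENNReal.ofReal (P + C * volume.real ball₁) := by
    have h1 : ∫⁻ x in ball₁, ENNReal.ofReal (pot a (w x) + C)
        = ∫⁻ x in ball₁, liminf (fun n => ENNReal.ofReal (pot a (wn n x) + C)) atTop := by
      refine lintegral_congr_ae ?_
      filter_upwards [hlim] with x hx
      refine (Tendsto.liminf_eq ?_).symm
      exact ENNReal.tendsto_ofReal ((((continuous_pot a).tendsto _).comp hx).add_const C)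
    rw [h1]
    refine (lintegral_liminf_le' fun n => (i1 n).1.aemeasurable.ennreal_ofReal).trans ?_
    have h2 : ∀ n, ∫⁻ x in ball₁, ENNReal.ofReal (pot a (wn n x) + C)
        = ENNReal.ofReal ((∫ x in ball₁, pot a (wn n x)) + C * volume.real ball₁) := fun n => by
      rw [← e1, ofReal_integral_eq_lintegral_ofReal (i1 n) (Eventually.of_forall fun x => hnn _)]
    simp_rw [h2]
    exact (ENNReal.tendsto_ofReal (hP.add_const _)).liminf_eq.le
  have hint : IntegrableOn (fun x => pot a (w x) + C) ball₁ := by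
    refine ⟨hmeas, ?_⟩
    rw [hasFiniteIntegral_iff_ofReal (Eventually.of_forall fun x => hnn _)]
    exact hfatou.trans_lt ENNReal.ofReal_lt_top
  have hint' : IntegrableOn (fun x => pot a (w x)) ball₁ := by
    refine (hint.sub (integrable_const C)).congr (Eventually.of_forall fun x => ?_)
    simp
  refine ⟨hint', ?_⟩
  have h3 : ENNReal.ofReal (∫ x in ball₁, (pot a (w x) + C))
      ≤ ENNReal.ofReal (P + C * volume.real ball₁) := by
    rwa [ofReal_integral_eq_lintegral_ofReal hint (Eventually.of_forall fun x => hnn _)]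
  have h4 : 0 ≤ P + C * volume.real ball₁ := by
    refine ge_of_tendsto' (hP.add_const _) fun n => ?_
    rw [← e1]
    exact integral_nonneg fun x => hnn _
  rw [ENNReal.ofReal_le_ofReal_iff h4, integral_add hint' (integrable_const C)] at h3
  simp only [integral_const, smul_eq_mul, measureReal_restrict_apply_univ] at h3
  linarith

theorem exists_subseq_ae_tendsto_fin {ι α F : Type*} [Finite ι] [MeasurableSpace α] {ν : Measure α}
    [NormedAddCommGroup F] [InnerProductSpace ℝ F] {f : ι → ℕ → α → F} {g : ι → α → F}
    (hf : ∀ k m, MemLp (f k m) 2 ν) (hg : ∀ k, MemLp (g k) 2 ν)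
    (h : ∀ k, Tendsto (fun m => ∫ x, ‖f k m x - g k x‖ ^ 2 ∂ν) atTop (𝓝 0)) :
    ∃ φ : ℕ → ℕ, StrictMono φ ∧ ∀ᵐ x ∂ν, ∀ k, Tendsto (fun m => f k (φ m) x) atTop (𝓝 (g k x)) := by
  classical
  have := Fintype.ofFinite ι
  suffices h : ∀ s : Finset ι, ∃ φ : ℕ → ℕ, StrictMono φ ∧ ∀ k ∈ s,
      ∀ᵐ x ∂ν, Tendsto (fun m => f k (φ m) x) atTop (𝓝 (g k x)) by
    obtain ⟨φ, hφ, h⟩ := h Finset.univ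
    exact ⟨φ, hφ, ae_all_iff.2 fun k => h k (Finset.mem_univ k)⟩
  intro s
  induction s using Finset.induction_on with
  | empty => exact ⟨id, strictMono_id, by simp⟩
  | insert k s _ ih =>
    obtain ⟨φ, hφ, h1⟩ := ih
    obtain ⟨ψ, hψ, h'⟩ := exists_subseq_ae_tendsto (fun m => hf k (φ m)) (hg k)
      ((h k).comp hφ.tendsto_atTop)
    refine ⟨φ ∘ ψ, hφ.comp hψ, fun l hl => ?_⟩
    rcases Finset.mem_insert.1 hl with rfl | hl
    · exact h'
    · filter_upwards [h1 l hl] with x hx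
      exact hx.comp hψ.tendsto_atTop

theorem tendsto_integral_norm_sq {α F : Type*} [MeasurableSpace α] {ν : Measure α}
    [NormedAddCommGroup F] [InnerProductSpace ℝ F] {f : ℕ → α → F} {g : α → F}
    (hf : ∀ m, MemLp (f m) 2 ν) (hg : MemLp g 2 ν)
    (h : Tendsto (fun m => ∫ x, ‖f m x - g x‖ ^ 2 ∂ν) atTop (𝓝 0)) :
    Tendsto (fun m => ∫ x, ‖f m x‖ ^ 2 ∂ν) atTop (𝓝 (∫ x, ‖g x‖ ^ 2 ∂ν)) := by
  have h1 : Tendsto (fun m => (hf m).toLp (f m)) atTop (𝓝 (hg.toLp g)) := by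
    rw [tendsto_iff_norm_sub_tendsto_zero]
    have := h.sqrt
    rw [Real.sqrt_zero] at this
    refine this.congr fun m => ?_
    rw [← norm_toLp_sub_sq (hf m) hg, Real.sqrt_sq (norm_nonneg _)]
  simpa only [norm_toLp_sq] using h1.norm.pow 2

/-- The energy attains its minimum over every closed convex obstacle class that contains the
competitor. -/
theorem exists_isMinimizer (ha : 0 < a) (hμ : 0 < μ) {C : Set ℝ} (hC : Convex ℝ C)
    (hCc : IsClosed C) (hC0 : -1 / 2 * H a ∈ C) : ∃ w, IsMinimizer a μ (Obst a μ C) w := by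
  obtain ⟨I, w, V, G, hI, hE, hw, hr, hVc, hGc⟩ := exists_minimizing_seq (μ := μ) ha hμ hC hC0
  have := fun k => exists_isH10_limit (fun n => (hr n).isH10 k) (hVc k) (hGc k)
  choose V' G' hH hVt hGt using this
  obtain ⟨φ, hφ, hVae⟩ := exists_subseq_ae_tendsto_fin (f := fun k n => V n k)
    (fun k n => ((hr n).isH10 k).memLp) (fun k => (hH k).memLp)
    (by simpa only [Real.norm_eq_abs, sq_abs] using hVt)
  set w' : E 3 → E 5 := fun x => WithLp.toLp 2 fun k => comp a k x + V' k x with hw'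
  have hrep : IsRep a w' V' G' := ⟨hH, fun k => Eventually.of_forall fun x => rfl⟩
  have hcomp : ∀ᵐ x ∂volume.restrict ball₁, ∀ k,
      Tendsto (fun n => w (φ n) x k) atTop (𝓝 (w' x k)) := by
    filter_upwards [ae_restrict_of_ae hVae, ae_all_iff.2 fun n => ae_all_iff.2 (hr n).eq_add]
      with x hx hx' k
    exact ((hx k).const_add (comp a k x)).congr fun n => (hx' (φ n) k).symm
  have hlim : ∀ᵐ x ∂volume.restrict ball₁, Tendsto (fun n => w (φ n) x) atTop (𝓝 (w' x)) := by
    filter_upwards [hcomp] with x hx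
    have h1 := tendsto_pi_nhds.2 hx
    exact ((PiLp.continuous_toLp 2 (fun _ : Fin 5 => ℝ)).tendsto _).comp h1
  have hax : IsRAxial w' := isRAxial_of_tendsto (fun n => (hw (φ n)).1.2) hcomp
  have hp := fun n => Obst.integrable_pot hμ (hw n) (hr n)
  have hgrad : ∀ k, Tendsto (fun n => ∫ x in ball₁, ‖grd (comp a k) x + G (φ n) k x‖ ^ 2) atTop
      (𝓝 (∫ x in ball₁, ‖grd (comp a k) x + G' k x‖ ^ 2)) := fun k => by
    refine tendsto_integral_norm_sq (fun n => memLp_grd_add (hr (φ n)) k) (memLp_grd_add hrep k) ?_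
    refine squeeze_zero (fun n => integral_nonneg fun x => sq_nonneg _) (fun n => ?_)
      ((hGt k).comp hφ.tendsto_atTop)
    simp only [add_sub_add_left_eq_sub]
    exact setIntegral_le_integral (((hr (φ n)).isH10 k).memLp_grad.sub
      (hH k).memLp_grad).norm.integrable_sq (Eventually.of_forall fun x => sq_nonneg _)
  -- Energies and Dirichlet integrals both converge, so the integrals of the potential converge too.
  -- Their limit is the bound needed from Fatou's lemma.
  have hPt : Tendsto (fun n => ∫ x in ball₁, pot a (w (φ n) x)) atTop
      (𝓝 (μ⁻¹ * (I - ∑ k, ∫ x in ball₁, ‖grd (comp a k) x + G' k x‖ ^ 2))) := by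
    refine ((((hE.comp hφ.tendsto_atTop).sub
      (tendsto_finsetSum Finset.univ fun k _ => hgrad k)).const_mul μ⁻¹)).congr fun n => ?_
    simp only [Function.comp_apply]
    rw [(hr (φ n)).energy_eq (hp _), add_sub_cancel_left, inv_mul_cancel_left₀ hμ.ne']
  obtain ⟨hp', hple⟩ := integrable_pot_of_tendsto ha hrep.aestronglyMeasurable
    (fun n => hp (φ n)) hlim hPt
  have hE' : energy a μ w' ≤ I := by
    rw [hrep.energy_eq hp']
    have h1 := mul_le_mul_of_nonneg_left hple hμ.le
    rw [mul_inv_cancel_left₀ hμ.ne'] at h1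
    linarith
  obtain ⟨ψ, hψ, htr⟩ := exists_subseq_flatTrace (fun n => (hr n).isH10_cut) hrep.isH10_cut (by
    simpa only [add_sub_add_left_eq_sub] using hGt 2)
  refine ⟨w', ⟨⟨hrep.memF hp' hax.exists_isAug, hax⟩, _, hrep.hasTraceOnT, ?_⟩, fun w'' hw'' =>
    hE'.trans (hI _ hw'')⟩
  -- Membership provides some trace with values in `C`. By uniqueness it agrees almost everywhere
  -- with the explicit one, for which convergence is known.
  have htn : ∀ n, ∀ᵐ x ∂flatMeasure, flatTrace (fun x => grd (compCut a) x + G n 2 x) x ∈ C :=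
    fun n => by
      obtain ⟨t, ht, htC⟩ := (hw n).2
      filter_upwards [ht.ae_eq (hr n).hasTraceOnT, htC] with x hx hx'
      rwa [← hx]
  filter_upwards [htr, ae_all_iff.2 htn] with x hx hx'
  exact hCc.mem_of_tendsto hx (Eventually.of_forall fun n => hx' (ψ n))

end Existence

/-! ### Cylindrical coordinates -/

section Cylindrical

open Filter Topology

/-- The half plane `ρ > 0`. -/
def rightHalf : Set (E 2) := {p | 0 < p 0}

theorem isOpen_rightHalf : IsOpen rightHalf :=
  isOpen_lt continuous_const (contDiff_coord (n := 2) 0).continuous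

/-- The measure `ρ dρ dz` on the half plane `ρ > 0`. -/
noncomputable def halfMeasure : Measure (E 2) :=
  (volume.restrict rightHalf).withDensity fun p => ENNReal.ofReal (p 0)

/-- The measure `dθ` on `(-π, π)`. -/
noncomputable def angleMeasure : Measure ℝ := volume.restrict (Ioo (-Real.pi) Real.pi)

instance : IsFiniteMeasure angleMeasure :=
  ⟨by simp [angleMeasure]⟩

instance : SFinite halfMeasure := by unfold halfMeasure; infer_instance

theorem angleMeasure_real_univ : angleMeasure.real univ = 2 * Real.pi := by
  rw [angleMeasure, measureReal_restrict_apply_univ, Real.volume_real_Ioo_of_le] <;>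
    linarith [Real.pi_pos]

/-- The point with the cylindrical coordinates `(ρ, z)` and `θ`. -/
noncomputable def cyl (q : E 2 × ℝ) : E 3 := !₂[q.1 0 * Real.cos q.2, q.1 0 * Real.sin q.2, q.1 1]

theorem continuous_cyl : Continuous cyl := by
  refine (PiLp.continuous_toLp 2 _).comp (continuous_pi fun j => ?_)
  have h := fun j => (contDiff_coord (n := 2) j).continuous.comp (continuous_fst (Y := ℝ))
  have h2 : Continuous fun q : E 2 × ℝ => q.2 := continuous_snd
  fin_cases j
  · exact (h 0).mul (Real.continuous_cos.comp h2)
  · exact (h 0).mul (Real.continuous_sin.comp h2)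
  · exact h 1

theorem measurable_coord {n : ℕ} (j : Fin n) : Measurable fun x : E n => x j :=
  (contDiff_coord j).continuous.measurable

/-- Both sides are sliced at fixed height `z`; on each horizontal plane the claim is the polar
coordinate formula, whose factor `ρ` is carried by `halfMeasure`. -/
theorem measurePreserving_cyl : MeasurePreserving cyl (halfMeasure.prod angleMeasure) volume := by
  refine ⟨continuous_cyl.measurable, Measure.ext_of_lintegral _ fun f hf => ?_⟩
  have hfc : Measurable fun q => f (cyl q) := hf.comp continuous_cyl.measurable
  rw [lintegral_map hf continuous_cyl.measurable, lintegral_prod _ hfc.aemeasurable, halfMeasure,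
    lintegral_withDensity_eq_lintegral_mul _ (measurable_coord 0).ennreal_ofReal
      hfc.lintegral_prod_right', ← lintegral_indicator isOpen_rightHalf.measurableSet,
    ← measurePreserving_pairEquiv.lintegral_comp_emb pairEquiv.measurableEmbedding,
    ← measurePreserving_heightEquiv.lintegral_comp_emb heightEquiv.measurableEmbedding]
  have hL : Measurable fun p : ℝ × ℝ => rightHalf.indicator
      ((fun p : E 2 => ENNReal.ofReal (p 0)) * fun p => ∫⁻ θ, f (cyl (p, θ)) ∂angleMeasure)
        (pairEquiv p) :=
    (((measurable_coord 0).ennreal_ofReal.mul hfc.lintegral_prod_right').indicator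
      isOpen_rightHalf.measurableSet).comp pairEquiv.measurable
  have hR : Measurable fun q => f (heightEquiv q) := hf.comp heightEquiv.measurable
  rw [Measure.volume_eq_prod, lintegral_prod_symm' _ hL, Measure.volume_eq_prod,
    lintegral_prod_symm' _ hR]
  refine lintegral_congr fun z => ?_
  rw [← measurePreserving_pairEquiv.lintegral_comp_emb pairEquiv.measurableEmbedding,
    ← lintegral_comp_polarCoord_symm, polarCoord_target, Measure.volume_eq_prod,
    ← Measure.prod_restrict]
  have hm : Measurable fun p : ℝ × ℝ =>
      ENNReal.ofReal p.1 • f (heightEquiv (pairEquiv (polarCoord.symm p), z)) := by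
    have h1 : Measurable fun p : ℝ × ℝ => (polarCoord.symm p : ℝ × ℝ) :=
      continuous_polarCoord_symm.measurable
    exact measurable_fst.ennreal_ofReal.smul (hf.comp (heightEquiv.measurable.comp
      ((pairEquiv.measurable.comp h1).prodMk measurable_const)))
  rw [lintegral_prod _ hm.aemeasurable, ← lintegral_indicator measurableSet_Ioi]
  refine lintegral_congr fun r => ?_
  by_cases hr : 0 < r
  · have h1 : pairEquiv (r, z) ∈ rightHalf := by simpa [rightHalf, pairEquiv_apply] using hr
    rw [indicator_of_mem h1, indicator_of_mem (mem_Ioi.2 hr)]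
    simp only [Pi.mul_apply, smul_eq_mul]
    rw [lintegral_const_mul _ (by
      have h2 : Measurable fun θ => (polarCoord.symm (r, θ) : ℝ × ℝ) :=
        (continuous_polarCoord_symm.comp (continuous_const.prodMk continuous_id)).measurable
      exact hf.comp (heightEquiv.measurable.comp
        ((pairEquiv.measurable.comp h2).prodMk measurable_const)))]
    rw [angleMeasure]
    simp [pairEquiv_apply, heightEquiv_apply, cyl, polarCoord_symm_apply]
  · have h1 : pairEquiv (r, z) ∉ rightHalf := by simpa [rightHalf, pairEquiv_apply] using hr
    rw [indicator_of_notMem h1, indicator_of_notMem (by simpa using hr)]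

theorem ae_halfMeasure {q : E 2 → Prop} :
    (∀ᵐ p ∂halfMeasure, q p) ↔ ∀ᵐ p ∂volume.restrict rightHalf, q p := by
  rw [halfMeasure, ae_withDensity_iff (measurable_coord 0).ennreal_ofReal,
    ae_restrict_iff' isOpen_rightHalf.measurableSet, ae_restrict_iff' isOpen_rightHalf.measurableSet]
  refine eventually_congr (Eventually.of_forall fun p => ?_)
  refine forall_congr' fun (hp : 0 < p 0) => ?_
  simp [hp]

theorem integral_halfMeasure (h : E 2 → ℝ) :
    ∫ p, h p ∂halfMeasure = ∫ p in rightHalf, p 0 * h p := by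
  rw [halfMeasure, integral_withDensity_eq_integral_toReal_smul
    (measurable_coord 0).ennreal_ofReal (by simp)]
  refine setIntegral_congr_fun isOpen_rightHalf.measurableSet fun p (hp : 0 < p 0) => ?_
  simp [hp.le]

theorem integrable_halfMeasure {h : E 2 → ℝ} :
    Integrable h halfMeasure ↔ IntegrableOn (fun p => p 0 * h p) rightHalf := by
  rw [halfMeasure, integrable_withDensity_iff_integrable_smul'
    (measurable_coord 0).ennreal_ofReal (by simp)]
  refine integrable_congr ?_
  filter_upwards [ae_restrict_mem isOpen_rightHalf.measurableSet] with p hp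
  have hp : 0 < p 0 := hp
  simp [hp.le]

/-- Away from the axis the weight `ρ` is locally bounded below, so dividing by it costs nothing
locally. -/
theorem locallyIntegrableOn_of_halfMeasure {h : E 2 → ℝ} (hh : Integrable h halfMeasure) :
    LocallyIntegrableOn h rightHalf := by
  have h1 := (integrable_halfMeasure.1 hh).locallyIntegrableOn
  have h2 : ContinuousOn (fun p : E 2 => (p 0)⁻¹) rightHalf := fun p hp =>
    ((contDiff_coord (n := 2) 0).continuous.continuousAt.inv₀ (ne_of_gt hp)).continuousWithinAt
  have h3 := h1.continuousOn_mul h2 isOpen_rightHalf.isLocallyClosed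
  refine locallyIntegrableOn_congr h3 ?_
  filter_upwards [ae_restrict_mem isOpen_rightHalf.measurableSet] with p hp
  rw [inv_mul_cancel_left₀ (ne_of_gt hp)]

theorem meridian_cyl {p : E 2} {θ : ℝ} (hp : 0 ≤ p 0) : meridian (cyl (p, θ)) = p := by
  have : (p 0 * Real.cos θ) ^ 2 + (p 0 * Real.sin θ) ^ 2 = p 0 ^ 2 := by
    linear_combination p 0 ^ 2 * Real.sin_sq_add_cos_sq θ
  ext j
  fin_cases j
  · simp [meridian, cyl, this, hp]
  · simp [meridian, cyl]

theorem ae_cyl : ∀ᵐ q ∂halfMeasure.prod angleMeasure, meridian (cyl q) = q.1 := by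
  have h1 : ∀ᵐ p ∂halfMeasure, 0 < p 0 :=
    ae_halfMeasure.2 (ae_restrict_mem isOpen_rightHalf.measurableSet)
  filter_upwards [Measure.quasiMeasurePreserving_fst.ae h1] with q hq
  exact meridian_cyl hq.le

/-- The angular mean. -/
noncomputable def avg (F : E 3 → ℝ) (p : E 2) : ℝ :=
  (2 * Real.pi)⁻¹ * ∫ θ, F (cyl (p, θ)) ∂angleMeasure

theorem integrable_comp_cyl {F : E 3 → ℝ} (hF : Integrable F) :
    Integrable (fun q => F (cyl q)) (halfMeasure.prod angleMeasure) :=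
  measurePreserving_cyl.integrable_comp_of_integrable hF

theorem integrable_avg {F : E 3 → ℝ} (hF : Integrable F) : Integrable (avg F) halfMeasure :=
  (integrable_comp_cyl hF).integral_prod_left.const_mul _

theorem integral_eq_integral_avg {F : E 3 → ℝ} (hF : Integrable F) :
    ∫ x, F x = 2 * Real.pi * ∫ p in rightHalf, p 0 * avg F p := by
  have hπ := Real.pi_pos
  rw [← integral_halfMeasure]
  simp only [avg]
  rw [integral_const_mul, mul_inv_cancel_left₀ (by positivity),
    ← integral_prod _ (integrable_comp_cyl hF), ← measurePreserving_cyl.map_eq,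
    integral_map continuous_cyl.measurable.aemeasurable]
  rw [measurePreserving_cyl.map_eq]
  exact hF.1

theorem avg_mul_meridian (F : E 3 → ℝ) (ψ : E 2 → ℝ) {p : E 2} (hp : 0 ≤ p 0) :
    avg (fun x => F x * ψ (meridian x)) p = avg F p * ψ p := by
  simp only [avg, meridian_cyl hp, integral_mul_const, mul_assoc]

/-- Integration of the product with an axially symmetric function. -/
theorem integral_mul_meridian {F : E 3 → ℝ} {ψ : E 2 → ℝ}
    (hF : Integrable fun x => F x * ψ (meridian x)) :
    ∫ x, F x * ψ (meridian x) = 2 * Real.pi * ∫ p in rightHalf, p 0 * (avg F p * ψ p) := by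
  rw [integral_eq_integral_avg hF]
  congr 1
  refine setIntegral_congr_fun isOpen_rightHalf.measurableSet fun p (hp : 0 < p 0) => ?_
  simp only
  rw [avg_mul_meridian _ _ hp.le]

/-- The profile `u` in the definition of axial symmetry comes without any measurability. It acquires
it by agreeing almost everywhere with an angular mean. -/
theorem avg_ae_eq {F : E 3 → ℝ} {u : E 2 → ℝ} (h : ∀ᵐ x, F x = u (meridian x)) :
    ∀ᵐ p ∂volume.restrict rightHalf, avg F p = u p := by
  rw [← ae_halfMeasure]
  have h1 : ∀ᵐ q ∂halfMeasure.prod angleMeasure, F (cyl q) = u q.1 := by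
    filter_upwards [measurePreserving_cyl.quasiMeasurePreserving.ae h, ae_cyl] with q hq hq'
    rw [hq, hq']
  filter_upwards [Measure.ae_ae_of_ae_prod h1] with p hp
  have hπ := Real.pi_pos
  rw [avg, integral_congr_ae hp, integral_const, angleMeasure_real_univ, smul_eq_mul,
    inv_mul_cancel_left₀ (by positivity)]

/-- Jensen's inequality on almost every circle; it transfers square integrability from the ball to
the profile. -/
theorem avg_sq_le {F : E 3 → ℝ} (hF : MemLp F 2) :
    ∀ᵐ p ∂halfMeasure, avg F p ^ 2 ≤ avg (fun x => F x ^ 2) p := by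
  have hm : AEStronglyMeasurable (fun q => F (cyl q)) (halfMeasure.prod angleMeasure) :=
    hF.1.comp_measurePreserving measurePreserving_cyl
  filter_upwards [(integrable_comp_cyl hF.integrable_sq).prod_right_ae, hm.prodMk_left] with p h1 h2
  have hπ := Real.pi_pos
  have h3 : MemLp (fun θ => F (cyl (p, θ))) 2 angleMeasure := (memLp_two_iff_integrable_sq h2).2 h1
  have h4 := sq_integral_le h3
  rw [angleMeasure_real_univ] at h4
  rw [avg, avg, mul_pow, sq (2 * Real.pi)⁻¹, mul_assoc]
  refine mul_le_mul_of_nonneg_left ?_ (by positivity)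
  rwa [inv_mul_le_iff₀ (by positivity)]

theorem integrable_avg_sq {F : E 3 → ℝ} (hF : MemLp F 2) (hF1 : Integrable F) :
    Integrable (fun p => avg F p ^ 2) halfMeasure := by
  refine (integrable_avg hF.integrable_sq).mono' ((integrable_avg hF1).1.pow 2) ?_
  filter_upwards [avg_sq_le hF] with p hp
  rwa [Real.norm_of_nonneg (sq_nonneg _)]

end Cylindrical

/-! ### Axially symmetric test functions -/

section AxialTest

open Filter Topology

theorem IsTest.contDiffOn_mul {n : ℕ} {U : Set (E n)} {φ g : E n → ℝ} (hU : IsOpen U)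
    (h : IsTest U φ) (hg : ContDiffOn ℝ ∞ g U) : IsTest U fun x => g x * φ x := by
  refine ⟨contDiff_iff_contDiffAt.2 fun x => ?_, h.2.1.mul_left,
    (tsupport_mul_subset_right (f := g) (g := φ)).trans h.2.2⟩
  by_cases hx : x ∈ tsupport φ
  · exact ((hg x (h.2.2 hx)).contDiffAt (hU.mem_nhds (h.2.2 hx))).mul h.1.contDiffAt
  · refine contDiffAt_const (c := (0 : ℝ)) |>.congr_of_eventuallyEq ?_
    filter_upwards [notMem_tsupport_iff_eventuallyEq.1 hx] with y hy
    rw [hy]; simp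

theorem contDiffAt_meridian {x : E 3} (hx : 0 < meridian x 0) : ContDiffAt ℝ ∞ meridian x := by
  have h0 := contDiff_coord (n := 3) 0
  have h1 := contDiff_coord (n := 3) 1
  refine contDiffAt_euclidean.2 fun j => ?_
  fin_cases j
  · refine ((h0.pow 2).add (h1.pow 2)).contDiffAt.sqrt ?_
    rw [← meridian_zero_sq]; positivity
  · exact (contDiff_coord 2).contDiffAt

/-- `meridian` is smooth off the axis, near which the composition vanishes. The support is compact
because `meridian` preserves the norm. -/
theorem IsTest.comp_meridian {U : Set (E 2)} {ψ : E 2 → ℝ} (hU : U ⊆ rightHalf) (h : IsTest U ψ) :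
    IsTest (meridian ⁻¹' U) fun x => ψ (meridian x) := by
  have hts : tsupport (fun x => ψ (meridian x)) ⊆ meridian ⁻¹' tsupport ψ :=
    tsupport_comp_subset_preimage ψ continuous_meridian
  refine ⟨contDiff_iff_contDiffAt.2 fun x => ?_, ?_, hts.trans (preimage_mono h.2.2)⟩
  · by_cases hx : meridian x ∈ tsupport ψ
    · exact h.1.contDiffAt.comp x (contDiffAt_meridian (hU (h.2.2 hx)))
    · refine contDiffAt_const (c := (0 : ℝ)) |>.congr_of_eventuallyEq ?_
      exact continuous_meridian.continuousAt.eventually (notMem_tsupport_iff_eventuallyEq.1 hx)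
  · obtain ⟨r, hr⟩ := h.2.1.isBounded.subset_closedBall 0
    refine HasCompactSupport.of_support_subset_isCompact (isCompact_closedBall (0 : E 3) r)
      fun x hx => ?_
    have := hr (subset_tsupport ψ hx)
    rwa [mem_closedBall_zero_iff, norm_meridian, ← mem_closedBall_zero_iff] at this

theorem pd_meridian_zero {x : E 3} (hx : 0 < meridian x 0) (i : Fin 3) :
    pd i (fun y => meridian y 0) x = if i = 2 then 0 else x i / meridian x 0 := by
  have hx' : 0 < x 0 ^ 2 + x 1 ^ 2 := by rw [← meridian_zero_sq]; positivity
  have hd := fun j => (contDiff_coord (n := 3) j).differentiable (by simp) x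
  have h1 : pd i (fun y : E 3 => y 0 ^ 2 + y 1 ^ 2) x
      = 2 * x 0 * (if i = 0 then 1 else 0) + 2 * x 1 * (if i = 1 then 1 else 0) := by
    rw [pd_add ((hd 0).fun_pow 2) ((hd 1).fun_pow 2)]
    simp_rw [sq]
    rw [pd_mul (hd 0) (hd 0), pd_mul (hd 1) (hd 1), pd_coord, pd_coord]
    ring
  have h2 := pd_comp (i := i) (f := fun y : E 3 => y 0 ^ 2 + y 1 ^ 2) (g := Real.sqrt) (x := x)
    (((hd 0).fun_pow 2).fun_add ((hd 1).fun_pow 2)) (Real.hasDerivAt_sqrt hx'.ne').differentiableAt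
  rw [show (fun y => meridian y 0) = fun y : E 3 => Real.sqrt (y 0 ^ 2 + y 1 ^ 2) from rfl, h2, h1,
    (Real.hasDerivAt_sqrt hx'.ne').deriv, ← meridian_zero]
  fin_cases i <;> simp <;> field_simp

theorem pd_meridian_one (x : E 3) (i : Fin 3) :
    pd i (fun y => meridian y 1) x = if i = 2 then 1 else 0 := pd_coord

theorem pd_comp_meridian_of_pos {ψ : E 2 → ℝ} (h : Differentiable ℝ ψ) {x : E 3}
    (hx : 0 < meridian x 0) (i : Fin 3) : pd i (fun y => ψ (meridian y)) x =
      if i = 2 then pd 1 ψ (meridian x) else x i / meridian x 0 * pd 0 ψ (meridian x) := by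
  have hm : DifferentiableAt ℝ meridian x := (contDiffAt_meridian hx).differentiableAt (by simp)
  have hc : ∀ j, fderiv ℝ meridian x (EuclideanSpace.single i 1) j
      = pd i (fun y => meridian y j) x := fun j => by
    have := ((EuclideanSpace.proj (𝕜 := ℝ) j).hasFDerivAt.comp x hm.hasFDerivAt).fderiv
    rw [pd, show (fun y => meridian y j) = EuclideanSpace.proj (𝕜 := ℝ) j ∘ meridian from rfl, this]
    rfl
  rw [pd, show (fun y => ψ (meridian y)) = ψ ∘ meridian from rfl, fderiv_comp x (h _) hm,
    ContinuousLinearMap.comp_apply, fderiv_apply_eq_sum, Fin.sum_univ_two, hc, hc,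
    pd_meridian_zero hx, pd_meridian_one]
  split_ifs <;> simp

theorem pd_comp_meridian {ψ : E 2 → ℝ} (h : IsTest rightHalf ψ) (x : E 3) (i : Fin 3) :
    pd i (fun y => ψ (meridian y)) x =
      if i = 2 then pd 1 ψ (meridian x) else x i / meridian x 0 * pd 0 ψ (meridian x) := by
  by_cases hx : 0 < meridian x 0
  · exact pd_comp_meridian_of_pos h.differentiable hx i
  · rw [(h.pd 1).eq_zero_of_notMem hx, (h.pd 0).eq_zero_of_notMem hx,
      ((h.comp_meridian subset_rfl).pd i).eq_zero_of_notMem hx]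
    simp

theorem contDiffOn_inv_pow (m : ℕ) : ContDiffOn ℝ ∞ (fun p : E 2 => ((p 0)⁻¹) ^ m) rightHalf :=
  ((contDiff_coord (n := 2) 0).contDiffOn.inv fun _ hp => ne_of_gt hp).pow m

theorem IsTest.inv_pow_mul {U : Set (E 2)} {ψ : E 2 → ℝ} (hU : U ⊆ rightHalf) (hUo : IsOpen U)
    (h : IsTest U ψ) (m : ℕ) : IsTest U fun p => ((p 0)⁻¹) ^ m * ψ p :=
  h.contDiffOn_mul hUo ((contDiffOn_inv_pow m).mono hU)

theorem pd_inv_pow_mul {ψ : E 2 → ℝ} (h : IsTest rightHalf ψ) (m : ℕ) (p : E 2) (i : Fin 2) :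
    pd i (fun p => ((p 0)⁻¹) ^ m * ψ p) p = ((p 0)⁻¹) ^ m * pd i ψ p
      - (if i = 0 then m * ((p 0)⁻¹) ^ (m + 1) * ψ p else 0) := by
  by_cases hp : 0 < p 0
  · have hd : DifferentiableAt ℝ (fun p : E 2 => p 0) p :=
      (contDiff_coord (n := 2) 0).differentiable (by simp) p
    have h1 : HasDerivAt (fun y : ℝ => (y⁻¹) ^ m) (m * (p 0)⁻¹ ^ (m - 1) * (-(p 0 ^ 2)⁻¹)) (p 0) :=
      (hasDerivAt_inv hp.ne').fun_pow m
    have h2 := pd_comp (i := i) (f := fun p : E 2 => p 0) (g := fun y => (y⁻¹) ^ m) hd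
      h1.differentiableAt
    have hd2 : DifferentiableAt ℝ (fun p : E 2 => ((p 0)⁻¹) ^ m) p :=
      (contDiffOn_inv_pow m).differentiableOn (by simp) p hp |>.differentiableAt
        (isOpen_rightHalf.mem_nhds hp)
    rw [pd_mul hd2 h.differentiableAt, h2, h1.deriv, pd_coord]
    split_ifs
    · rcases m with _ | m
      · simp
      · simp only [Nat.add_sub_cancel, inv_pow]
        field_simp
        ring
    · ring
  · rw [h.eq_zero_of_notMem hp, (h.pd i).eq_zero_of_notMem hp,
      ((h.inv_pow_mul subset_rfl isOpen_rightHalf m).pd i).eq_zero_of_notMem hp]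
    simp

/-- The angular derivative of `augPoly`. -/
noncomputable def augPerp (k : Fin 5) (x : E 3) : ℝ :=
  ![-(2 * x 0 * x 1) * 2, 2 * (x 0 ^ 2 - x 1 ^ 2), 0, -x 1, x 0] k

theorem contDiff_augPerp (k : Fin 5) : ContDiff ℝ ∞ (augPerp k) := by
  have h0 := contDiff_coord (n := 3) 0
  have h1 := contDiff_coord (n := 3) 1
  fin_cases k
  · exact ((contDiff_const.mul h0).mul h1).neg.mul contDiff_const
  · exact contDiff_const.mul ((h0.pow 2).sub (h1.pow 2))
  · exact contDiff_const
  · exact h1.neg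
  · exact h0

theorem pd_augPoly (k : Fin 5) (i : Fin 3) (x : E 3) : pd i (augPoly k) x =
    ![![2 * x 0, -2 * x 1, 0], ![2 * x 1, 2 * x 0, 0], ![0, 0, 0], ![1, 0, 0], ![0, 1, 0]] k i := by
  have hd := fun j => (contDiff_coord (n := 3) j).differentiable (by simp) x
  fin_cases k
  · rw [show augPoly _ = fun x => x 0 * x 0 - x 1 * x 1 by ext; simp [augPoly, sq],
      pd_sub ((hd 0).fun_mul (hd 0)) ((hd 1).fun_mul (hd 1)), pd_mul (hd 0) (hd 0), pd_mul (hd 1) (hd 1),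
      pd_coord, pd_coord]
    fin_cases i <;> simp <;> ring
  · rw [show augPoly _ = fun x => 2 * (x 0 * x 1) by ext; simp [augPoly]; ring,
      pd_const_mul _ ((hd 0).fun_mul (hd 1)), pd_mul (hd 0) (hd 1), pd_coord, pd_coord]
    fin_cases i <;> simp
  · rw [show augPoly _ = fun _ => 1 from rfl, pd_const]
    fin_cases i <;> simp
  · rw [show augPoly _ = fun x => x 0 from rfl, pd_coord]
    fin_cases i <;> simp
  · rw [show augPoly _ = fun x => x 1 from rfl, pd_coord]
    fin_cases i <;> simp

theorem pd_augPerp (k : Fin 5) (i : Fin 3) (x : E 3) : pd i (augPerp k) x =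
    ![![-4 * x 1, -4 * x 0, 0], ![4 * x 0, -4 * x 1, 0], ![0, 0, 0], ![0, -1, 0], ![1, 0, 0]] k i := by
  have hd := fun j => (contDiff_coord (n := 3) j).differentiable (by simp) x
  fin_cases k
  · rw [show augPerp _ = fun x => -4 * (x 0 * x 1) by ext; simp [augPerp]; ring,
      pd_const_mul _ ((hd 0).fun_mul (hd 1)), pd_mul (hd 0) (hd 1), pd_coord, pd_coord]
    fin_cases i <;> simp
  · rw [show augPerp _ = fun x => 2 * (x 0 * x 0 - x 1 * x 1) by ext; simp [augPerp, sq],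
      pd_const_mul _ (((hd 0).fun_mul (hd 0)).fun_sub ((hd 1).fun_mul (hd 1))),
      pd_sub ((hd 0).fun_mul (hd 0)) ((hd 1).fun_mul (hd 1)), pd_mul (hd 0) (hd 0), pd_mul (hd 1) (hd 1),
      pd_coord, pd_coord]
    fin_cases i <;> simp <;> ring
  · rw [show augPerp _ = fun _ => 0 from rfl, pd_const]
    fin_cases i <;> simp
  · rw [show augPerp _ = fun x => (-1) * x 1 by ext; simp [augPerp], pd_const_mul _ (hd 1), pd_coord]
    fin_cases i <;> simp
  · rw [show augPerp _ = fun x => x 0 from rfl, pd_coord]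
    fin_cases i <;> simp

/-- The homogeneity of `augPoly`. -/
theorem augPoly_euler (k : Fin 5) (x : E 3) :
    x 0 * pd 0 (augPoly k) x + x 1 * pd 1 (augPoly k) x = augDeg (augIdx k) * augPoly k x := by
  rw [pd_augPoly, pd_augPoly]
  fin_cases k <;> simp [augPoly, augDeg, augIdx] <;> ring

theorem augPoly_perp (k : Fin 5) (x : E 3) :
    x 0 * pd 1 (augPoly k) x - x 1 * pd 0 (augPoly k) x = augPerp k x := by
  rw [pd_augPoly, pd_augPoly]
  fin_cases k <;> simp [augPerp] <;> ring

theorem augPerp_perp (k : Fin 5) (x : E 3) :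
    x 0 * pd 1 (augPerp k) x - x 1 * pd 0 (augPerp k) x
      = -(augDeg (augIdx k) : ℝ) ^ 2 * augPoly k x := by
  rw [pd_augPerp, pd_augPerp]
  fin_cases k <;> simp [augPoly, augDeg, augIdx] <;> ring

theorem pd_two_augPoly (k : Fin 5) (x : E 3) : pd 2 (augPoly k) x = 0 := by
  rw [pd_augPoly]; fin_cases k <;> rfl

/-- The test function `(k-th trigonometric factor) * ρ⁻ᵐ ψ(ρ, z)`. -/
noncomputable def axTest (m : ℕ) (k : Fin 5) (ψ : E 2 → ℝ) (x : E 3) : ℝ :=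
  augPoly k x * (((meridian x 0)⁻¹) ^ (augDeg (augIdx k) + m) * ψ (meridian x))

variable {U : Set (E 2)} {ψ : E 2 → ℝ}

theorem isTest_axTest (hU : U ⊆ rightHalf) (hUo : IsOpen U) (h : IsTest U ψ) (m : ℕ) (k : Fin 5) :
    IsTest (meridian ⁻¹' U) (axTest m k ψ) :=
  ((h.inv_pow_mul hU hUo _).comp_meridian hU).mul_left (contDiff_augPoly k)

/-- The definition with a polynomial and powers of `ρ` is visibly smooth and is used for
derivatives. This form is used under angular integrals, where the discontinuity of `azimuth` does no
harm. -/
theorem axTest_eq (h : IsTest rightHalf ψ) (m : ℕ) (k : Fin 5) (x : E 3) :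
    axTest m k ψ x = augTrig k (azimuth x) * (((meridian x 0)⁻¹) ^ m * ψ (meridian x)) := by
  by_cases hx : 0 < meridian x 0
  · rw [axTest, augPoly_eq, pow_add, inv_pow (meridian x 0) (augDeg _)]
    field_simp
  · rw [axTest, h.eq_zero_of_notMem hx]; simp

theorem pd_two_axTest (h : IsTest rightHalf ψ) (m : ℕ) (k : Fin 5) (x : E 3) :
    pd 2 (axTest m k ψ) x = axTest m k (pd 1 ψ) x := by
  have h1 := h.inv_pow_mul subset_rfl isOpen_rightHalf (augDeg (augIdx k) + m)
  rw [show axTest m k ψ = fun x => augPoly k x *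
    (((meridian x 0)⁻¹) ^ (augDeg (augIdx k) + m) * ψ (meridian x)) from rfl,
    pd_mul ((contDiff_augPoly k).differentiable (by simp) x)
      (h1.comp_meridian subset_rfl).differentiableAt, pd_comp_meridian h1, pd_inv_pow_mul h,
    pd_two_augPoly, axTest]
  simp

theorem pd_axTest (h : IsTest rightHalf ψ) (m : ℕ) (k : Fin 5) (x : E 3) {i : Fin 3} (hi : i ≠ 2) :
    pd i (axTest m k ψ) x = augPoly k x * (x i / meridian x 0 *
        (((meridian x 0)⁻¹) ^ (augDeg (augIdx k) + m) * pd 0 ψ (meridian x)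
      - (augDeg (augIdx k) + m : ℕ) * ((meridian x 0)⁻¹) ^ (augDeg (augIdx k) + m + 1)
        * ψ (meridian x)))
      + pd i (augPoly k) x * (((meridian x 0)⁻¹) ^ (augDeg (augIdx k) + m) * ψ (meridian x)) := by
  have h1 := h.inv_pow_mul subset_rfl isOpen_rightHalf (augDeg (augIdx k) + m)
  rw [show axTest m k ψ = fun x => augPoly k x *
    (((meridian x 0)⁻¹) ^ (augDeg (augIdx k) + m) * ψ (meridian x)) from rfl,
    pd_mul ((contDiff_augPoly k).differentiable (by simp) x)
      (h1.comp_meridian subset_rfl).differentiableAt, pd_comp_meridian h1, if_neg hi, pd_inv_pow_mul h,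
    if_pos rfl]

/-- The radial derivative of a test function as a horizontal divergence. -/
theorem div_axTest (h : IsTest rightHalf ψ) (k : Fin 5) (x : E 3) :
    pd 0 (fun y => y 0 * axTest 2 k ψ y) x + pd 1 (fun y => y 1 * axTest 2 k ψ y) x
      = axTest 1 k (pd 0 ψ) x := by
  have hd := fun j => (contDiff_coord (n := 3) j).differentiable (by simp) x
  have ht := (isTest_axTest subset_rfl isOpen_rightHalf h 2 k).differentiableAt (x := x)
  rw [pd_mul (hd 0) ht, pd_mul (hd 1) ht, pd_coord, pd_coord, pd_axTest h _ _ _ (by decide),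
    pd_axTest h _ _ _ (by decide)]
  simp only [axTest, if_true]
  by_cases hx : 0 < meridian x 0
  -- The trigonometric factor is homogeneous of degree zero. Differentiating `ρ⁻²` produces `-2`,
  -- which cancels the divergence `2` of the field `(x₁, x₂)`; this is why the exponent on the left
  -- is `2`.
  · have he := augPoly_euler k x
    have hm := meridian_zero_sq x
    set r := meridian x 0
    have e1 : ∀ m, (r⁻¹) ^ (augDeg (augIdx k) + m) = (r⁻¹) ^ augDeg (augIdx k) * (r⁻¹) ^ m :=
      fun m => pow_add _ _ _
    rw [add_assoc, e1 2, e1 (2 + 1), e1 1]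
    push_cast
    generalize (r⁻¹) ^ augDeg (augIdx k) = A
    set n := (augDeg (augIdx k) : ℝ)
    field_simp
    linear_combination A * r ^ 2 * ψ (meridian x) * he
      - A * (r * pd 0 ψ (meridian x) - (n + 2) * ψ (meridian x)) * augPoly k x * hm
  · rw [h.eq_zero_of_notMem hx, (h.pd 0).eq_zero_of_notMem hx]; simp

end AxialTest

/-! ### The reduced profile and its weak gradient -/

section Reduction

open Filter Topology

theorem continuous_augTrig (k : Fin 5) : Continuous (augTrig k) := by
  have h2 : Continuous fun θ : ℝ => 2 * θ := continuous_const.mul continuous_id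
  fin_cases k
  · exact Real.continuous_cos.comp h2
  · exact Real.continuous_sin.comp h2
  · exact continuous_const
  · exact Real.continuous_cos
  · exact Real.continuous_sin

theorem abs_augTrig_le (k : Fin 5) (θ : ℝ) : |augTrig k θ| ≤ 1 := by
  fin_cases k
  · exact Real.abs_cos_le_one _
  · exact Real.abs_sin_le_one _
  · exact abs_one.le
  · exact Real.abs_cos_le_one _
  · exact Real.abs_sin_le_one _

theorem measurable_azimuth : Measurable azimuth := by
  have h : Continuous fun x : E 3 => (⟨x 0, x 1⟩ : ℂ) := by
    have h0 := (contDiff_coord (n := 3) 0).continuous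
    have h1 := (contDiff_coord (n := 3) 1).continuous
    exact Complex.equivRealProdCLM.symm.continuous.comp (h0.prodMk h1)
  exact Complex.measurable_arg.comp h.measurable

theorem memLp_mul_azimuth {f : E 3 → ℝ} {t : ℝ → ℝ} {p : ENNReal} (hf : MemLp f p)
    (ht : Continuous t) (h1 : ∀ θ, |t θ| ≤ 1) : MemLp (fun x => t (azimuth x) * f x) p := by
  refine hf.mono ((ht.measurable.comp measurable_azimuth).aestronglyMeasurable.mul hf.1)
    (Eventually.of_forall fun x => ?_)
  rw [norm_mul]
  exact mul_le_of_le_one_left (norm_nonneg _) (h1 _)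

/-- The `j`-th component of the profile of a field. -/
noncomputable def augProj (j : Fin 3) (f : Fin 5 → E 3 → ℝ) (x : E 3) : ℝ :=
  ∑ k with augIdx k = j, augTrig k (azimuth x) * f k x

theorem memLp_augProj {f : Fin 5 → E 3 → ℝ} {p : ENNReal} (hf : ∀ k, MemLp (f k) p) (j : Fin 3) :
    MemLp (augProj j f) p :=
  memLp_finsetSum _ fun k _ => memLp_mul_azimuth (hf k) (continuous_augTrig k) (abs_augTrig_le k)

theorem integrable_augProj {f : Fin 5 → E 3 → ℝ} (hf : ∀ k, Integrable (f k)) (j : Fin 3) :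
    Integrable (augProj j f) :=
  memLp_one_iff_integrable.1 (memLp_augProj (fun k => memLp_one_iff_integrable.2 (hf k)) j)

theorem augProj_augField (j : Fin 3) (u : E 2 → E 3) (x : E 3) :
    augProj j (fun k y => augField u y k) x = u (meridian x) j := by
  rw [augProj, Finset.sum_filter]
  exact sum_augTrig_sq _ _ _

theorem augProj_congr {j : Fin 3} {f f' : Fin 5 → E 3 → ℝ} {x : E 3} (h : ∀ k, f k x = f' k x) :
    augProj j f x = augProj j f' x := by
  simp only [augProj, h]

theorem integrable_mul_test {f φ : E 3 → ℝ} {U : Set (E 3)} (hf : Integrable f) (hφ : IsTest U φ) :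
    Integrable fun x => f x * φ x := hφ.integrable_mul hf.integrableOn

/-- Pairing of the angular mean with a test function. -/
theorem integral_avg_augProj_mul {F : Fin 5 → E 3 → ℝ} (hF : ∀ k, Integrable (F k)) (j : Fin 3)
    {ψ : E 2 → ℝ} (h : IsTest rightHalf ψ) :
    ∫ p in rightHalf, avg (augProj j F) p * ψ p
      = (2 * Real.pi)⁻¹ * ∑ k with augIdx k = j, ∫ x, F k x * axTest 1 k ψ x := by
  have hπ := Real.pi_pos
  -- The extra factor `ρ⁻¹` cancels the weight `ρ` of the cylindrical volume element, so the pairing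
  -- on the half plane is unweighted.
  have h1 := h.inv_pow_mul subset_rfl isOpen_rightHalf 1
  have hi : ∀ k, Integrable fun x => F k x * axTest 1 k ψ x := fun k =>
    integrable_mul_test (hF k) (isTest_axTest subset_rfl isOpen_rightHalf h 1 k)
  have e1 : ∀ x, augProj j F x * ((meridian x 0)⁻¹ ^ 1 * ψ (meridian x))
      = ∑ k with augIdx k = j, F k x * axTest 1 k ψ x := fun x => by
    rw [augProj, Finset.sum_mul]
    refine Finset.sum_congr rfl fun k _ => ?_
    rw [axTest_eq h]; ring
  have h2 := integral_mul_meridian (F := augProj j F) (ψ := fun p => (p 0)⁻¹ ^ 1 * ψ p)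
    (integrable_mul_test (integrable_augProj hF j) (h1.comp_meridian subset_rfl))
  simp only [e1] at h2
  rw [integral_finsetSum _ fun k _ => hi k] at h2
  rw [h2, inv_mul_cancel_left₀ (by positivity)]
  refine setIntegral_congr_fun isOpen_rightHalf.measurableSet fun p (hp : 0 < p 0) => ?_
  field_simp

/-- `g` is a weak gradient of `f` with respect to test functions on `U`, both square integrable. -/
structure WeakPair (U : Set (E 3)) (f : E 3 → ℝ) (g : E 3 → E 3) : Prop where
  integrable : Integrable f
  integrable_grad : Integrable g
  memLp_grad : MemLp g 2
  integral_eq : ∀ φ : E 3 → ℝ, IsTest U φ → ∀ i, ∫ x, f x * pd i φ x = - ∫ x, g x i * φ x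

theorem IsH10.weakPair {R : ℝ} {v : E 3 → ℝ} {G : E 3 → E 3} (h : IsH10 R v G) :
    WeakPair univ v G :=
  ⟨h.integrable, h.integrable_grad, h.memLp_grad, h.integral_eq⟩

/-- The radial derivative. -/
noncomputable def radial (g : Fin 5 → E 3 → E 3) (k : Fin 5) (x : E 3) : ℝ :=
  Real.cos (azimuth x) * g k x 0 + Real.sin (azimuth x) * g k x 1

/-- The gradient of the `j`-th component of the profile. -/
noncomputable def augGrad (g : Fin 5 → E 3 → E 3) (j : Fin 3) (p : E 2) : E 2 :=
  !₂[avg (augProj j (radial g)) p, avg (augProj j fun k x => g k x 2) p]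

variable {f : Fin 5 → E 3 → ℝ} {g : Fin 5 → E 3 → E 3} {U : Set (E 3)}

theorem memLp_radial {p : ENNReal} (h : ∀ k, MemLp (g k) p) (k : Fin 5) :
    MemLp (radial g k) p :=
  (memLp_mul_azimuth (memLp_apply (h k) 0) Real.continuous_cos Real.abs_cos_le_one).add
    (memLp_mul_azimuth (memLp_apply (h k) 1) Real.continuous_sin Real.abs_sin_le_one)

theorem integrable_radial (h : ∀ k, Integrable (g k)) (k : Fin 5) : Integrable (radial g k) :=
  memLp_one_iff_integrable.1 (memLp_radial (fun k => memLp_one_iff_integrable.2 (h k)) k)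

theorem integrable_toLp_two {α : Type*} [MeasurableSpace α] {ν : Measure α} {s t : α → ℝ}
    (hs : Integrable s ν) (ht : Integrable t ν) : Integrable (fun p => !₂[s p, t p]) ν := by
  refine (hs.norm.add ht.norm).mono' ?_ (Eventually.of_forall fun p => ?_)
  · have h1 : AEMeasurable (fun p => (![s p, t p] : Fin 2 → ℝ)) ν := by
      refine aemeasurable_pi_iff.2 fun i => ?_
      fin_cases i
      · exact hs.1.aemeasurable
      · exact ht.1.aemeasurable
    exact ((PiLp.continuous_toLp 2 (fun _ : Fin 2 => ℝ)).measurable.comp_aemeasurable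
      h1).aestronglyMeasurable
  · refine (sq_le_sq₀ (norm_nonneg _) (add_nonneg (norm_nonneg _) (norm_nonneg _))).1 ?_
    rw [EuclideanSpace.norm_sq_eq, Fin.sum_univ_two]
    simp only [Matrix.cons_val_zero, Matrix.cons_val_one]
    nlinarith [norm_nonneg (s p), norm_nonneg (t p)]

theorem locallyIntegrableOn_avg {F : E 3 → ℝ} (hF : Integrable F) :
    LocallyIntegrableOn (avg F) rightHalf := locallyIntegrableOn_of_halfMeasure (integrable_avg hF)

theorem locallyIntegrableOn_augGrad (h : ∀ k, Integrable (g k)) (j : Fin 3) :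
    LocallyIntegrableOn (augGrad g j) rightHalf := fun p hp => by
  obtain ⟨s, hs, hi⟩ := locallyIntegrableOn_avg (integrable_augProj (integrable_radial h) j) p hp
  obtain ⟨t, ht, hi'⟩ := locallyIntegrableOn_avg
    (integrable_augProj (fun k => integrable_apply (h k) 2) j) p hp
  exact ⟨s ∩ t, inter_mem hs ht, integrable_toLp_two (hi.mono_set inter_subset_left)
    (hi'.mono_set inter_subset_right)⟩

theorem IsTest.setIntegral_mul_eq {n : ℕ} {V W : Set (E n)} {φ f : E n → ℝ} (h : IsTest V φ)
    (hVW : V ⊆ W) : ∫ x in W, f x * φ x = ∫ x, f x * φ x :=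
  (h.mono hVW).setIntegral_eq

/-- The weak gradient of the profile of a field. -/
theorem hasWeakGradient_augGrad (h : ∀ k, WeakPair U (f k) (g k)) {W : Set (E 2)} (hW : IsOpen W)
    (hWr : W ⊆ rightHalf) (hWU : meridian ⁻¹' W ⊆ U) {j : Fin 3} {u : E 2 → ℝ}
    (hu : ∀ᵐ x, augProj j f x = u (meridian x)) : HasWeakGradient W u (augGrad g j) := by
  have hae := avg_ae_eq hu
  have hloc : LocallyIntegrableOn u rightHalf :=
    locallyIntegrableOn_congr (locallyIntegrableOn_avg
      (integrable_augProj (fun k => (h k).integrable) j)) hae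
  refine ⟨hloc.mono_set hWr,
    (locallyIntegrableOn_augGrad (fun k => (h k).integrable_grad) j).mono_set hWr,
    fun ψ hψ i => ?_⟩
  have hψ' := hψ.mono hWr
  have e1 : ∫ p in W, u p * pd i ψ p = ∫ p in rightHalf, avg (augProj j f) p * pd i ψ p := by
    rw [(hψ.pd i).setIntegral_eq, ← (hψ.pd i).setIntegral_mul_eq hWr]
    refine integral_congr_ae ?_
    filter_upwards [hae] with p hp
    rw [hp]
  rw [e1, hψ.setIntegral_eq, ← hψ.setIntegral_mul_eq hWr,
    integral_avg_augProj_mul (fun k => (h k).integrable) j (hψ'.pd i)]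
  have hT : ∀ m k, IsTest U (axTest m k ψ) := fun m k => (isTest_axTest hWr hW hψ m k).mono hWU
  fin_cases i
  -- The radial derivative of the test function is a horizontal divergence by `div_axTest`, to which
  -- the weak derivatives in the Cartesian directions apply.
  · have e2 : ∀ k, ∫ x, f k x * axTest 1 k (pd 0 ψ) x
        = - ∫ x, radial g k x * axTest 1 k ψ x := fun k => by
      have ht := fun i : Fin 3 => (hT 2 k).mul_left (contDiff_coord i)
      have i1 := fun i l => integrable_mul_test (h k).integrable ((ht i).pd l)
      have i2 := fun i => integrable_mul_test (integrable_apply (h k).integrable_grad i) (ht i)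
      have e3 : ∀ x, f k x * axTest 1 k (pd 0 ψ) x
          = f k x * pd 0 (fun y => y 0 * axTest 2 k ψ y) x
            + f k x * pd 1 (fun y => y 1 * axTest 2 k ψ y) x := fun x => by
        rw [← div_axTest hψ']; ring
      simp_rw [e3]
      rw [integral_add (i1 0 0) (i1 1 1), (h k).integral_eq _ (ht 0), (h k).integral_eq _ (ht 1),
        ← neg_add, ← integral_add (i2 0) (i2 1)]
      congr 1
      refine integral_congr_ae (Eventually.of_forall fun x => ?_)
      simp only [radial]
      rw [axTest_eq hψ', axTest_eq hψ']
      by_cases hx : 0 < meridian x 0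
      · have h0 := meridian_mul_cos x
        have h1 := meridian_mul_sin x
        rw [← h0, ← h1]
        field_simp
      · rw [hψ'.eq_zero_of_notMem hx]; simp
    simp only [Fin.zero_eta, e2]
    rw [Finset.sum_neg_distrib, mul_neg]
    congr 1
    exact (integral_avg_augProj_mul (integrable_radial fun k => (h k).integrable_grad) j hψ').symm
  · have e2 : ∀ k, ∫ x, f k x * axTest 1 k (pd 1 ψ) x
        = - ∫ x, g k x 2 * axTest 1 k ψ x := fun k => by
      rw [← (h k).integral_eq _ (hT 1 k)]
      simp_rw [pd_two_axTest hψ']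
    simp only [Fin.mk_one, e2]
    rw [Finset.sum_neg_distrib, mul_neg]
    congr 1
    exact (integral_avg_augProj_mul (fun k => integrable_apply (h k).integrable_grad 2) j hψ').symm

theorem locallyIntegrableOn_augGrad_sq (h : ∀ k, WeakPair U (f k) (g k)) (j : Fin 3) :
    LocallyIntegrableOn (fun p => ‖augGrad g j p‖ ^ 2) rightHalf := by
  have h1 := integrable_avg_sq (memLp_augProj (memLp_radial fun k => (h k).memLp_grad) j)
    (integrable_augProj (integrable_radial fun k => (h k).integrable_grad) j)
  have h2 := integrable_avg_sq (memLp_augProj (fun k => memLp_apply (h k).memLp_grad 2) j)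
    (integrable_augProj (fun k => integrable_apply (h k).integrable_grad 2) j)
  refine locallyIntegrableOn_congr ((locallyIntegrableOn_of_halfMeasure h1).add
    (locallyIntegrableOn_of_halfMeasure h2)) (Eventually.of_forall fun p => ?_)
  simp [EuclideanSpace.norm_sq_eq, Fin.sum_univ_two, augGrad]

end Reduction

/-! ### Boundary values of the profile -/

section ProfileBoundary

open Filter Topology

theorem mem_ball₁_iff_meridian (x : E 3) : x ∈ ball₁ ↔ ‖meridian x‖ < 1 := by
  rw [norm_meridian, ball₁, mem_ball_zero_iff]

theorem D_eq : D = rightHalf ∩ Metric.ball 0 1 := by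
  ext p
  simp [D, rightHalf, EuclideanSpace.norm_eq, Fin.sum_univ_two, Real.sqrt_lt']

theorem isOpen_D : IsOpen D := D_eq ▸ isOpen_rightHalf.inter Metric.isOpen_ball

theorem D_subset_rightHalf : D ⊆ rightHalf := D_eq ▸ inter_subset_left

theorem meridian_preimage_D : meridian ⁻¹' D ⊆ ball₁ := fun x hx => by
  rw [mem_ball₁_iff_meridian]
  have : meridian x ∈ rightHalf ∩ Metric.ball 0 1 := D_eq ▸ hx
  exact mem_ball_zero_iff.1 this.2

theorem norm_cyl {p : E 2} {θ : ℝ} (hp : 0 ≤ p 0) : ‖cyl (p, θ)‖ = ‖p‖ := by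
  rw [← norm_meridian, meridian_cyl hp]

theorem augGrad_eq_zero {g : Fin 5 → E 3 → E 3} (h : ∀ k, ∀ x ∉ ball₁, g k x = 0) (j : Fin 3)
    {p : E 2} (hp : p ∈ rightHalf) (hpD : p ∉ D) : augGrad g j p = 0 := by
  have h1 : ∀ θ, cyl (p, θ) ∉ ball₁ := fun θ hθ => hpD <| by
    rw [ball₁, mem_ball_zero_iff, norm_cyl (le_of_lt hp)] at hθ
    rw [D_eq]
    exact ⟨hp, mem_ball_zero_iff.2 hθ⟩
  have h2 : ∀ k θ, g k (cyl (p, θ)) = 0 := fun k θ => h k _ (h1 θ)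
  ext i
  fin_cases i <;> simp [augGrad, avg, augProj, radial, h2]

theorem ae_arcMeasure : ∀ᵐ p ∂arcMeasure, 0 ≤ p 0 ∧ ‖p‖ = 1 := by
  have hm : Measurable fun s : ℝ => (!₂[Real.sin s, Real.cos s] : E 2) :=
    ((PiLp.continuous_toLp 2 _).comp (continuous_pi fun j => by
      fin_cases j
      · exact Real.continuous_sin
      · exact Real.continuous_cos)).measurable
  have hs : MeasurableSet {p : E 2 | 0 ≤ p 0 ∧ ‖p‖ = 1} :=
    (isClosed_le continuous_const (contDiff_coord (n := 2) 0).continuous).measurableSet.inter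
      (isClosed_eq continuous_norm continuous_const).measurableSet
  rw [arcMeasure, ae_map_iff hm.aemeasurable hs]
  filter_upwards [ae_restrict_mem measurableSet_Ioo] with s hs
  refine ⟨(Real.sin_pos_of_mem_Ioo hs).le, ?_⟩
  simp [EuclideanSpace.norm_eq, Fin.sum_univ_two]

instance : IsFiniteMeasure arcMeasure := by
  unfold arcMeasure; infer_instance

theorem LocallyIntegrableOn.restrict {n : ℕ} {F : Type*} [NormedAddCommGroup F] {f : E n → F}
    {s t : Set (E n)} (h : LocallyIntegrableOn f s) :
    LocallyIntegrableOn f s (volume.restrict t) := fun x hx => by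
  obtain ⟨u, hu, hi⟩ := h x hx
  exact ⟨u, hu, hi.mono_measure Measure.restrict_le_self⟩

/-- A function with a weak gradient up to the arc, plus a smooth function, has the trace of the
latter on the arc. -/
theorem hasTrace_arc {d u t c : E 2 → ℝ} {g : E 2 → E 2} (hd : HasWeakGradient rightHalf d g)
    (hd0 : ∀ p ∈ rightHalf, p ∉ D → d p = 0) (hg0 : ∀ p ∈ rightHalf, p ∉ D → g p = 0)
    (hc : ContDiff ℝ ∞ c) (ht : ∀ p : E 2, 0 ≤ p 0 → ‖p‖ = 1 → t p = c p)
    (hu : ∀ p ∈ D, u p = c p + d p) : HasTrace D {p | 0 < p 0} arcMeasure id u t := by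
  have htc : c =ᵐ[arcMeasure] t := ae_arcMeasure.mono fun p hp => (ht p hp.1 hp.2).symm
  have huc : (fun p => c p + d p) =ᵐ[volume.restrict D] u := by
    filter_upwards [ae_restrict_mem isOpen_D.measurableSet] with p hp
    rw [hu p hp]
  have hw : HasWeakGradient rightHalf (fun p => c p + d p) fun p => grd c p + g p :=
    (hasWeakGradient_grd hc _).add hd
  have hcl : LocallyIntegrableOn c rightHalf arcMeasure :=
    hc.continuous.locallyIntegrable.locallyIntegrableOn _
  refine ⟨locallyIntegrableOn_congr hcl (ae_restrict_of_ae htc),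
    locallyIntegrableOn_congr (LocallyIntegrableOn.restrict hw.locInt) (ae_restrict_of_ae huc),
    fun p => grd c p + g p, ?_, LocallyIntegrableOn.restrict hw.locInt_grad, fun φ hφ i => ?_⟩
  · refine HasWeakGradient.congr ⟨hw.locInt.mono_set D_subset_rightHalf,
      hw.locInt_grad.mono_set D_subset_rightHalf, fun φ hφ i => ?_⟩ huc (ae_eq_refl _)
    have := hw.integral_eq φ (hφ.mono D_subset_rightHalf) i
    rwa [(hφ.pd i).setIntegral_mul_eq D_subset_rightHalf, hφ.setIntegral_mul_eq D_subset_rightHalf,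
      ← (hφ.pd i).setIntegral_eq, ← hφ.setIntegral_eq (f := fun x => (grd c x + g x) i)] at this
  · have hφ' : IsTest rightHalf φ := hφ
    have i1 := integrableOn_mul_test hd.locInt (hφ'.pd i)
    have i2 := integrableOn_mul_test (locallyIntegrableOn_apply hd.locInt_grad i) hφ'
    -- The weak gradient identity holds across the arc and both functions vanish beyond it, so no
    -- boundary term appears.
    have e1 : ∫ p in D, (d p * pd i φ p + g p i * φ p) = 0 := by
      rw [← setIntegral_eq_of_subset_of_forall_sdiff_eq_zero isOpen_rightHalf.measurableSet
        D_subset_rightHalf fun p hp => by rw [hd0 p hp.1 hp.2, hg0 p hp.1 hp.2]; simp]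
      rw [integral_add i1 i2, hd.integral_eq φ hφ' i, neg_add_cancel]
    have hcφ := hφ'.mul_left hc
    have e2 : ∫ p in D, pd i (fun p => c p * φ p) p = ∫ p, t p * φ p * p i ∂arcMeasure := by
      rw [integral_D_pd hcφ i]
      refine integral_congr_ae (htc.mono fun p hp => ?_)
      simp only [hp]
    simp only [id]
    rw [← e2, ← add_zero (∫ p in D, pd i (fun p => c p * φ p) p), ← e1, ← integral_add
      (hcφ.pd i).integrable.integrableOn ((i1.fun_add i2).mono_set D_subset_rightHalf)]
    refine setIntegral_congr_fun isOpen_D.measurableSet fun p hp => ?_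
    simp only
    rw [hu p hp, pd_mul (hc.differentiable (by simp) p) hφ.differentiableAt, PiLp.add_apply,
      grd_apply]
    ring

variable {a μ : ℝ} {w : E 3 → E 5} {V : Fin 5 → E 3 → ℝ} {G : Fin 5 → E 3 → E 3} {u : E 2 → E 3}

/-- `V` is the zero extension of `ℒ[u - u₀]`, so its profile is that of `u - u₀`, extended by zero
beyond the arc. -/
theorem IsRep.ae_augProj (h : IsRep a w V G) (hu : IsAug w u) (j : Fin 3) :
    ∀ᵐ x, augProj j V x
      = (Metric.ball (0 : E 2) 1).indicator (fun p => u p j - compProf a p j) (meridian x) := by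
  have h1 : ∀ᵐ x, x ∈ ball₁ → ∀ k, w x k = comp a k x + V k x :=
    (ae_restrict_iff' isOpen_ball₁.measurableSet).1 (ae_all_iff.2 h.eq_add)
  have h2 : ∀ᵐ x, x ∈ ball₁ → w x = augField u x :=
    (ae_restrict_iff' isOpen_ball₁.measurableSet).1 hu
  filter_upwards [h1, h2] with x h1 h2
  by_cases hx : x ∈ ball₁
  · have h3 : ∀ k, V k x = augField (fun p => u p - compProf a p) x k := fun k => by
      have := h1 hx k
      rw [h2 hx, ← augField_compProf] at this
      simp only [augField, aug_apply, PiLp.sub_apply] at this ⊢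
      linarith
    rw [indicator_of_mem (by rwa [mem_ball_zero_iff, ← mem_ball₁_iff_meridian]),
      augProj_congr (f' := fun k y => augField (fun p => u p - compProf a p) y k) h3,
      augProj_augField, PiLp.sub_apply]
  · rw [indicator_of_notMem (by rwa [mem_ball_zero_iff, ← mem_ball₁_iff_meridian]),
      augProj_congr (f' := fun _ _ => 0) fun k => (h.isH10 k).eq_zero x hx]
    simp [augProj]

/-- The profile of an admissible field has the boundary values `U_a^*`. -/
theorem IsRep.eqOnArc (h : IsRep a w V G) (hu : IsAug w u) : EqOnArc u (Ustar a) := fun j => by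
  have hd := hasWeakGradient_augGrad (fun k => (h.isH10 k).weakPair) isOpen_rightHalf subset_rfl
    (subset_univ _) (h.ae_augProj hu j)
  refine hasTrace_arc hd (fun p hp hpD => indicator_of_notMem (fun hb => hpD ?_) _)
    (fun p hp hpD => augGrad_eq_zero (fun k => (h.isH10 k).grad_eq_zero) j hp hpD)
    (contDiff_compProf a j) (fun p h0 h1 => by rw [Ustar_eq_compProf a h0 h1]) fun p hp => ?_
  · rw [D_eq]; exact ⟨hp, hb⟩
  · rw [D_eq] at hp
    rw [indicator_of_mem hp.2]; ring

/-- The field itself, extended by zero. -/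
noncomputable def extField (a : ℝ) (V : Fin 5 → E 3 → ℝ) (k : Fin 5) (x : E 3) : ℝ :=
  ball₁.indicator (comp a k) x + V k x

/-- The gradient of the field, extended by zero. -/
noncomputable def extGrad (a : ℝ) (G : Fin 5 → E 3 → E 3) (k : Fin 5) (x : E 3) : E 3 :=
  ball₁.indicator (grd (comp a k)) x + G k x

/-- The zero extension of the competitor jumps across the sphere, so the identity is only claimed
for test functions supported inside the ball. -/
theorem IsRep.weakPair (h : IsRep a w V G) (k : Fin 5) :
    WeakPair ball₁ (extField a V k) (extGrad a G k) := by
  have hc := contDiff_comp a k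
  have m1 : MemLp (ball₁.indicator (comp a k)) 2 :=
    (memLp_indicator_iff_restrict isOpen_ball₁.measurableSet).2
      (integrable_ball₁_of_continuous hc.continuous)
  have m2 : MemLp (ball₁.indicator (grd (comp a k))) 2 :=
    (memLp_indicator_iff_restrict isOpen_ball₁.measurableSet).2
      (integrable_ball₁_of_continuous (continuous_grd hc))
  have i1 : Integrable (ball₁.indicator (comp a k)) :=
    integrable_of_memLp_of_eq_zero (R := 1) m1 fun x hx => indicator_of_notMem hx _
  have i2 : Integrable (ball₁.indicator (grd (comp a k))) :=
    integrable_of_memLp_of_eq_zero (R := 1) m2 fun x hx => indicator_of_notMem hx _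
  refine ⟨i1.add (h.isH10 k).integrable, i2.add (h.isH10 k).integrable_grad,
    m2.add (h.isH10 k).memLp_grad, fun φ hφ i => ?_⟩
  have e1 : ∫ x, ball₁.indicator (comp a k) x * pd i φ x
      = - ∫ x, ball₁.indicator (grd (comp a k)) x i * φ x := by
    have a1 : ∫ x in ball₁, ball₁.indicator (comp a k) x * pd i φ x
        = ∫ x in ball₁, comp a k x * pd i φ x :=
      setIntegral_congr_fun isOpen_ball₁.measurableSet fun x hx => by
        simp only [indicator_of_mem hx]
    have a2 : ∫ x in ball₁, ball₁.indicator (grd (comp a k)) x i * φ x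
        = ∫ x in ball₁, grd (comp a k) x i * φ x :=
      setIntegral_congr_fun isOpen_ball₁.measurableSet fun x hx => by
        simp only [indicator_of_mem hx]
    rw [← (hφ.pd i).setIntegral_eq,
      ← hφ.setIntegral_eq (f := fun x => ball₁.indicator (grd (comp a k)) x i), a1, a2]
    exact (hasWeakGradient_grd hc ball₁).integral_eq φ hφ i
  simp only [extField, extGrad, add_mul, PiLp.add_apply]
  rw [integral_add (integrable_mul_test i1 (hφ.pd i))
      (integrable_mul_test (h.isH10 k).integrable (hφ.pd i)),
    integral_add (integrable_mul_test (integrable_apply i2 i) hφ)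
      (integrable_mul_test (integrable_apply (h.isH10 k).integrable_grad i) hφ), e1,
    (h.isH10 k).integral_eq φ (hφ.mono (subset_univ _)) i, neg_add]

theorem IsRep.ae_extField (h : IsRep a w V G) : ∀ᵐ x, x ∈ ball₁ → ∀ k, extField a V k x = w x k := by
  have h1 : ∀ᵐ x, x ∈ ball₁ → ∀ k, w x k = comp a k x + V k x :=
    (ae_restrict_iff' isOpen_ball₁.measurableSet).1 (ae_all_iff.2 h.eq_add)
  filter_upwards [h1] with x hx hb k
  rw [hx hb, extField, indicator_of_mem hb]

theorem IsRep.ae_augProj_extField (h : IsRep a w V G) (hu : IsAug w u) (j : Fin 3) :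
    ∀ᵐ x, augProj j (extField a V) x
      = (Metric.ball (0 : E 2) 1).indicator (fun p => u p j) (meridian x) := by
  have h2 : ∀ᵐ x, x ∈ ball₁ → w x = augField u x :=
    (ae_restrict_iff' isOpen_ball₁.measurableSet).1 hu
  filter_upwards [h.ae_extField, h2] with x h1 h2
  by_cases hx : x ∈ ball₁
  · rw [indicator_of_mem (by rwa [mem_ball_zero_iff, ← mem_ball₁_iff_meridian]),
      augProj_congr (f' := fun k y => augField u y k) fun k => by rw [h1 hx, h2 hx],
      augProj_augField]
  · rw [indicator_of_notMem (by rwa [mem_ball_zero_iff, ← mem_ball₁_iff_meridian]),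
      augProj_congr (f' := fun _ _ => 0) fun k => by
        rw [extField, indicator_of_notMem hx, (h.isH10 k).eq_zero x hx, add_zero]]
    simp [augProj]

/-- The weak gradient of the profile of an admissible field. -/
theorem IsRep.hasWeakGradient_profile (h : IsRep a w V G) (hu : IsAug w u) (j : Fin 3) :
    HasWeakGradient D (fun p => u p j) (augGrad (extGrad a G) j) := by
  refine (hasWeakGradient_augGrad h.weakPair isOpen_D D_subset_rightHalf meridian_preimage_D
    (h.ae_augProj_extField hu j)).congr ?_ (ae_eq_refl _)
  filter_upwards [ae_restrict_mem isOpen_D.measurableSet] with p hp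
  rw [D_eq] at hp
  rw [indicator_of_mem hp.2]

theorem norm_augField (u : E 2 → E 3) (x : E 3) : ‖augField u x‖ = ‖u (meridian x)‖ := by
  rw [← sq_eq_sq₀ (norm_nonneg _) (norm_nonneg _), EuclideanSpace.norm_sq_eq,
    EuclideanSpace.norm_sq_eq, Fin.sum_univ_five, Fin.sum_univ_three]
  simp only [augField, aug_apply, Real.norm_eq_abs, sq_abs]
  have h1 := Real.sin_sq_add_cos_sq (2 * azimuth x)
  have h2 := Real.sin_sq_add_cos_sq (azimuth x)
  simp [augIdx, augTrig]
  linear_combination (u (meridian x) 0) ^ 2 * h1 + (u (meridian x) 2) ^ 2 * h2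

/-- The fourth power of the profile is locally integrable. -/
theorem locallyIntegrableOn_profile_pow_four (hu : IsAug w u)
    (h4 : IntegrableOn (fun x => ‖w x‖ ^ 4) ball₁) :
    LocallyIntegrableOn (fun p => ‖u p‖ ^ 4) D := by
  have h1 : Integrable (ball₁.indicator fun x => ‖w x‖ ^ 4) :=
    (integrable_indicator_iff isOpen_ball₁.measurableSet).2 h4
  have h2 : ∀ᵐ x, ball₁.indicator (fun x => ‖w x‖ ^ 4) x
      = (Metric.ball (0 : E 2) 1).indicator (fun p => ‖u p‖ ^ 4) (meridian x) := by
    filter_upwards [(ae_restrict_iff' isOpen_ball₁.measurableSet).1 hu] with x hx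
    by_cases hb : x ∈ ball₁
    · rw [indicator_of_mem hb, hx hb, norm_augField,
        indicator_of_mem (by rwa [mem_ball_zero_iff, ← mem_ball₁_iff_meridian])]
    · rw [indicator_of_notMem hb,
        indicator_of_notMem (by rwa [mem_ball_zero_iff, ← mem_ball₁_iff_meridian])]
  have h3 := locallyIntegrableOn_congr (locallyIntegrableOn_avg h1) (avg_ae_eq h2)
  refine locallyIntegrableOn_congr (h3.mono_set D_subset_rightHalf) ?_
  filter_upwards [ae_restrict_mem isOpen_D.measurableSet] with p hp
  rw [D_eq] at hp
  rw [indicator_of_mem hp.2]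

end ProfileBoundary

/-! ### The first variation -/

section Variation

open Filter Topology

/-- Taylor expansion of a cubic form. The coefficient of `t` identifies `SPolar z v` as the
derivative of `S` at `v` in the direction `z`. -/
theorem S_add_smul (v z : E 5) (t : ℝ) :
    S (v + t • z) = S v + t * SPolar z v + t ^ 2 * SPolar v z + t ^ 3 * S z := by
  simp only [S, SPolar, PiLp.add_apply, PiLp.smul_apply, smul_eq_mul]; ring

/-- The derivative of the potential at `v` in the direction `z`. -/
noncomputable def potDeriv (a : ℝ) (v z : E 5) : ℝ :=
  -(3 * Real.sqrt 2) * SPolar z v + 2 * a * (‖v‖ ^ 2 - 1) * inner ℝ v z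

/-- The remainder is at most quadratic in `v` when `z` is bounded, so `w ∈ L²` makes it integrable.
An upper bound is enough, since minimality gives the opposite inequality and both signs of `t` are
tried. -/
theorem exists_pot_expansion {a : ℝ} (ha : 0 < a) {Z : ℝ} (hZ : 0 ≤ Z) : ∃ K : ℝ, 0 ≤ K ∧
    ∀ v z : E 5, ‖z‖ ≤ Z → ∀ t : ℝ, |t| ≤ 1 →
      pot a (v + t • z) ≤ pot a v + t * potDeriv a v z + t ^ 2 * (K * (1 + ‖v‖ ^ 2)) := by
  refine ⟨6 * (30 * Z ^ 2 + 10 * Z ^ 3) + a / 2 * (6 * Z ^ 2 + 4 * Z ^ 3 + Z ^ 4), by positivity,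
    fun v z hz t ht => ?_⟩
  have hz0 := norm_nonneg z
  have hN0 := norm_nonneg v
  have hi := abs_le.1 (abs_real_inner_le_norm v z)
  have ht' := abs_le.1 ht
  have hA := abs_le.1 ((abs_SPolar_le v z).trans (show 30 * (‖v‖ * ‖z‖ ^ 2) ≤ 30 * (‖v‖ * Z ^ 2) by
    gcongr))
  have hB := abs_le.1 ((abs_S_le z).trans (show 10 * ‖z‖ ^ 3 ≤ 10 * Z ^ 3 by gcongr))
  have hiZ : |inner ℝ v z| ≤ ‖v‖ * Z := (abs_real_inner_le_norm v z).trans (by gcongr)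
  have hz2 : ‖z‖ ^ 2 ≤ Z ^ 2 := by gcongr
  have hi2 : (inner ℝ v z : ℝ) ^ 2 ≤ ‖v‖ ^ 2 * Z ^ 2 := by
    rw [← sq_abs, ← mul_pow]; gcongr
  have hn : ‖v + t • z‖ ^ 2 = ‖v‖ ^ 2 + 2 * t * inner ℝ v z + t ^ 2 * ‖z‖ ^ 2 := by
    rw [norm_add_sq_real, real_inner_smul_right, norm_smul, Real.norm_eq_abs, mul_pow, sq_abs]; ring
  have hs2 := sqrt_two_le
  have hs0 := Real.sqrt_nonneg 2
  have h1 : -(3 * Real.sqrt 2) * (SPolar v z + t * S z)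
      ≤ 6 * (30 * (‖v‖ * Z ^ 2) + 10 * Z ^ 3) := by
    have hle : |SPolar v z + t * S z| ≤ 30 * (‖v‖ * Z ^ 2) + 10 * Z ^ 3 := by
      refine (abs_add_le _ _).trans (add_le_add (abs_le.2 hA) ?_)
      rw [abs_mul]
      have := abs_le.2 hB
      nlinarith [abs_nonneg (S z), abs_nonneg t]
    have hle' := (abs_le.1 hle).1
    have hp : 0 ≤ 30 * (‖v‖ * Z ^ 2) + 10 * Z ^ 3 := by positivity
    nlinarith
  have h2 : 4 * (inner ℝ v z : ℝ) ^ 2 + 2 * (‖v‖ ^ 2 - 1) * ‖z‖ ^ 2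
      + 4 * t * (inner ℝ v z) * ‖z‖ ^ 2 + t ^ 2 * ‖z‖ ^ 4
      ≤ 4 * (‖v‖ ^ 2 * Z ^ 2) + 2 * (‖v‖ ^ 2 * Z ^ 2) + 4 * (‖v‖ * Z * Z ^ 2) + Z ^ 4 := by
    have a1 : 2 * (‖v‖ ^ 2 - 1) * ‖z‖ ^ 2 ≤ 2 * (‖v‖ ^ 2 * Z ^ 2) := by
      nlinarith [mul_le_mul_of_nonneg_left hz2 (sq_nonneg ‖v‖), sq_nonneg ‖z‖]
    have a2 : t * (inner ℝ v z) * ‖z‖ ^ 2 ≤ ‖v‖ * Z * Z ^ 2 := by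
      have b1 : |t * inner ℝ v z| ≤ ‖v‖ * Z := by
        rw [abs_mul]
        nlinarith [abs_nonneg (inner ℝ v z), abs_nonneg t]
      have b2 := le_of_abs_le b1
      calc t * (inner ℝ v z) * ‖z‖ ^ 2 ≤ ‖v‖ * Z * ‖z‖ ^ 2 := by gcongr
        _ ≤ _ := by gcongr
    have a3 : t ^ 2 * ‖z‖ ^ 4 ≤ Z ^ 4 := by
      have c1 : t ^ 2 ≤ 1 := by rw [← sq_abs]; exact pow_le_one₀ (abs_nonneg t) ht
      have c2 : ‖z‖ ^ 4 ≤ Z ^ 4 := by gcongr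
      nlinarith [pow_nonneg hz0 4]
    linarith
  have h3 : ‖v‖ ≤ 1 + ‖v‖ ^ 2 := by nlinarith [sq_nonneg (‖v‖ - 1)]
  have h4 : 6 * (30 * (‖v‖ * Z ^ 2) + 10 * Z ^ 3)
      ≤ 6 * (30 * Z ^ 2 + 10 * Z ^ 3) * (1 + ‖v‖ ^ 2) := by
    have c1 := mul_le_mul_of_nonneg_right h3 (show 0 ≤ Z ^ 2 by positivity)
    have c2 : 0 ≤ Z ^ 3 * ‖v‖ ^ 2 := by positivity
    linarith
  have h5 : 4 * (‖v‖ ^ 2 * Z ^ 2) + 2 * (‖v‖ ^ 2 * Z ^ 2) + 4 * (‖v‖ * Z * Z ^ 2) + Z ^ 4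
      ≤ (6 * Z ^ 2 + 4 * Z ^ 3 + Z ^ 4) * (1 + ‖v‖ ^ 2) := by
    have c1 := mul_le_mul_of_nonneg_right h3 (show 0 ≤ Z ^ 3 by positivity)
    have c2 : 0 ≤ Z ^ 4 * ‖v‖ ^ 2 := by positivity
    have c3 : 0 ≤ Z ^ 2 := by positivity
    linarith
  have h6 := add_le_add (h1.trans h4)
    (mul_le_mul_of_nonneg_left (h2.trans h5) (show 0 ≤ a / 2 by positivity))
  have h7 := mul_le_mul_of_nonneg_left h6 (sq_nonneg t)
  rw [pot, pot, potDeriv, S_add_smul, hn]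
  linarith

theorem exists_potDeriv_bound {a : ℝ} (ha : 0 < a) {Z : ℝ} (hZ : 0 ≤ Z) : ∃ K : ℝ,
    ∀ v z : E 5, ‖z‖ ≤ Z → |potDeriv a v z| ≤ K * (1 + ‖v‖ ^ 4) := by
  refine ⟨6 * (30 * Z) + 2 * a * (2 * Z), fun v z hz => ?_⟩
  have hN0 := norm_nonneg v
  have h1 : |3 * Real.sqrt 2 * SPolar z v| ≤ 6 * (30 * (Z * ‖v‖ ^ 2)) := by
    rw [abs_mul, abs_of_nonneg (by positivity)]
    have := (abs_SPolar_le z v).trans (show 30 * (‖z‖ * ‖v‖ ^ 2) ≤ 30 * (Z * ‖v‖ ^ 2) by gcongr)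
    have hs2 := sqrt_two_le
    have hs0 := Real.sqrt_nonneg 2
    nlinarith [abs_nonneg (SPolar z v)]
  have h2 : |2 * a * (‖v‖ ^ 2 - 1) * inner ℝ v z| ≤ 2 * a * ((‖v‖ ^ 2 + 1) * (‖v‖ * Z)) := by
    rw [abs_mul, abs_mul, abs_of_nonneg (show 0 ≤ 2 * a by positivity), mul_assoc]
    have b1 : |‖v‖ ^ 2 - 1| ≤ ‖v‖ ^ 2 + 1 := by
      rw [abs_le]; constructor <;> nlinarith [sq_nonneg ‖v‖]
    have b2 : |inner ℝ v z| ≤ ‖v‖ * Z := (abs_real_inner_le_norm v z).trans (by gcongr)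
    gcongr
  have h3 : ‖v‖ ^ 2 ≤ 1 + ‖v‖ ^ 4 := by nlinarith [sq_nonneg (‖v‖ ^ 2 - 1)]
  have h4 : (‖v‖ ^ 2 + 1) * ‖v‖ ≤ 2 * (1 + ‖v‖ ^ 4) := by
    nlinarith [sq_nonneg (‖v‖ ^ 2 - ‖v‖), sq_nonneg (‖v‖ - 1), sq_nonneg (‖v‖ ^ 2 - 1), sq_nonneg ‖v‖]
  have h5 := mul_le_mul_of_nonneg_right h3 hZ
  have h6 := mul_le_mul_of_nonneg_left h4 (show 0 ≤ 2 * a * Z by positivity)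
  have e : potDeriv a v z = -(3 * Real.sqrt 2 * SPolar z v)
      + 2 * a * (‖v‖ ^ 2 - 1) * inner ℝ v z := by rw [potDeriv]; ring
  rw [e]
  refine (abs_add_le _ _).trans ?_
  rw [abs_neg]
  linarith

theorem continuous_potDeriv (a : ℝ) : Continuous (Function.uncurry (potDeriv a)) := by
  have h := fun j => (contDiff_coord (n := 5) j).continuous.comp (continuous_fst (Y := E 5))
  have h' := fun j => (contDiff_coord (n := 5) j).continuous.comp (continuous_snd (X := E 5))
  have hs : Continuous fun q : E 5 × E 5 => SPolar q.2 q.1 := by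
    simp only [Function.comp_def] at h h'
    unfold SPolar
    fun_prop
  exact (continuous_const.mul hs).add ((continuous_const.mul
    ((continuous_fst.norm.pow 2).sub continuous_const)).mul (continuous_fst.inner continuous_snd))

theorem eq_zero_of_forall_mul_le {A B : ℝ} (h : ∀ t : ℝ, |t| ≤ 1 → 0 ≤ t * A + t ^ 2 * B) :
    A = 0 := by
  have h1 : ∀ A : ℝ, (∀ t : ℝ, 0 < t → t ≤ 1 → 0 ≤ t * A + t ^ 2 * B) → 0 ≤ A := fun A h => by
    by_contra hA
    push Not at hA
    have hB : 0 < |B| + 1 := by positivity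
    -- With this `t` the quadratic term is at most half of `|A| t`, too small to compensate a
    -- negative linear term.
    set t := min 1 (-A / (2 * (|B| + 1))) with ht
    have ht0 : 0 < t := lt_min one_pos (div_pos (by linarith) (by positivity))
    have h2 := h t ht0 (min_le_left _ _)
    have h3 : t * (2 * (|B| + 1)) ≤ -A := by
      rw [← le_div_iff₀ (by positivity)]; exact min_le_right _ _
    have h4 : 0 ≤ A + t * B := by
      have : t * (A + t * B) = t * A + t ^ 2 * B := by ring
      exact nonneg_of_mul_nonneg_right (this ▸ h2) ht0
    nlinarith [le_abs_self B, mul_nonneg ht0.le (abs_nonneg B),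
      mul_le_mul_of_nonneg_left (le_abs_self B) ht0.le]
  refine le_antisymm ?_ (h1 A fun t h0 h1 => h t (by rwa [abs_of_pos h0]))
  have := h1 (-A) fun t h0 h1 => by
    have := h (-t) (by rwa [abs_neg, abs_of_pos h0])
    linarith [neg_sq t]
  linarith

variable {a μ : ℝ} {w : E 3 → E 5} {V : Fin 5 → E 3 → ℝ} {G : Fin 5 → E 3 → E 3} {C : Set ℝ}
  {ζ : Fin 5 → E 3 → ℝ}

/-- The field with the components `ζ`. -/
noncomputable def toField (ζ : Fin 5 → E 3 → ℝ) (x : E 3) : E 5 := WithLp.toLp 2 fun k => ζ k x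

theorem IsRep.add_test (h : IsRep a w V G) (hζ : ∀ k, IsTest ball₁ (ζ k)) (t : ℝ) :
    IsRep a (fun x => w x + t • toField ζ x) (fun k x => V k x + t * ζ k x)
      (fun k x => G k x + t • grd (ζ k) x) := by
  refine ⟨fun k => (h.isH10 k).add ((isTest_ball_isH10 (hζ k)).const_mul t), fun k => ?_⟩
  filter_upwards [h.eq_add k] with x hx
  simp only [PiLp.add_apply, PiLp.smul_apply, smul_eq_mul, hx, toField]; ring

theorem continuous_toField (hζ : ∀ k, IsTest ball₁ (ζ k)) : Continuous (toField ζ) :=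
  (PiLp.continuous_toLp 2 _).comp (continuous_pi fun k => (hζ k).continuous)

theorem exists_toField_bound (hζ : ∀ k, IsTest ball₁ (ζ k)) :
    ∃ Z, 0 ≤ Z ∧ ∀ x, ‖toField ζ x‖ ≤ Z := by
  choose B hB using fun k => (hζ k).exists_bound
  refine ⟨∑ k, |B k|, Finset.sum_nonneg fun k _ => abs_nonneg _, fun x => ?_⟩
  refine (sq_le_sq₀ (norm_nonneg _) (Finset.sum_nonneg fun k _ => abs_nonneg _)).1 ?_
  rw [EuclideanSpace.norm_sq_eq]
  refine le_trans (Finset.sum_le_sum fun k _ => ?_)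
    (Finset.sum_sq_le_sq_sum_of_nonneg fun k _ => abs_nonneg (B k))
  exact pow_le_pow_left₀ (norm_nonneg _) ((hB k x).trans (le_abs_self _)) 2

/-- A perturbation whose third component vanishes on the plane leaves the trace unchanged. The
obstacle is then invisible and `t` may have either sign. -/
theorem Obst.add_test (ha : 0 < a) (hμ : 0 < μ) (hw : w ∈ Obst a μ C) (h : IsRep a w V G)
    (hζ : ∀ k, IsTest ball₁ (ζ k)) (hT : ∀ x, ζ 2 (planeProj x) = 0)
    (hax : IsRAxial (toField ζ)) (t : ℝ) : (fun x => w x + t • toField ζ x) ∈ Obst a μ C := by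
  have hr := h.add_test hζ t
  have hax' := hw.1.2.add (hax.const_smul t)
  obtain ⟨s, hs, hsC⟩ := hw.2
  refine ⟨⟨hr.memF ?_ hax'.exists_isAug, hax'⟩, _, hs.add
    (((isTest_ball_isH10 (hζ 2)).hasTraceOnT (ae_eq_refl _)).const_mul t), ?_⟩
  · rw [integrable_pot_iff ha hr.aestronglyMeasurable]
    have i1 := (integrable_pot_iff ha h.aestronglyMeasurable).1 (Obst.integrable_pot hμ hw h)
    obtain ⟨Z, hZ, hb⟩ := exists_toField_bound hζ
    refine ((i1.const_mul 8).add (integrable_const (8 * (|t| * Z) ^ 4))).mono'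
      (hr.aestronglyMeasurable.norm.pow 4) (Eventually.of_forall fun x => ?_)
    rw [Real.norm_of_nonneg (by positivity)]
    have h1 : ‖w x + t • toField ζ x‖ ≤ ‖w x‖ + |t| * Z := by
      refine (norm_add_le _ _).trans ?_
      rw [norm_smul, Real.norm_eq_abs]
      have := hb x
      gcongr
    have h2 := add_pow_le (norm_nonneg (w x)) (show 0 ≤ |t| * Z by positivity) 4
    norm_num at h2
    simp only [Pi.add_apply]
    calc ‖w x + t • toField ζ x‖ ^ 4 ≤ (‖w x‖ + |t| * Z) ^ 4 := by gcongr
      _ ≤ _ := by linarith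
  · filter_upwards [hsC] with x hx
    rwa [flatTrace_grd ((hζ 2).mono (subset_univ _)), hT, mul_zero, add_zero]

theorem aestronglyMeasurable_potDeriv {ν : Measure (E 3)} {f g : E 3 → E 5}
    (hf : AEStronglyMeasurable f ν) (hg : AEStronglyMeasurable g ν) :
    AEStronglyMeasurable (fun x => potDeriv a (f x) (g x)) ν :=
  (continuous_potDeriv a).comp_aestronglyMeasurable₂ hf hg

theorem integrable_potDeriv (ha : 0 < a) (h : IsRep a w V G)
    (h4 : IntegrableOn (fun x => ‖w x‖ ^ 4) ball₁) (hζ : ∀ k, IsTest ball₁ (ζ k)) :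
    IntegrableOn (fun x => potDeriv a (w x) (toField ζ x)) ball₁ := by
  obtain ⟨Z, hZ, hb⟩ := exists_toField_bound hζ
  obtain ⟨K, hK⟩ := exists_potDeriv_bound ha hZ
  have m2 : AEStronglyMeasurable (fun x => potDeriv a (w x) (toField ζ x))
      (volume.restrict ball₁) :=
    aestronglyMeasurable_potDeriv h.aestronglyMeasurable
      (continuous_toField hζ).aestronglyMeasurable
  have i1 : IntegrableOn (fun x => K * (1 + ‖w x‖ ^ 4)) ball₁ :=
    ((integrable_const (1 : ℝ)).fun_add h4).const_mul K
  exact i1.mono' m2 (Eventually.of_forall fun x => hK _ _ (hb x))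

theorem inner_eq_sum {n : ℕ} (x y : E n) : (inner ℝ x y : ℝ) = ∑ i, x i * y i := by
  rw [PiLp.inner_apply]
  exact Finset.sum_congr rfl fun i _ => mul_comm _ _

theorem integrable_inner_of_memLp {n : ℕ} {ν : Measure (E n)} {f g : E n → E n} (hf : MemLp f 2 ν)
    (hg : MemLp g 2 ν) : Integrable (fun x => (inner ℝ (f x) (g x) : ℝ)) ν := by
  simp_rw [inner_eq_sum]
  exact integrable_finsetSum _ fun i _ => (memLp_apply hf i).integrable_mul (memLp_apply hg i)

/-- The weak Euler-Lagrange equation of a minimizer. -/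
theorem IsMinimizer.first_variation (ha : 0 < a) (hμ : 0 < μ) (hm : IsMinimizer a μ (Obst a μ C) w)
    (h : IsRep a w V G) (hζ : ∀ k, IsTest ball₁ (ζ k)) (hT : ∀ x, ζ 2 (planeProj x) = 0)
    (hax : IsRAxial (toField ζ)) :
    2 * (∑ k, ∫ x in ball₁, inner ℝ (grd (comp a k) x + G k x) (grd (ζ k) x))
      + μ * ∫ x in ball₁, potDeriv a (w x) (toField ζ x) = 0 := by
  have hp := Obst.integrable_pot hμ hm.1 h
  have i4 := (integrable_pot_iff ha h.aestronglyMeasurable).1 hp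
  have iD := integrable_potDeriv ha h i4 hζ
  obtain ⟨Z, hZ, hb⟩ := exists_toField_bound hζ
  obtain ⟨K, hK0, hK⟩ := exists_pot_expansion ha hZ
  have i2 : IntegrableOn (fun x => K * (1 + ‖w x‖ ^ 2)) ball₁ :=
    ((integrable_const (1 : ℝ)).fun_add h.memLp.norm.integrable_sq).const_mul K
  have mζ : ∀ k, MemLp (grd (ζ k)) 2 (volume.restrict ball₁) := fun k =>
    integrable_ball₁_of_continuous (continuous_grd (hζ k).1)
  refine eq_zero_of_forall_mul_le (B := (∑ k, ∫ x in ball₁, ‖grd (ζ k) x‖ ^ 2)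
    + μ * ∫ x in ball₁, K * (1 + ‖w x‖ ^ 2)) fun t ht => ?_
  have hr := h.add_test hζ t
  have hmem := Obst.add_test ha hμ hm.1 h hζ hT hax t
  have hpt := Obst.integrable_pot hμ hmem hr
  have hle : energy a μ w ≤ energy a μ (fun x => w x + t • toField ζ x) := hm.2 hmem
  rw [h.energy_eq hp, hr.energy_eq hpt] at hle
  have e1 : ∀ k, ∫ x in ball₁, ‖grd (comp a k) x + (G k x + t • grd (ζ k) x)‖ ^ 2
      = (∫ x in ball₁, ‖grd (comp a k) x + G k x‖ ^ 2)
        + (2 * t * (∫ x in ball₁, inner ℝ (grd (comp a k) x + G k x) (grd (ζ k) x))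
          + t ^ 2 * ∫ x in ball₁, ‖grd (ζ k) x‖ ^ 2) := fun k => by
    have j1 : IntegrableOn (fun x => (inner ℝ (grd (comp a k) x + G k x) (grd (ζ k) x) : ℝ)) ball₁ :=
      integrable_inner_of_memLp (memLp_grd_add h k) (mζ k)
    have j2 : IntegrableOn (fun x => ‖grd (ζ k) x‖ ^ 2) ball₁ := (mζ k).norm.integrable_sq
    rw [← integral_const_mul, ← integral_const_mul, ← integral_add (j1.const_mul _) (j2.const_mul _),
      ← integral_add (h.integrable_grad_sq k) ((j1.const_mul _).fun_add (j2.const_mul _))]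
    refine integral_congr_ae (Eventually.of_forall fun x => ?_)
    simp only
    rw [← add_assoc, norm_add_sq_real, real_inner_smul_right, norm_smul, mul_pow, Real.norm_eq_abs,
      sq_abs]
    ring
  have e2 : ∫ x in ball₁, pot a (w x + t • toField ζ x) ≤ (∫ x in ball₁, pot a (w x))
      + t * (∫ x in ball₁, potDeriv a (w x) (toField ζ x))
      + t ^ 2 * ∫ x in ball₁, K * (1 + ‖w x‖ ^ 2) := by
    rw [← integral_const_mul, ← integral_const_mul, ← integral_add hp (iD.const_mul t),
      ← integral_add (hp.fun_add (iD.const_mul t)) (i2.const_mul _)]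
    exact integral_mono hpt ((hp.fun_add (iD.const_mul t)).fun_add (i2.const_mul _))
      fun x => hK _ _ (hb x) t ht
  simp_rw [e1] at hle
  rw [Finset.sum_add_distrib, Finset.sum_add_distrib, ← Finset.mul_sum, ← Finset.mul_sum] at hle
  have e3 := mul_le_mul_of_nonneg_left e2 hμ.le
  linarith

end Variation

/-! ### The reduced first variation -/

section ReducedVariation

open Filter Topology

/-- The derivative of `P` at `u` in the direction `η`. -/
noncomputable def PDeriv (u η : E 3) : ℝ :=
  -2 * u 0 * u 1 * η 0 - u 0 ^ 2 * η 1 + Real.sqrt 3 / 2 * (u 2 ^ 2 * η 0 + 2 * u 0 * u 2 * η 2)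
    + u 1 ^ 2 * η 1 + 1 / 2 * (u 2 ^ 2 * η 1 + 2 * u 1 * u 2 * η 2)

theorem P_add_smul (u η : E 3) (t : ℝ) :
    P (u + t • η) = P u + t * PDeriv u η + t ^ 2 * PDeriv η u + t ^ 3 * P η := by
  simp only [P, PDeriv, PiLp.add_apply, PiLp.smul_apply, smul_eq_mul]; ring

theorem differentiable_P : Differentiable ℝ P := by
  have h := fun j => (contDiff_coord (n := 3) j).differentiable (by simp : (∞ : WithTop ℕ∞) ≠ 0)
  unfold P
  fun_prop

theorem inner_gradient_P (u η : E 3) : inner ℝ (gradient P u) η = PDeriv u η := by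
  have h1 : HasDerivAt (fun t : ℝ => P (u + t • η)) (PDeriv u η) 0 := by
    simp_rw [P_add_smul]
    have h2 := (((hasDerivAt_id (0 : ℝ)).mul_const (PDeriv u η)).const_add (P u)).fun_add
      (((hasDerivAt_id (0 : ℝ)).pow 2).mul_const (PDeriv η u))
    have h3 := h2.fun_add (((hasDerivAt_id (0 : ℝ)).pow 3).mul_const (P η))
    simpa using h3
  rw [gradient, InnerProductSpace.toDual_symm_apply,
    ← (differentiable_P u).lineDeriv_eq_fderiv, lineDeriv, h1.deriv]

/-- The derivative form of `S ∘ ℒ = P`: the angle enters only through powers of `cos² θ + sin² θ`.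
-/
theorem SPolar_aug (u η : E 3) (θ : ℝ) : SPolar (aug η θ) (aug u θ) = PDeriv u η := by
  have hX := Real.cos_sq_add_sin_sq θ
  have e : SPolar (aug η θ) (aug u θ)
      = (-(η 1 * u 0 ^ 2) - 2 * u 0 * u 1 * η 0
          + Real.sqrt 3 / 2 * (u 2 ^ 2 * η 0 + 2 * u 0 * u 2 * η 2))
          * (Real.cos θ ^ 2 + Real.sin θ ^ 2) ^ 2
        + (1 / 2 * (u 2 ^ 2 * η 1 + 2 * u 1 * u 2 * η 2)) * (Real.cos θ ^ 2 + Real.sin θ ^ 2)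
        + u 1 ^ 2 * η 1 := by
    simp only [SPolar, aug_apply, augTrig, augIdx, Real.cos_two_mul', Real.sin_two_mul]
    simp only [Matrix.cons_val_zero, Matrix.cons_val_one, Matrix.cons_val]
    ring
  rw [e, hX, PDeriv]; ring

theorem inner_aug (u η : E 3) (θ : ℝ) : (inner ℝ (aug u θ) (aug η θ) : ℝ) = inner ℝ u η := by
  rw [inner_eq_sum, inner_eq_sum, Fin.sum_univ_five, Fin.sum_univ_three]
  have h1 := Real.sin_sq_add_cos_sq (2 * θ)
  have h2 := Real.sin_sq_add_cos_sq θ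
  simp [aug]
  linear_combination u 0 * η 0 * h1 + u 2 * η 2 * h2

/-- The derivative of the reduced potential. -/
noncomputable def redDeriv (a : ℝ) (u η : E 3) : ℝ :=
  3 / Real.sqrt 2 * PDeriv u η - a * (‖u‖ ^ 2 - 1) * inner ℝ u η

theorem redDeriv_eq (a : ℝ) (u η : E 3) : redDeriv a u η = inner ℝ
    ((3 / Real.sqrt 2) • gradient P u - (a * (‖u‖ ^ 2 - 1)) • u) η := by
  rw [inner_sub_left, real_inner_smul_left, real_inner_smul_left, inner_gradient_P, redDeriv]

/-- The factor `-2` matches the `2` in front of the Dirichlet pairing in the first variation, and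
`3√2 = 2 · 3/√2` explains the coefficient of `P` in the reduced system. -/
theorem potDeriv_augField (a : ℝ) (u η : E 2 → E 3) (x : E 3) :
    potDeriv a (augField u x) (augField η x)
      = -2 * redDeriv a (u (meridian x)) (η (meridian x)) := by
  have h2 : 3 / Real.sqrt 2 = 3 * Real.sqrt 2 / 2 := by
    have : Real.sqrt 2 * Real.sqrt 2 = 2 := Real.mul_self_sqrt (by norm_num)
    field_simp
    linarith
  rw [potDeriv, norm_augField, redDeriv, h2]
  simp only [augField]
  rw [SPolar_aug, inner_aug]
  ring

/-- The product of the angular derivative of a trigonometric factor with a radial test function. -/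
noncomputable def perpTest (k : Fin 5) (ψ : E 2 → ℝ) (x : E 3) : ℝ :=
  augPerp k x * (((meridian x 0)⁻¹) ^ (augDeg (augIdx k) + 2) * ψ (meridian x))

variable {ψ : E 2 → ℝ} {W : Set (E 2)}

theorem isTest_perpTest (hW : W ⊆ rightHalf) (hWo : IsOpen W) (h : IsTest W ψ) (k : Fin 5) :
    IsTest (meridian ⁻¹' W) (perpTest k ψ) :=
  ((h.inv_pow_mul hW hWo _).comp_meridian hW).mul_left (contDiff_augPerp k)

/-- The operator `x₁ ∂₂ - x₂ ∂₁` is `∂_θ` and annihilates functions of `(ρ, z)`. Two angular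
derivatives of a trigonometric factor give `-m²`, the source of the coefficients `4, 0, 1` in the
reduced system. -/
theorem pd_perpTest (h : IsTest rightHalf ψ) (k : Fin 5) (x : E 3) :
    pd 1 (fun y => y 0 * perpTest k ψ y) x - pd 0 (fun y => y 1 * perpTest k ψ y) x
      = -(augDeg (augIdx k) : ℝ) ^ 2 * axTest 2 k ψ x := by
  have hd := fun j => (contDiff_coord (n := 3) j).differentiable (by simp) x
  have h1 := h.inv_pow_mul subset_rfl isOpen_rightHalf (augDeg (augIdx k) + 2)
  have ht : DifferentiableAt ℝ (perpTest k ψ) x :=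
    (isTest_perpTest subset_rfl isOpen_rightHalf h k).differentiableAt
  have hp : ∀ i, pd i (perpTest k ψ) x = augPerp k x * pd i (fun y => ((meridian y 0)⁻¹)
      ^ (augDeg (augIdx k) + 2) * ψ (meridian y)) x
      + pd i (augPerp k) x * (((meridian x 0)⁻¹) ^ (augDeg (augIdx k) + 2) * ψ (meridian x)) :=
    fun i => pd_mul ((contDiff_augPerp k).differentiable (by simp) x)
      (h1.comp_meridian subset_rfl).differentiableAt
  rw [pd_mul (hd 0) ht, pd_mul (hd 1) ht, pd_coord, pd_coord, hp, hp, pd_comp_meridian h1,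
    pd_comp_meridian h1, axTest]
  simp only [Fin.reduceEq, if_false]
  linear_combination (((meridian x 0)⁻¹) ^ (augDeg (augIdx k) + 2) * ψ (meridian x))
    * augPerp_perp k x

theorem isTest_coord_mul {n : ℕ} {U : Set (E n)} {φ : E n → ℝ} (h : IsTest U φ) (i : Fin n) :
    IsTest U fun p => p i * φ p := h.mul_left (contDiff_coord i)

/-- Splitting of the Dirichlet pairing into its radial, angular and vertical parts. -/
theorem sum_mul_pd_axTest (h : IsTest rightHalf ψ) (g : Fin 5 → E 3 → E 3) (k : Fin 5) (x : E 3) :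
    ∑ i, g k x i * pd i (axTest 0 k ψ) x = radial g k x * axTest 1 k (fun p => p 0 * pd 0 ψ p) x
      + g k x 2 * axTest 1 k (fun p => p 0 * pd 1 ψ p) x
      + (g k x 1 * (x 0 * perpTest k ψ x) - g k x 0 * (x 1 * perpTest k ψ x)) := by
  rw [Fin.sum_univ_three, pd_two_axTest h, pd_axTest h _ _ _ (by decide),
    pd_axTest h _ _ _ (by decide)]
  by_cases hx : 0 < meridian x 0
  · rw [axTest_eq (isTest_coord_mul (h.pd 1) 0), axTest_eq (h.pd 1)]
    have he := augPoly_euler k x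
    have hpp := augPoly_perp k x
    have hm := meridian_zero_sq x
    have hc := meridian_mul_cos x
    have hs := meridian_mul_sin x
    simp only [axTest, perpTest, radial, add_zero]
    set r := meridian x 0
    have hr : r ≠ 0 := hx.ne'
    rw [pow_succ, pow_add]
    generalize (r⁻¹) ^ augDeg (augIdx k) = A
    -- The Euler identity and the angular derivative give the radial and tangential components of
    -- the gradient of `augPoly`; the next two identities solve for its Cartesian components.
    have hq0 : r ^ 2 * pd 0 (augPoly k) x
        = x 0 * (augDeg (augIdx k) * augPoly k x) - x 1 * augPerp k x := by
      rw [← he, ← hpp, hm]; ring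
    have hq1 : r ^ 2 * pd 1 (augPoly k) x
        = x 1 * (augDeg (augIdx k) * augPoly k x) + x 0 * augPerp k x := by
      rw [← he, ← hpp, hm]; ring
    have hq0' : pd 0 (augPoly k) x
        = (x 0 * (augDeg (augIdx k) * augPoly k x) - x 1 * augPerp k x) / r ^ 2 := by
      rw [← hq0]; field_simp
    have hq1' : pd 1 (augPoly k) x
        = (x 1 * (augDeg (augIdx k) * augPoly k x) + x 0 * augPerp k x) / r ^ 2 := by
      rw [← hq1]; field_simp
    have hc' : Real.cos (azimuth x) = x 0 / r := by rw [← hc]; field_simp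
    have hs' : Real.sin (azimuth x) = x 1 / r := by rw [← hs]; field_simp
    rw [hq0', hq1', hc', hs']
    field_simp
    ring
  · simp [axTest, perpTest, h.eq_zero_of_notMem hx, (h.pd 0).eq_zero_of_notMem hx,
      (h.pd 1).eq_zero_of_notMem hx]

variable {f : Fin 5 → E 3 → ℝ} {g : Fin 5 → E 3 → E 3} {U : Set (E 3)}

/-- The angular part of the pairing is integrated by parts in `θ`, so it involves `f` itself and no
angular derivative of `f` has to be identified. -/
theorem integral_sum_mul_pd_axTest (h : ∀ k, WeakPair U (f k) (g k)) (hW : IsOpen W)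
    (hWr : W ⊆ rightHalf) (hWU : meridian ⁻¹' W ⊆ U) (hψ : IsTest W ψ) (k : Fin 5) :
    ∫ x, ∑ i, g k x i * pd i (axTest 0 k ψ) x
      = (∫ x, radial g k x * axTest 1 k (fun p => p 0 * pd 0 ψ p) x)
        + (∫ x, g k x 2 * axTest 1 k (fun p => p 0 * pd 1 ψ p) x)
        + (augDeg (augIdx k) : ℝ) ^ 2 * ∫ x, f k x * axTest 1 k (fun p => (p 0)⁻¹ ^ 1 * ψ p) x := by
  have hψ' := hψ.mono hWr
  have hP := (isTest_perpTest hWr hW hψ k).mono hWU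
  have hP' := fun i => isTest_coord_mul hP i
  have hA : ∀ i, IsTest rightHalf fun p => p 0 * pd i ψ p := fun i => isTest_coord_mul (hψ'.pd i) 0
  have i1 : Integrable fun x => radial g k x * axTest 1 k (fun p => p 0 * pd 0 ψ p) x :=
    integrable_mul_test (integrable_radial (fun k => (h k).integrable_grad) k)
      (isTest_axTest subset_rfl isOpen_rightHalf (hA 0) 1 k)
  have i2 : Integrable fun x => g k x 2 * axTest 1 k (fun p => p 0 * pd 1 ψ p) x :=
    integrable_mul_test (integrable_apply (h k).integrable_grad 2)
      (isTest_axTest subset_rfl isOpen_rightHalf (hA 1) 1 k)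
  have i3 := integrable_mul_test (integrable_apply (h k).integrable_grad 1) (hP' 0)
  have i4 := integrable_mul_test (integrable_apply (h k).integrable_grad 0) (hP' 1)
  have i5 := integrable_mul_test (h k).integrable ((hP' 0).pd 1)
  have i6 := integrable_mul_test (h k).integrable ((hP' 1).pd 0)
  have i34 : Integrable fun x => g k x 1 * (x 0 * perpTest k ψ x)
      - g k x 0 * (x 1 * perpTest k ψ x) := i3.sub i4
  simp_rw [sum_mul_pd_axTest hψ' g k]
  rw [integral_add (i1.fun_add i2) i34, integral_add i1 i2, integral_sub i3 i4]
  congr 1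
  have e1 := (h k).integral_eq _ (hP' 0) 1
  have e2 := (h k).integral_eq _ (hP' 1) 0
  have e3 : (∫ x, g k x 1 * (x 0 * perpTest k ψ x)) - ∫ x, g k x 0 * (x 1 * perpTest k ψ x)
      = -((∫ x, f k x * pd 1 (fun y => y 0 * perpTest k ψ y) x)
        - ∫ x, f k x * pd 0 (fun y => y 1 * perpTest k ψ y) x) := by rw [e1, e2]; ring
  rw [e3, ← integral_sub i5 i6, ← integral_neg, ← integral_const_mul]
  refine integral_congr_ae (Eventually.of_forall fun x => ?_)
  have e4 := pd_perpTest hψ' k x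
  have e5 : axTest 1 k (fun p => (p 0)⁻¹ ^ 1 * ψ p) x = axTest 2 k ψ x := by
    rw [axTest_eq (hψ'.inv_pow_mul subset_rfl isOpen_rightHalf 1), axTest_eq hψ']; ring
  simp only [e5]
  linear_combination (-f k x) * e4

/-- The Dirichlet pairing in terms of the profile. -/
theorem sum_integral_pd_axTest (h : ∀ k, WeakPair U (f k) (g k)) (hW : IsOpen W)
    (hWr : W ⊆ rightHalf) (hWU : meridian ⁻¹' W ⊆ U) (hψ : IsTest W ψ) {j : Fin 3} {u : E 2 → ℝ}
    (hu : ∀ᵐ x, augProj j f x = u (meridian x)) :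
    ∑ k with augIdx k = j, ∫ x, ∑ i, g k x i * pd i (axTest 0 k ψ) x
      = 2 * Real.pi * ∫ p in W, (p 0 * (∑ i, augGrad g j p i * pd i ψ p)
        + (p 0)⁻¹ * ((augDeg j : ℝ) ^ 2 * (u p * ψ p))) := by
  have hπ := Real.pi_pos
  have hψ' := hψ.mono hWr
  have hA : ∀ i, IsTest rightHalf fun p => p 0 * pd i ψ p := fun i => isTest_coord_mul (hψ'.pd i) 0
  have hB := hψ'.inv_pow_mul subset_rfl isOpen_rightHalf 1
  have hwg := hasWeakGradient_augGrad h hW hWr hWU hu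
  have hA' : ∀ i, IsTest W fun p => p 0 * pd i ψ p := fun i => isTest_coord_mul (hψ.pd i) 0
  have hB' := hψ.inv_pow_mul hWr hW 1
  have i0 := integrableOn_mul_test (locallyIntegrableOn_apply hwg.locInt_grad 0) (hA' 0)
  have i1 := integrableOn_mul_test (locallyIntegrableOn_apply hwg.locInt_grad 1) (hA' 1)
  have i2 := integrableOn_mul_test hwg.locInt hB'
  have p0 := integral_avg_augProj_mul (integrable_radial fun k => (h k).integrable_grad) j (hA 0)
  have p1 := integral_avg_augProj_mul (fun k => integrable_apply (h k).integrable_grad 2) j (hA 1)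
  have p2 := integral_avg_augProj_mul (fun k => (h k).integrable) j hB
  have e1 : ∀ k ∈ Finset.univ.filter (fun k => augIdx k = j),
      ∫ x, ∑ i, g k x i * pd i (axTest 0 k ψ) x
      = (∫ x, radial g k x * axTest 1 k (fun p => p 0 * pd 0 ψ p) x)
        + (∫ x, g k x 2 * axTest 1 k (fun p => p 0 * pd 1 ψ p) x)
        + (augDeg j : ℝ) ^ 2 * ∫ x, f k x * axTest 1 k (fun p => (p 0)⁻¹ ^ 1 * ψ p) x :=
    fun k hk => by
      rw [integral_sum_mul_pd_axTest h hW hWr hWU hψ k, (Finset.mem_filter.1 hk).2]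
  rw [Finset.sum_congr rfl e1, Finset.sum_add_distrib, Finset.sum_add_distrib, ← Finset.mul_sum]
  have q : ∀ {A B : ℝ}, A = (2 * Real.pi)⁻¹ * B → B = 2 * Real.pi * A := fun hAB => by
    rw [hAB, mul_inv_cancel_left₀ (by positivity)]
  rw [q p0, q p1, q p2]
  have r0 : ∫ p in rightHalf, avg (augProj j (radial g)) p * (p 0 * pd 0 ψ p)
      = ∫ p in W, augGrad g j p 0 * (p 0 * pd 0 ψ p) := by
    rw [(hA' 0).setIntegral_mul_eq hWr, (hA' 0).setIntegral_eq (f := fun p => augGrad g j p 0)]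
    rfl
  have r1 : ∫ p in rightHalf, avg (augProj j fun k x => g k x 2) p * (p 0 * pd 1 ψ p)
      = ∫ p in W, augGrad g j p 1 * (p 0 * pd 1 ψ p) := by
    rw [(hA' 1).setIntegral_mul_eq hWr, (hA' 1).setIntegral_eq (f := fun p => augGrad g j p 1)]
    rfl
  have r2 : ∫ p in rightHalf, avg (augProj j f) p * ((p 0)⁻¹ ^ 1 * ψ p)
      = ∫ p in W, u p * ((p 0)⁻¹ ^ 1 * ψ p) := by
    have : ∫ p in rightHalf, avg (augProj j f) p * ((p 0)⁻¹ ^ 1 * ψ p)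
        = ∫ p in rightHalf, u p * ((p 0)⁻¹ ^ 1 * ψ p) := by
      refine integral_congr_ae ?_
      filter_upwards [avg_ae_eq hu] with p hp
      rw [hp]
    rw [this, hB'.setIntegral_mul_eq hWr, hB'.setIntegral_eq]
  have key : ∫ p in W, (p 0 * (∑ i, augGrad g j p i * pd i ψ p)
        + (p 0)⁻¹ * ((augDeg j : ℝ) ^ 2 * (u p * ψ p)))
      = (∫ p in W, augGrad g j p 0 * (p 0 * pd 0 ψ p))
        + (∫ p in W, augGrad g j p 1 * (p 0 * pd 1 ψ p))
        + (augDeg j : ℝ) ^ 2 * ∫ p in W, u p * ((p 0)⁻¹ ^ 1 * ψ p) := by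
    rw [← integral_add i0 i1, ← integral_const_mul,
      ← integral_add (i0.fun_add i1) (i2.const_mul _)]
    refine integral_congr_ae (Eventually.of_forall fun p => ?_)
    simp only [Fin.sum_univ_two]
    ring
  rw [r0, r1, r2, key]
  ring

end ReducedVariation

/-! ### The reflection in the plane `z = 0` -/

section Reflection

open Filter Topology

/-- The sign of the `i`-th coordinate under the reflection. -/
def reflSign (i : Fin 2) : ℝ := ![1, -1] i

/-- The parity of the `j`-th component of the profile. -/
def parity (j : Fin 3) : ℝ := ![1, 1, -1] j

/-- The reflection `(ρ, z) ↦ (ρ, -z)`. -/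
noncomputable def reflect : E 2 ≃ₗᵢ[ℝ] E 2 :=
  LinearIsometryEquiv.piLpCongrRight 2
    ![LinearIsometryEquiv.refl ℝ ℝ, LinearIsometryEquiv.neg ℝ]

theorem reflect_apply (p : E 2) (i : Fin 2) : reflect p i = reflSign i * p i := by
  fin_cases i <;> simp [reflect, reflSign]

theorem reflect_eq (p : E 2) : reflect p = !₂[p 0, -p 1] := by
  ext i
  rw [reflect_apply]
  fin_cases i <;> simp [reflSign]

theorem reflSign_mul_self (i : Fin 2) : reflSign i * reflSign i = 1 := by
  fin_cases i <;> simp [reflSign]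

theorem parity_mul_self (j : Fin 3) : parity j * parity j = 1 := by
  fin_cases j <;> simp [parity]

theorem reflect_reflect (p : E 2) : reflect (reflect p) = p := by
  ext i
  rw [reflect_apply, reflect_apply, ← mul_assoc, reflSign_mul_self, one_mul]

theorem reflect_mem_D (p : E 2) : reflect p ∈ D ↔ p ∈ D := by
  rw [reflect_eq]; simp [D]

theorem reflect_preimage_D : reflect ⁻¹' D = D := ext reflect_mem_D

theorem measurableEmbedding_reflect : MeasurableEmbedding reflect :=
  reflect.toHomeomorph.measurableEmbedding

theorem setIntegral_D_reflect (f : E 2 → ℝ) : ∫ p in D, f (reflect p) = ∫ p in D, f p := by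
  have := reflect.measurePreserving.setIntegral_preimage_emb measurableEmbedding_reflect f D
  rwa [reflect_preimage_D] at this

theorem integrableOn_D_reflect {F : Type*} [NormedAddCommGroup F] {f : E 2 → F}
    (hf : IntegrableOn f D) : IntegrableOn (fun p => f (reflect p)) D := by
  have := (reflect.measurePreserving.integrableOn_comp_preimage measurableEmbedding_reflect).2 hf
  rwa [reflect_preimage_D] at this

theorem IsTest.comp_reflect {U : Set (E 2)} {φ : E 2 → ℝ} (h : IsTest U φ) :
    IsTest (reflect ⁻¹' U) fun p => φ (reflect p) :=
  ⟨h.1.comp reflect.contDiff, h.2.1.comp_homeomorph reflect.toHomeomorph,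
    (tsupport_comp_subset_preimage φ reflect.continuous).trans (preimage_mono h.2.2)⟩

theorem pd_comp_reflect {φ : E 2 → ℝ} (h : Differentiable ℝ φ) (i : Fin 2) (p : E 2) :
    pd i (fun q => φ (reflect q)) p = reflSign i * pd i φ (reflect p) := by
  have h1 : reflect (EuclideanSpace.single i 1) = reflSign i • EuclideanSpace.single i (1 : ℝ) := by
    ext l
    rw [reflect_apply]
    by_cases hl : l = i
    · subst hl; simp
    · simp [hl]
  have h2 : HasFDerivAt (fun q => φ (reflect q))
      ((fderiv ℝ φ (reflect p)).comp (reflect : E 2 →L[ℝ] E 2)) p :=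
    (h (reflect p)).hasFDerivAt.comp p (reflect : E 2 →L[ℝ] E 2).hasFDerivAt
  rw [pd, h2.fderiv, pd]
  change fderiv ℝ φ (reflect p) (reflect (EuclideanSpace.single i 1)) = _
  rw [h1, map_smul, smul_eq_mul]

theorem locallyIntegrableOn_D_reflect {F : Type*} [NormedAddCommGroup F] {f : E 2 → F}
    (hf : LocallyIntegrableOn f D) : LocallyIntegrableOn (fun p => f (reflect p)) D := by
  intro x hx
  obtain ⟨s, hs, hi⟩ := hf (reflect x) ((reflect_mem_D x).2 hx)
  refine ⟨reflect ⁻¹' s, ?_, (reflect.measurePreserving.integrableOn_comp_preimage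
    measurableEmbedding_reflect).2 hi⟩
  exact (reflect.continuous.continuousWithinAt.tendsto_nhdsWithin
    fun p hp => (reflect_mem_D p).2 hp) hs

theorem HasWeakGradient.reflect {f : E 2 → ℝ} {g : E 2 → E 2} (h : HasWeakGradient D f g) :
    HasWeakGradient D (fun p => f (reflect p)) fun p => LdG.reflect (g (LdG.reflect p)) := by
  refine ⟨locallyIntegrableOn_D_reflect h.locInt, ?_, fun φ hφ i => ?_⟩
  · intro x hx
    obtain ⟨s, hs, hi⟩ := locallyIntegrableOn_D_reflect h.locInt_grad x hx
    exact ⟨s, hs, (LdG.reflect : E 2 →L[ℝ] E 2).integrable_comp hi⟩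
  · have hφ' : IsTest D fun p => φ (LdG.reflect p) := by
      have := hφ.comp_reflect
      rwa [reflect_preimage_D] at this
    have e1 := h.integral_eq _ hφ' i
    simp_rw [pd_comp_reflect hφ.differentiable] at e1
    rw [← setIntegral_D_reflect, ← setIntegral_D_reflect (fun p => g p i * _)] at e1
    simp only [reflect_reflect] at e1
    have e2 : ∀ p, f (LdG.reflect p) * pd i φ p
        = reflSign i * (f (LdG.reflect p) * (reflSign i * pd i φ p)) := fun p => by
      linear_combination (-(f (LdG.reflect p) * pd i φ p)) * reflSign_mul_self i
    simp_rw [e2, reflect_apply, mul_assoc]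
    rw [integral_const_mul, integral_const_mul, e1, mul_neg]

end Reflection

/-! ### The reduced Euler-Lagrange system -/

section EulerLagrange

open Filter Topology

variable {a μ : ℝ} {w : E 3 → E 5} {V : Fin 5 → E 3 → ℝ} {G : Fin 5 → E 3 → E 3} {C : Set ℝ}
  {u : E 2 → E 3} {ψ η : Fin 3 → E 2 → ℝ}

/-- The half disk without its axis of reflection. -/
def slitD : Set (E 2) := {p | p ∈ D ∧ p 1 ≠ 0}

theorem slitD_subset : slitD ⊆ D := fun _ hp => hp.1

theorem Dplus_subset_slitD : Dplus ⊆ slitD := fun _ hp => ⟨hp.1, hp.2.ne'⟩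

theorem reflect_preimage_slitD : reflect ⁻¹' slitD = slitD := by
  ext p
  simp only [slitD, mem_preimage, mem_ofPred_eq, reflect_mem_D, reflect_apply]
  simp [reflSign]

/-- The field on `ℝ³` with the profile `ψ`. -/
noncomputable def axField (ψ : Fin 3 → E 2 → ℝ) (k : Fin 5) : E 3 → ℝ := axTest 0 k (ψ (augIdx k))

/-- The profile with the components `ψ`. -/
noncomputable def toProf (ψ : Fin 3 → E 2 → ℝ) (p : E 2) : E 3 := WithLp.toLp 2 fun j => ψ j p

theorem isTest_axField (h : ∀ j, IsTest D (ψ j)) (k : Fin 5) : IsTest ball₁ (axField ψ k) :=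
  (isTest_axTest D_subset_rightHalf isOpen_D (h _) 0 k).mono meridian_preimage_D

theorem toField_axField (h : ∀ j, IsTest D (ψ j)) (x : E 3) :
    toField (axField ψ) x = augField (toProf ψ) x := by
  ext k
  rw [augField, aug_apply]
  simp only [toField, axField, toProf]
  rw [axTest_eq ((h _).mono D_subset_rightHalf), pow_zero, one_mul]

theorem isRAxial_axField (h : ∀ j, IsTest D (ψ j)) (hp : ∀ j p, ψ j (reflect p) = parity j * ψ j p) :
    IsRAxial (toField (axField ψ)) := by
  refine ⟨toProf ψ, Eventually.of_forall (toField_axField h), fun p _ => ?_⟩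
  rw [← reflect_eq]
  simp only [toProf, hp]
  simp [parity]

theorem sum_inner_axField (h : IsRep a w V G) (hu : IsAug w u) (hψ : ∀ j, IsTest D (ψ j)) :
    ∑ k, ∫ x in ball₁, inner ℝ (grd (comp a k) x + G k x) (grd (axField ψ k) x)
      = 2 * Real.pi * ∑ j, ∫ p in D, (p 0 * (∑ i, augGrad (extGrad a G) j p i * pd i (ψ j) p)
        + (p 0)⁻¹ * ((augDeg j : ℝ) ^ 2 * (u p j * ψ j p))) := by
  have e1 : ∀ k, ∫ x in ball₁, inner ℝ (grd (comp a k) x + G k x) (grd (axField ψ k) x)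
      = ∫ x, ∑ i, extGrad a G k x i * pd i (axTest 0 k (ψ (augIdx k))) x := fun k => by
    have hT := isTest_axField hψ k
    rw [← setIntegral_ball_eq fun x hx => Finset.sum_eq_zero fun i _ => by
      have := (hT.pd i).eq_zero_of_notMem hx
      rw [axField] at this
      rw [this, mul_zero]]
    refine setIntegral_congr_fun isOpen_ball₁.measurableSet fun x hx => ?_
    simp only [inner_eq_sum, extGrad, indicator_of_mem hx, grd_apply, axField]
  simp_rw [e1]
  -- The five components of the field are grouped by the profile component from which they arise.
  rw [← Finset.sum_fiberwise Finset.univ augIdx, Finset.mul_sum]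
  refine Finset.sum_congr rfl fun j _ => ?_
  have e2 := sum_integral_pd_axTest h.weakPair isOpen_D D_subset_rightHalf meridian_preimage_D
    (hψ j) (h.ae_augProj_extField hu j)
  rw [Finset.sum_congr rfl fun k hk => by rw [(Finset.mem_filter.1 hk).2], e2]
  congr 1
  refine setIntegral_congr_fun isOpen_D.measurableSet fun p hp => ?_
  rw [D_eq] at hp
  simp only [indicator_of_mem hp.2]

theorem redDeriv_zero (a : ℝ) (v : E 3) : redDeriv a v 0 = 0 := by simp [redDeriv, PDeriv]

theorem potDeriv_axField (ha : 0 < a) (h : IsRep a w V G)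
    (h4 : IntegrableOn (fun x => ‖w x‖ ^ 4) ball₁) (hu : IsAug w u) (hψ : ∀ j, IsTest D (ψ j)) :
    IntegrableOn (fun p => p 0 * redDeriv a (u p) (toProf ψ p)) D ∧
    ∫ x in ball₁, potDeriv a (w x) (toField (axField ψ) x)
      = 2 * Real.pi * (-2 * ∫ p in D, p 0 * redDeriv a (u p) (toProf ψ p)) := by
  have hi := integrable_potDeriv ha h h4 (isTest_axField hψ)
  have hF : Integrable (ball₁.indicator fun x => potDeriv a (w x) (toField (axField ψ) x)) :=
    (integrable_indicator_iff isOpen_ball₁.measurableSet).2 hi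
  have hae : ∀ᵐ x, ball₁.indicator (fun x => potDeriv a (w x) (toField (axField ψ) x)) x
      = (Metric.ball (0 : E 2) 1).indicator (fun p => -2 * redDeriv a (u p) (toProf ψ p))
        (meridian x) := by
    filter_upwards [(ae_restrict_iff' isOpen_ball₁.measurableSet).1 hu] with x hx
    by_cases hb : x ∈ ball₁
    · rw [indicator_of_mem hb, hx hb, toField_axField hψ, potDeriv_augField,
        indicator_of_mem (by rwa [mem_ball_zero_iff, ← mem_ball₁_iff_meridian])]
    · rw [indicator_of_notMem hb,
        indicator_of_notMem (by rwa [mem_ball_zero_iff, ← mem_ball₁_iff_meridian])]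
  have hae' := avg_ae_eq hae
  have e0 : ∀ᵐ p ∂volume.restrict rightHalf,
      p 0 * avg (ball₁.indicator fun x => potDeriv a (w x) (toField (axField ψ) x)) p
        = -2 * (D.indicator (fun p => p 0 * redDeriv a (u p) (toProf ψ p)) p) := by
    filter_upwards [hae', ae_restrict_mem isOpen_rightHalf.measurableSet] with p hp hpr
    rw [hp]
    by_cases hb : p ∈ Metric.ball (0 : E 2) 1
    · rw [indicator_of_mem hb, indicator_of_mem (by rw [D_eq]; exact ⟨hpr, hb⟩)]; ring
    · rw [indicator_of_notMem hb, indicator_of_notMem (by rw [D_eq]; exact fun h => hb h.2)]; simp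
  have e1 := integral_eq_integral_avg hF
  rw [integral_indicator isOpen_ball₁.measurableSet, integral_congr_ae e0, integral_const_mul,
    setIntegral_indicator isOpen_D.measurableSet,
    inter_eq_self_of_subset_right D_subset_rightHalf] at e1
  refine ⟨?_, e1⟩
  have i1 : IntegrableOn (fun p => -2 * D.indicator
      (fun p => p 0 * redDeriv a (u p) (toProf ψ p)) p) rightHalf :=
    (integrable_halfMeasure.1 (integrable_avg hF)).congr e0
  have i2 := (i1.mono_set D_subset_rightHalf).const_mul (-1 / 2)
  refine i2.congr ?_
  filter_upwards [ae_restrict_mem isOpen_D.measurableSet] with p hp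
  rw [indicator_of_mem hp]; ring

/-- The Euler-Lagrange equation for symmetric test functions. -/
theorem euler_lagrange_symm (ha : 0 < a) (hμ : 0 < μ) (hm : IsMinimizer a μ (Obst a μ C) w)
    (h : IsRep a w V G) (hu : IsAug w u) (hψ : ∀ j, IsTest slitD (ψ j))
    (hp : ∀ j p, ψ j (reflect p) = parity j * ψ j p) :
    ∑ j, ∫ p in D, (p 0 * (∑ i, augGrad (extGrad a G) j p i * pd i (ψ j) p)
        + (p 0)⁻¹ * ((augDeg j : ℝ) ^ 2 * (u p j * ψ j p)))
      = μ * ∫ p in D, p 0 * redDeriv a (u p) (toProf ψ p) := by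
  have hπ := Real.pi_pos
  have hψD := fun j => (hψ j).mono slitD_subset
  have i4 := (integrable_pot_iff ha h.aestronglyMeasurable).1 (Obst.integrable_pot hμ hm.1 h)
  -- The support of `ψ` avoids `z = 0`, so the variation does not touch the obstacle on `T`.
  have hT : ∀ x, axField ψ 2 (planeProj x) = 0 := fun x => by
    rw [axField, axTest, (hψ _).eq_zero_of_notMem fun hx => hx.2 (by
      rw [meridian_one, planeProj_apply]; simp)]
    simp
  have h1 := hm.first_variation ha hμ h (isTest_axField hψD) hT (isRAxial_axField hψD hp)
  rw [sum_inner_axField h hu hψD, (potDeriv_axField ha h i4 hu hψD).2] at h1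
  have h2 : (4 * Real.pi) * ((∑ j, ∫ p in D, (p 0 *
        (∑ i, augGrad (extGrad a G) j p i * pd i (ψ j) p)
        + (p 0)⁻¹ * ((augDeg j : ℝ) ^ 2 * (u p j * ψ j p))))
      - μ * ∫ p in D, p 0 * redDeriv a (u p) (toProf ψ p)) = 0 := by linarith
  have h3 := (mul_eq_zero.1 h2).resolve_left (by positivity)
  linarith

end EulerLagrange

/-! ### The weak reduced system in the upper quarter disk -/

section WeakSolution

open Filter Topology

variable {a μ : ℝ} {w : E 3 → E 5} {V : Fin 5 → E 3 → ℝ} {G : Fin 5 → E 3 → E 3} {C : Set ℝ}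
  {u : E 2 → E 3} {ψ : Fin 3 → E 2 → ℝ} {φ : E 2 → ℝ} {v : E 2 → ℝ} {g : E 2 → E 2}

theorem HasWeakGradient.const_mul {n : ℕ} {Ω : Set (E n)} {f : E n → ℝ} {F : E n → E n} (c : ℝ)
    (h : HasWeakGradient Ω f F) : HasWeakGradient Ω (fun x => c * f x) fun x => c • F x where
  locInt x hx := by
    obtain ⟨s, hs, hi⟩ := h.locInt x hx
    exact ⟨s, hs, hi.const_mul c⟩
  locInt_grad x hx := by
    obtain ⟨s, hs, hi⟩ := h.locInt_grad x hx
    exact ⟨s, hs, hi.smul c⟩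
  integral_eq φ hφ i := by
    simp only [PiLp.smul_apply, smul_eq_mul, mul_assoc, integral_const_mul, h.integral_eq φ hφ i]
    ring

theorem HasWeakGradient.mono {n : ℕ} {Ω Ω' : Set (E n)} {f : E n → ℝ} {F : E n → E n}
    (h : HasWeakGradient Ω f F) (hΩ : Ω' ⊆ Ω) : HasWeakGradient Ω' f F where
  locInt := h.locInt.mono_set hΩ
  locInt_grad := h.locInt_grad.mono_set hΩ
  integral_eq φ hφ i := by
    have := h.integral_eq φ (hφ.mono hΩ) i
    rwa [(hφ.pd i).setIntegral_mul_eq hΩ, hφ.setIntegral_mul_eq hΩ, ← (hφ.pd i).setIntegral_eq,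
      ← hφ.setIntegral_eq (f := fun x => F x i)] at this

/-- The weak gradient of an even or odd function is odd or even. -/
theorem HasWeakGradient.ae_reflect (h : HasWeakGradient D v g) {s : ℝ}
    (hs : s * s = 1) (hv : ∀ p ∈ D, v (LdG.reflect p) = s * v p) :
    ∀ᵐ p ∂volume.restrict D, ∀ i, g p i = s * (reflSign i * g (LdG.reflect p) i) := by
  have h1 := (h.reflect.const_mul s).congr (f' := v) (by
    filter_upwards [ae_restrict_mem isOpen_D.measurableSet] with p hp
    rw [hv p hp, ← mul_assoc, hs, one_mul]) (ae_eq_refl _)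
  filter_upwards [h.ae_eq' h1 isOpen_D] with p hp i
  rw [hp, PiLp.smul_apply, reflect_apply, smul_eq_mul]

/-- The density of the Dirichlet pairing of a profile of degree `m` with a test function. -/
noncomputable def redForm (g : E 2 → E 2) (v : E 2 → ℝ) (m : ℕ) (φ : E 2 → ℝ) (p : E 2) : ℝ :=
  p 0 * (∑ i, g p i * pd i φ p) + (p 0)⁻¹ * ((m : ℝ) ^ 2 * (v p * φ p))

theorem integrableOn_redForm (h : HasWeakGradient D v g) (hφ : IsTest D φ) (m : ℕ) :
    IntegrableOn (redForm g v m φ) D := by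
  have h1 := fun i => integrableOn_mul_test (locallyIntegrableOn_apply h.locInt_grad i)
    (isTest_coord_mul (hφ.pd i) 0)
  have h2 := integrableOn_mul_test h.locInt (hφ.inv_pow_mul D_subset_rightHalf isOpen_D 1)
  have h3 := ((integrable_finsetSum Finset.univ fun i _ => h1 i).fun_add
    (h2.const_mul ((m : ℝ) ^ 2)))
  refine h3.congr (Eventually.of_forall fun p => ?_)
  simp only [redForm, Fin.sum_univ_two]; ring

/-- The symmetrization of a test function. -/
noncomputable def symTest (s : ℝ) (φ : E 2 → ℝ) (p : E 2) : ℝ := φ p + s * φ (reflect p)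

theorem isTest_symTest (h : IsTest Dplus φ) (s : ℝ) : IsTest slitD (symTest s φ) := by
  have h1 := h.mono Dplus_subset_slitD
  have h2 := h1.comp_reflect
  rw [reflect_preimage_slitD] at h2
  exact h1.add (h2.const_mul s)

/-- When `v` has parity `s`, the form of `s φ ∘ reflect` is the reflection of the form of `φ`, and
`D` is invariant under reflection. -/
theorem integral_redForm_symTest (h : HasWeakGradient D v g) {s : ℝ}
    (hs : s * s = 1) (hv : ∀ p ∈ D, v (reflect p) = s * v p) (hφ : IsTest Dplus φ) (m : ℕ) :
    ∫ p in D, redForm g v m (symTest s φ) p = 2 * ∫ p in D, redForm g v m φ p := by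
  have hi := integrableOn_redForm h (hφ.mono (Dplus_subset_slitD.trans slitD_subset)) m
  have hd := hφ.differentiable
  have hd' : Differentiable ℝ fun q => φ (reflect q) := hφ.comp_reflect.differentiable
  have e : ∀ᵐ p ∂volume.restrict D, redForm g v m (symTest s φ) p
      = redForm g v m φ p + redForm g v m φ (reflect p) := by
    filter_upwards [h.ae_reflect hs hv, ae_restrict_mem isOpen_D.measurableSet] with p hp hpD
    have e1 : ∀ i, g p i * pd i (symTest s φ) p
        = g p i * pd i φ p + g (reflect p) i * pd i φ (reflect p) := fun i => by
      have : pd i (symTest s φ) p = pd i φ p + s * (reflSign i * pd i φ (reflect p)) := by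
        rw [← pd_comp_reflect hd, ← pd_const_mul s (hd' p), ← pd_add (hd p) ((hd' p).const_mul s)]
        rfl
      rw [this, mul_add]
      nth_rewrite 2 [hp i]
      linear_combination (reflSign i * reflSign i * g (reflect p) i * pd i φ (reflect p)) * hs
        + (g (reflect p) i * pd i φ (reflect p)) * reflSign_mul_self i
    have e2 : reflect p 0 = p 0 := by rw [reflect_apply]; simp [reflSign]
    simp only [redForm, e1, e2, hv p hpD, Finset.sum_add_distrib, symTest]
    ring
  rw [integral_congr_ae e, integral_add hi (integrableOn_D_reflect hi), setIntegral_D_reflect]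
  ring

theorem redDeriv_add (a : ℝ) (x y z : E 3) :
    redDeriv a x (y + z) = redDeriv a x y + redDeriv a x z := by
  simp only [redDeriv, PDeriv, inner_add_right, PiLp.add_apply]; ring

/-- `P` and the norm are even in the third component, so flipping the sign there in both arguments
changes nothing. -/
theorem redDeriv_parity (a : ℝ) {x x' y y' : E 3} (hx : ∀ j, x' j = parity j * x j)
    (hy : ∀ j, y' j = parity j * y j) : redDeriv a x' y' = redDeriv a x y := by
  have hn : ‖x'‖ ^ 2 = ‖x‖ ^ 2 := by
    simp only [EuclideanSpace.norm_sq_eq, hx, Real.norm_eq_abs, sq_abs, mul_pow, sq (parity _),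
      parity_mul_self, one_mul]
  have hin : (inner ℝ x' y' : ℝ) = inner ℝ x y := by
    rw [inner_eq_sum, inner_eq_sum]
    refine Finset.sum_congr rfl fun j _ => ?_
    rw [hx, hy]
    linear_combination (x j * y j) * parity_mul_self j
  rw [redDeriv, redDeriv, hn, hin, PDeriv, PDeriv]
  simp only [hx, hy, parity, Matrix.cons_val_zero, Matrix.cons_val_one, Matrix.cons_val]
  ring

/-- The Euler-Lagrange equation for test functions supported in the upper quarter disk. -/
theorem euler_lagrange (ha : 0 < a) (hμ : 0 < μ) (hm : IsMinimizer a μ (Obst a μ C) w)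
    (h : IsRep a w V G) (hu : IsAug w u)
    (hp : ∀ p ∈ D, ∀ j, u (reflect p) j = parity j * u p j) (hψ : ∀ j, IsTest Dplus (ψ j)) :
    ∑ j, ∫ p in D, redForm (augGrad (extGrad a G) j) (fun p => u p j) (augDeg j) (ψ j) p
      = μ * ∫ p in D, p 0 * redDeriv a (u p) (toProf ψ p) := by
  have i4 := (integrable_pot_iff ha h.aestronglyMeasurable).1 (Obst.integrable_pot hμ hm.1 h)
  have hψD := fun j => (hψ j).mono (Dplus_subset_slitD.trans slitD_subset)
  have hi := (potDeriv_axField ha h i4 hu hψD).1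
  have e0 := euler_lagrange_symm ha hμ hm h hu (fun j => isTest_symTest (hψ j) (parity j))
    fun j p => by
      simp only [symTest, reflect_reflect]
      linear_combination (-ψ j (reflect p)) * parity_mul_self j
  have e1 : ∀ j, ∫ p in D, (p 0 * (∑ i, augGrad (extGrad a G) j p i
        * pd i (symTest (parity j) (ψ j)) p)
        + (p 0)⁻¹ * ((augDeg j : ℝ) ^ 2 * (u p j * symTest (parity j) (ψ j) p)))
      = 2 * ∫ p in D, redForm (augGrad (extGrad a G) j) (fun p => u p j) (augDeg j) (ψ j) p :=
    fun j => integral_redForm_symTest (h.hasWeakGradient_profile hu j) (parity_mul_self j)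
      (fun p hpD => hp p hpD j) (hψ j) (augDeg j)
  have e2 : ∫ p in D, p 0 * redDeriv a (u p) (toProf (fun j => symTest (parity j) (ψ j)) p)
      = 2 * ∫ p in D, p 0 * redDeriv a (u p) (toProf ψ p) := by
    have e3 : ∀ p ∈ D, p 0 * redDeriv a (u p) (toProf (fun j => symTest (parity j) (ψ j)) p)
        = p 0 * redDeriv a (u p) (toProf ψ p)
          + reflect p 0 * redDeriv a (u (reflect p)) (toProf ψ (reflect p)) := fun p hpD => by
      have e4 : toProf (fun j => symTest (parity j) (ψ j)) p
          = toProf ψ p + WithLp.toLp 2 fun j => parity j * ψ j (reflect p) := by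
        ext j; simp [toProf, symTest]
      have e5 : redDeriv a (u (reflect p)) (toProf ψ (reflect p))
          = redDeriv a (u p) (WithLp.toLp 2 fun j => parity j * ψ j (reflect p)) :=
        redDeriv_parity a (hp p hpD) fun j => by
          simp only [toProf]
          rw [← mul_assoc, parity_mul_self, one_mul]
      have e6 : reflect p 0 = p 0 := by rw [reflect_apply]; simp [reflSign]
      rw [e4, redDeriv_add, e5, e6, mul_add]
    rw [setIntegral_congr_fun isOpen_D.measurableSet e3,
      integral_add hi (integrableOn_D_reflect hi),
      setIntegral_D_reflect fun p => p 0 * redDeriv a (u p) (toProf ψ p)]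
    ring
  rw [Finset.sum_congr rfl fun j _ => e1 j, ← Finset.mul_sum, e2] at e0
  linarith

theorem Dplus_subset_D : Dplus ⊆ D := fun _ hp => hp.1

/-- Minimizers of the obstacle problem solve the reduced Euler-Lagrange system. -/
theorem isReducedSolution (ha : 0 < a) (hμ : 0 < μ) (hm : IsMinimizer a μ (Obst a μ C) w) :
    IsReducedSolution a μ w := by
  obtain ⟨V, G, h⟩ := hm.1.1.1.exists_isRep
  obtain ⟨u, hu, hsym⟩ := hm.1.1.2
  have hp : ∀ p ∈ D, ∀ j, u (reflect p) j = parity j * u p j := fun p hpD j => by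
    obtain ⟨h0, h1, h2⟩ := hsym p hpD
    rw [← reflect_eq] at h0 h1 h2
    fin_cases j <;> simp [parity, h0, h1, h2]
  have i4 := (integrable_pot_iff ha h.aestronglyMeasurable).1 (Obst.integrable_pot hμ hm.1 h)
  refine ⟨u, hu, ⟨augGrad (extGrad a G),
    fun j => (h.hasWeakGradient_profile hu j).mono Dplus_subset_D,
    fun j => (locallyIntegrableOn_augGrad_sq h.weakPair j).mono_set
      (Dplus_subset_D.trans D_subset_rightHalf),
    (locallyIntegrableOn_profile_pow_four hu i4).mono_set Dplus_subset_D, fun η hη => ?_⟩,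
    h.eqOnArc hu⟩
  have hψ : ∀ j, IsTest Dplus fun p => η p j := fun j =>
    ⟨(contDiff_coord j).comp hη.1,
      hη.2.1.comp_left (g := fun x : E 3 => x j) rfl,
      (tsupport_comp_subset (g := fun x : E 3 => x j) rfl η).trans hη.2.2⟩
  have hψD := fun j => (hψ j).mono Dplus_subset_D
  have e0 := euler_lagrange ha hμ hm h hu hp hψ
  have hpm : MeasurableSet Dplus := (isOpen_D.inter
    (isOpen_lt continuous_const (contDiff_coord (n := 2) 1).continuous)).measurableSet
  -- Both integrands vanish where the test function and its derivatives do, so the integrals over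
  -- `D` reduce to `Dplus`.
  rw [← integral_finsetSum _ fun j _ =>
    integrableOn_redForm (h.hasWeakGradient_profile hu j) (hψD j) (augDeg j),
    ← integral_const_mul,
    setIntegral_eq_of_subset_of_forall_sdiff_eq_zero isOpen_D.measurableSet Dplus_subset_D
      fun p hp => ?_,
    setIntegral_eq_of_subset_of_forall_sdiff_eq_zero isOpen_D.measurableSet Dplus_subset_D
      fun p hp => ?_] at e0
  · refine (setIntegral_congr_fun hpm fun p _ => ?_).trans
      (e0.trans (setIntegral_congr_fun hpm fun p _ => ?_))
    · simp only [redForm, Fin.sum_univ_three, augDeg, Matrix.cons_val_zero, Matrix.cons_val_one,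
        Matrix.cons_val]
      push_cast
      ring
    · have : toProf (fun j p => η p j) p = η p := by ext j; rfl
      simp only [this, ← redDeriv_eq]
      ring
  · have : toProf (fun j p => η p j) p = 0 := by
      ext j
      exact (hψ j).eq_zero_of_notMem hp.2
    rw [this, redDeriv_zero]; simp
  · refine Finset.sum_eq_zero fun j _ => ?_
    simp only [redForm, (hψ j).eq_zero_of_notMem hp.2,
      ((hψ j).pd _).eq_zero_of_notMem hp.2]
    simp

theorem H_pos (ha : 0 < a) : 0 < H a := by rw [H]; positivity

end WeakSolution

end LdG

/-! ### The two obstacle problems -/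

theorem mainTheorem9 (a μ b c : ℝ) (ha : 0 < a) (hμ : 0 < μ)
    (hb : b ∈ Set.Ioc (-1 : ℝ) (-1 / 2)) (hc : c ∈ Set.Ico (-1 / 2 : ℝ) 1) :
    ((∃ w, LdG.IsMinimizer a μ (LdG.Fplus a μ b) w) ∧
      ∀ w, LdG.IsMinimizer a μ (LdG.Fplus a μ b) w → LdG.IsReducedSolution a μ w) ∧
    ((∃ w, LdG.IsMinimizer a μ (LdG.Fminus a μ c) w) ∧
      ∀ w, LdG.IsMinimizer a μ (LdG.Fminus a μ c) w → LdG.IsReducedSolution a μ w) := by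
  have hH := LdG.H_pos ha
  rw [LdG.Fplus_eq_Obst, LdG.Fminus_eq_Obst]
  -- Because `H_a > 0`, the inequalities `b ≤ -1/2` and `-1/2 ≤ c` place the competitor's trace
  -- `-H_a/2` in the respective half line.
  exact ⟨⟨LdG.exists_isMinimizer ha hμ (convex_Ici _) isClosed_Ici
      (mul_le_mul_of_nonneg_right hb.2 hH.le), fun _ hm => LdG.isReducedSolution ha hμ hm⟩,
    LdG.exists_isMinimizer ha hμ (convex_Iic _) isClosed_Iic
      (mul_le_mul_of_nonneg_right hc.1 hH.le), fun _ hm => LdG.isReducedSolution ha hμ hm⟩
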